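/- **Setting.** Let $T$ be a finite rooted tree with root $r$ (the depot), every vertex having at most two children, with edge lengths $\ell\ge 0$; the clients are the leaves of $T$. A *tour* is a closed walk in $T$ from $r$ to $r$; its length is the sum of the lengths of the edges it traverses, with multiplicity. A *solution* consists of $k$ tours that together visit all clients; its *makespan* is the maximum length of a tour. The *load* of a set of edges is twice its total length. Fix $D\ge 0$ and $0<\hat\epsilon\le 1$. *Condensing.* For $v\ne r$, the $v$-branch is the subtree rooted at $v$ together with the edge from $v$ to its parent. Let $\mathcal B$ be the set of maximal branches of load at most $\hat\epsilon D$. In the condensed tree every $b\in\mathcal B$ is replaced by one leaf edge of the same load, at whose leaf all clients of $b$ are located; a tour covers this leaf edge if it visits all clients of $b$. *Clusters.* A *leaf cluster* is a leaf edge of the condensed tree of load at least $\frac{\hat\epsilon}{2}D$; the other leaf edges are *small*. The *backbone* is the union of the paths from $r$ to the upper endpoints of the leaf clusters. The tree is assumed to be preprocessed (by merging small sibling branches with zero-length edges and by subdividing edges) so that every edge of the condensed tree is a backbone edge, a leaf cluster, or a small leaf edge attached to a vertex of the backbone. A *woolly edge* is a maximal path of the backbone between branching points (or ends) of the backbone with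 attached leaf clusters, together with the small leaf edges off this path; a *woolly subedge* of it is a contiguous part in the order of distance from $r$, where the small leaf edge at a backbone vertex $x$ comes between the backbone edges above and below $x$. A woolly edge of load less than $\frac{\hat\epsilon^2}{2}D$ is a *small cluster*. Every other woolly edge is partitioned into woolly subedges, the *edge clusters*, each of load in $[\frac{\hat\epsilon^2}{2}D,\ \kappa\frac{\hat\epsilon}{2}D]$, where $\kappa\ge 1$ is a constant (the basic case is $\kappa=1$). *Coverage.* A cluster has *single coverage* if one tour visits all of its clients and no other tour visits any of them. For an edge cluster $C$, a tour that visits clients of $C$ is *$C$-collecting* if it contains all backbone edges of $C$, and *$C$-ending* otherwise. $C$ has *split coverage* if, with the small leaf edges of $C$ ordered by distance from $r$ as $e_1,\dots,e_q$, there are $1\le i<q$, a $C$-ending tour that covers $e_1,\dots,e_i$, and a $C$-collecting tour that covers $e_{i+1},\dots,e_q$, and no client of $C$ is visited by any tour other than the one covering its leaf edge. **Theorem.** For every $\kappa\ge1$ there are constants $c_1,c_2>0$, depending only on $\kappa$, such that for every such tree, all $k$, $D\ge0$, $0<\hat\epsilon\le1$ and every choice of edge clusters as above: if there is a solution with $k$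 tours of makespan at most $D$, then there is a solution with $k$ tours of makespan at most $(1+c_1\hat\epsilon)D$ with simple structure, that is, in which 1. all leaf clusters and all small clusters have single coverage, 2. every edge cluster has single or split coverage, and 3. every tour visits clients of at most $c_2/\hat\epsilon^{3}$ clusters. -/

import Mathlib

universe u

noncomputable section

namespace Makespan

variable {T : RootedTree.{u}} [Fintype T]

/-! A rooted tree is Mathlib's `RootedTree`: `u ≤ v` says that `u` is an ancestor of `v`, the root
(the depot) is `⊥`, the parent of `v ≠ ⊥` is `Order.pred v`, and the edges are the pairs `u ⋖ v`,
i.e. the edges of `SimpleGraph.hasse T`. Clients are the leaves, i.e. the maximal elements. -/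

/-- Every vertex has at most two children. -/
def IsBinary (T : RootedTree.{u}) : Prop := ∀ x : T, {v : T | x ⋖ v}.ncard ≤ 2

/-- The edge between `v` and its parent (meaningful for `v ≠ ⊥`). Sets of edges are represented
below by the sets of their lower endpoints. -/
def parentEdge (v : T) : Sym2 T := s(Order.pred v, v)

/-! ### Tours and solutions -/

/-- A tour is a closed walk in the tree that starts and ends at the depot. -/
abbrev Tour (T : RootedTree.{u}) := (SimpleGraph.hasse T).Walk ⊥ ⊥

/-- The length of a tour; every traversal of an edge counts. -/
def tourLength (ℓ : Sym2 T → ℝ) (p : Tour T) : ℝ := (p.edges.map ℓ).sum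

/-- The tours serve all clients. -/
def Feasible {k : ℕ} (τ : Fin k → Tour T) : Prop :=
  ∀ c : T, IsMax c → ∃ i, c ∈ (τ i).support

/-- No tour is longer than `M`. -/
def MakespanLE (ℓ : Sym2 T → ℝ) {k : ℕ} (τ : Fin k → Tour T) (M : ℝ) : Prop :=
  ∀ i, tourLength ℓ (τ i) ≤ M

/-! ### Condensing -/

/-- The load of the `v`-branch at the parent of `v`: twice the length of the subtree rooted at `v`
together with the parent edge of `v`. -/
def branchLoad (ℓ : Sym2 T → ℝ) (v : T) : ℝ :=
  2 * ∑ w, (Set.Ici v).indicator (fun w => ℓ (parentEdge w)) w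

/-- The `v`-branch is a maximal branch of load at most `δ D`, hence is condensed to a leaf edge.
(There is no branch above a child of the root.) -/
def Condensed (ℓ : Sym2 T → ℝ) (δ D : ℝ) (v : T) : Prop :=
  v ≠ ⊥ ∧ branchLoad ℓ v ≤ δ * D ∧
    (Order.pred v = ⊥ ∨ δ * D < branchLoad ℓ (Order.pred v))

/-- `v` is a vertex of the condensed tree: it is not strictly below the top of a condensed branch. -/
def Kept (ℓ : Sym2 T → ℝ) (δ D : ℝ) (v : T) : Prop :=
  ∀ b, Condensed ℓ δ D b → ¬ b < v

/-- The load of the parent edge of `v` in the condensed tree. -/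
def condLoad (ℓ : Sym2 T → ℝ) (δ D : ℝ) (v : T) : ℝ :=
  open Classical in
  if Condensed ℓ δ D v then branchLoad ℓ v else 2 * ℓ (parentEdge v)

/-- The load in the condensed tree of a set of edges. -/
def setLoad (ℓ : Sym2 T → ℝ) (δ D : ℝ) (A : Set T) : ℝ :=
  ∑ v, A.indicator (condLoad ℓ δ D) v

/-- The parent edge of `v` is a leaf edge of the condensed tree. -/
def IsLeafEdge (ℓ : Sym2 T → ℝ) (δ D : ℝ) (v : T) : Prop :=
  v ≠ ⊥ ∧ Kept ℓ δ D v ∧ ∀ w, v < w → ¬ Kept ℓ δ D w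

/-- A leaf cluster: a leaf edge of the condensed tree of load at least `δ D / 2`. -/
def IsLeafCluster (ℓ : Sym2 T → ℝ) (δ D : ℝ) (v : T) : Prop :=
  IsLeafEdge ℓ δ D v ∧ δ / 2 * D ≤ condLoad ℓ δ D v

/-- The remaining leaf edges of the condensed tree, of load less than `δ D / 2`. -/
def IsSmallLeaf (ℓ : Sym2 T → ℝ) (δ D : ℝ) (v : T) : Prop :=
  IsLeafEdge ℓ δ D v ∧ condLoad ℓ δ D v < δ / 2 * D

/-- `x` is a vertex of the backbone, the union of the paths from the root to the upper endpoints of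
the leaf clusters. -/
def OnBackbone (ℓ : Sym2 T → ℝ) (δ D : ℝ) (x : T) : Prop :=
  ∃ w, IsLeafCluster ℓ δ D w ∧ x < w

/-- The parent edge of `v` belongs to the backbone. -/
def IsBackboneEdge (ℓ : Sym2 T → ℝ) (δ D : ℝ) (v : T) : Prop :=
  v ≠ ⊥ ∧ OnBackbone ℓ δ D v

/-- Every edge of the condensed tree is a backbone edge, a leaf cluster, or a small leaf edge whose
upper endpoint is on the backbone. -/
def IsWoollyTree (ℓ : Sym2 T → ℝ) (δ D : ℝ) : Prop :=
  ∀ v, v ≠ ⊥ → Kept ℓ δ D v →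
    IsBackboneEdge ℓ δ D v ∨ IsLeafCluster ℓ δ D v ∨
      (IsSmallLeaf ℓ δ D v ∧ OnBackbone ℓ δ D (Order.pred v))

/-! ### Woolly edges and clusters -/

/-- `y` is a branching point of the backbone (with the leaf clusters attached): two distinct child
edges of `y` are backbone edges or leaf clusters. -/
def IsBranching (ℓ : Sym2 T → ℝ) (δ D : ℝ) (y : T) : Prop :=
  ∃ a b, y ⋖ a ∧ y ⋖ b ∧ a ≠ b ∧
    (IsBackboneEdge ℓ δ D a ∨ IsLeafCluster ℓ δ D a) ∧
    (IsBackboneEdge ℓ δ D b ∨ IsLeafCluster ℓ δ D b)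

/-- The backbone vertex of an edge of the backbone or of a small leaf edge: the lower endpoint of a
backbone edge, the attachment vertex of a small leaf edge. -/
def foot (ℓ : Sym2 T → ℝ) (δ D : ℝ) (v : T) : T :=
  open Classical in if IsSmallLeaf ℓ δ D v then Order.pred v else v

/-- One of `x`, `y` is an ancestor of the other, and walking down from the upper one to the lower
one no branching point is left behind; the lower endpoint itself may be a branching point. -/
def SamePath (ℓ : Sym2 T → ℝ) (δ D : ℝ) (x y : T) : Prop :=
  (x ≤ y ∧ ∀ z, x ≤ z → z < y → ¬ IsBranching ℓ δ D z) ∨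
    (y ≤ x ∧ ∀ z, y ≤ z → z < x → ¬ IsBranching ℓ δ D z)

/-- `W` is a woolly edge: a maximal backbone path between branching points (or ends) of the
backbone, together with the small leaf edges off this path. -/
def IsWoollyEdge (ℓ : Sym2 T → ℝ) (δ D : ℝ) (W : Set T) : Prop :=
  W.Nonempty ∧ ∃ x, OnBackbone ℓ δ D x ∧
    W = {v | (IsBackboneEdge ℓ δ D v ∨ IsSmallLeaf ℓ δ D v) ∧
      OnBackbone ℓ δ D (foot ℓ δ D v) ∧ SamePath ℓ δ D x (foot ℓ δ D v)}

/-- A small cluster: a woolly edge of load less than `ε δ D / 2`. -/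
def IsSmallCluster (ℓ : Sym2 T → ℝ) (ε δ D : ℝ) (W : Set T) : Prop :=
  IsWoollyEdge ℓ δ D W ∧ setLoad ℓ δ D W < ε * δ / 2 * D

/-- The order of the edges along a woolly edge, in increasing distance from the depot: the small
leaf edge at a backbone vertex `x` comes after the backbone edge above `x` and before the one
below `x`. -/
def Before (ℓ : Sym2 T → ℝ) (δ D : ℝ) (a b : T) : Prop :=
  foot ℓ δ D a < foot ℓ δ D b ∨
    (foot ℓ δ D a = foot ℓ δ D b ∧ ¬ IsSmallLeaf ℓ δ D a ∧ IsSmallLeaf ℓ δ D b)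

/-- `C` is a woolly subedge of the woolly edge `W`: a contiguous part of it. (The small leaf edge
at the common endpoint of two consecutive subpaths may belong to either part.) -/
def IsSubedge (ℓ : Sym2 T → ℝ) (δ D : ℝ) (W C : Set T) : Prop :=
  C.Nonempty ∧ C ⊆ W ∧
    ∀ a ∈ C, ∀ c ∈ C, ∀ b ∈ W, Before ℓ δ D a b → Before ℓ δ D b c → b ∈ C

/-- `𝒞` is a choice of edge clusters: a partition of every woolly edge that is not a small cluster
into woolly subedges with loads in `[ε δ D / 2, κ δ D / 2]`. -/
structure IsEdgeClustering (ℓ : Sym2 T → ℝ) (ε δ D κ : ℝ) (𝒞 : Set (Set T)) : Prop where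
  subedge : ∀ C ∈ 𝒞, ∃ W, IsWoollyEdge ℓ δ D W ∧ ¬ IsSmallCluster ℓ ε δ D W ∧
    IsSubedge ℓ δ D W C
  load_ge : ∀ C ∈ 𝒞, ε * δ / 2 * D ≤ setLoad ℓ δ D C
  load_le : ∀ C ∈ 𝒞, setLoad ℓ δ D C ≤ κ * (δ / 2 * D)
  disjoint : 𝒞.PairwiseDisjoint id
  cover : ∀ W, IsWoollyEdge ℓ δ D W → ¬ IsSmallCluster ℓ ε δ D W → ∀ v ∈ W, ∃ C ∈ 𝒞, v ∈ C

/-- The clusters: leaf clusters, small clusters and edge clusters, as sets of edges of the condensed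
tree. -/
def clusters (ℓ : Sym2 T → ℝ) (ε δ D : ℝ) (𝒞 : Set (Set T)) : Set (Set T) :=
  {C | (∃ v, IsLeafCluster ℓ δ D v ∧ C = {v}) ∨ IsSmallCluster ℓ ε δ D C ∨ C ∈ 𝒞}

/-- The clients of a cluster: those of the (condensed) branches at its leaf edges. -/
def clients (ℓ : Sym2 T → ℝ) (δ D : ℝ) (C : Set T) : Set T :=
  {c | IsMax c ∧ ∃ e ∈ C, IsLeafEdge ℓ δ D e ∧ e ≤ c}

/-! ### Simple structure -/

/-- A single tour covers all clients of `C` (and no other tour visits a client of `C`). -/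
def SingleCoverage (ℓ : Sym2 T → ℝ) (δ D : ℝ) {k : ℕ} (τ : Fin k → Tour T) (C : Set T) : Prop :=
  ∃ i, ∀ c ∈ clients ℓ δ D C, ∀ j, c ∈ (τ j).support ↔ j = i

/-- The tour `p` traverses `C`: it contains all backbone edges of `C`. -/
def Traverses (ℓ : Sym2 T → ℝ) (δ D : ℝ) (p : Tour T) (C : Set T) : Prop :=
  ∀ v ∈ C, IsBackboneEdge ℓ δ D v → parentEdge v ∈ p.edges

/-- The tour `p` covers clients in `C`. -/
def CoversSome (ℓ : Sym2 T → ℝ) (δ D : ℝ) (p : Tour T) (C : Set T) : Prop :=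
  ∃ c ∈ clients ℓ δ D C, c ∈ p.support

/-- A `C`-collecting tour traverses `C` and covers clients in `C`. -/
def IsCollecting (ℓ : Sym2 T → ℝ) (δ D : ℝ) (p : Tour T) (C : Set T) : Prop :=
  Traverses ℓ δ D p C ∧ CoversSome ℓ δ D p C

/-- A `C`-ending tour covers clients in `C` but does not traverse `C`. -/
def IsEnding (ℓ : Sym2 T → ℝ) (δ D : ℝ) (p : Tour T) (C : Set T) : Prop :=
  ¬ Traverses ℓ δ D p C ∧ CoversSome ℓ δ D p C

/-- Split coverage of an edge cluster `C`: a `C`-ending tour `i` covers the leaf edges of `C` up to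
some leaf edge `e₀`, a `C`-collecting tour `j` covers all later leaf edges of `C`, and nothing else
of the leaf edges of `C` is visited by any tour. To cover a leaf edge is to cover the whole branch
condensed to it. -/
def SplitCoverage (ℓ : Sym2 T → ℝ) (δ D : ℝ) {k : ℕ} (τ : Fin k → Tour T) (C : Set T) : Prop :=
  ∃ i j, IsEnding ℓ δ D (τ i) C ∧ IsCollecting ℓ δ D (τ j) C ∧
    ∃ e₀ ∈ C, IsSmallLeaf ℓ δ D e₀ ∧ ∀ e ∈ C, IsSmallLeaf ℓ δ D e → ∀ c, IsMax c → e ≤ c →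
      ((e = e₀ ∨ Before ℓ δ D e e₀) → ∀ t, c ∈ (τ t).support ↔ t = i) ∧
      (Before ℓ δ D e₀ e → ∀ t, c ∈ (τ t).support ↔ t = j)

/-- Simple structure, where every tour covers clients in at most `N` clusters. -/
structure HasSimpleStructure (ℓ : Sym2 T → ℝ) (ε δ D : ℝ) (𝒞 : Set (Set T)) {k : ℕ}
    (τ : Fin k → Tour T) (N : ℝ) : Prop where
  leaf : ∀ v, IsLeafCluster ℓ δ D v → SingleCoverage ℓ δ D τ {v}
  small : ∀ W, IsSmallCluster ℓ ε δ D W → SingleCoverage ℓ δ D τ W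
  edge : ∀ C ∈ 𝒞, SingleCoverage ℓ δ D τ C ∨ SplitCoverage ℓ δ D τ C
  count : ∀ i, ({C ∈ clusters ℓ ε δ D 𝒞 | CoversSome ℓ δ D (τ i) C}.ncard : ℝ) ≤ N

end Makespan

end

/-!
Only the set of vertices visited by a tour and the load of that set matter: the set is closed
under taking ancestors, a tour traverses the parent edge of every visited vertex at least twice
(`Makespan.cost_visited_le`), and every set of vertices closed under taking ancestors and containing
the root is visited by a tour that traverses each of its edges exactly twice
(`Makespan.exists_tour`). So loads of lower sets are compared instead of tours.

The basic tool is a rounding lemma for fractional assignments of jobs to machines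
(`Makespan.exists_rounding`): jobs can be assigned to single machines such that no load exceeds the
fractional load by more than the largest job. Each leaf cluster is a job, and the machines are the
tours that visit it. (A leaf cluster that is a single long edge may be too large for the rounding
error, but it lies entirely with every tour that visits it, so it needs no rounding.) An edge
cluster `C` gives two jobs. The tours that end in `C` together cover a certain load `L` of its small
leaf edges. One of them should take over the initial part of `C` of load `L`, together with the
backbone down to it, and one of the tours that pass `C`, which contain its backbone anyway, should
take over the rest (`Makespan.Setting.exists_isSplit`). One leaf edge may straddle the cut. After
the jobs are assigned, the straddling leaf edges are jobs, each of which can be done by the two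
tours that share its cluster, and they are assigned by rounding once more. Each rounding increases
the length of a tour by `O(ε D)` only (`Makespan.Setting.exists_rounded`).

Then small contributions are removed. If one of the two parts of an edge cluster has load less than
`ε³ D / 4`, then the cluster goes to the tour of the other part; as the cluster has load at least
`ε² D / 2`, this costs a factor `1 + ε` (`Makespan.Setting.exists_thresholded`). Hence a tour covers
clients in `O(1 / ε³)` edge clusters, and in `O(1 / ε)` leaf clusters because of their load.

Small clusters are not rounded, as their number could not be bounded by their load. Each of them is
charged to a leaf cluster below it, at most two to the same one
(`Makespan.exists_leafCluster_of_woollyEdge`), and goes to the tour that covers this leaf cluster,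
which traverses the small cluster in any case. So each tour gets `O(1 / ε)` small clusters, of total
load `O(ε D)`.

The new tours retain the backbone edges of the small clusters and of the edge clusters that they
pass (`Makespan.base`). That nothing else is needed above the leaf edges assigned to a tour
(`Makespan.IsAssignment.mem_base_or`) rests on the fact that a path down the tree cannot enter a
cluster through a backbone edge and leave it without passing all of its backbone
(`Makespan.Setting.foot_le_foot`).
-/

/-! ### Rounding fractional assignments -/

namespace Makespan

section Rounding

variable {J M : Type*} [Fintype J] [Fintype M]

/-- If every row and every column of the support of a nonzero matrix `y` has no entry or at least
two, then some nonzero matrix supported there has vanishing row and column sums: the support has at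
least as many entries as there are nonzero rows and columns, and the last column sum is
redundant. -/
lemma exists_circulation (y : J → M → ℝ) (hy : ∃ j i, y j i ≠ 0)
    (hrow : ∀ j i, y j i ≠ 0 → ∃ i', i' ≠ i ∧ y j i' ≠ 0)
    (hcol : ∀ j i, y j i ≠ 0 → ∃ j', j' ≠ j ∧ y j' i ≠ 0) :
    ∃ z : J → M → ℝ, (∃ j i, z j i ≠ 0) ∧ (∀ j i, y j i = 0 → z j i = 0) ∧
      (∀ j, ∑ i, z j i = 0) ∧ ∀ i, ∑ j, z j i = 0 := by
  classical
  obtain ⟨j₀, i₀, h₀⟩ := hy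
  set E : Finset (J × M) := Finset.univ.filter fun e => y e.1 e.2 ≠ 0 with hE
  set A : Finset J := Finset.univ.filter fun j => ∃ i, y j i ≠ 0 with hA
  set B : Finset M := Finset.univ.filter fun i => ∃ j, y j i ≠ 0 with hB
  have hAE : 2 * A.card ≤ E.card := by
    refine Finset.mul_card_image_le_card_of_maps_to (f := Prod.fst) ?_ 2 ?_
    · rintro ⟨j, i⟩ h
      simp only [hE, Finset.mem_filter, Finset.mem_univ, true_and] at h
      simp only [hA, Finset.mem_filter, Finset.mem_univ, true_and]
      exact ⟨i, h⟩
    · intro j hj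
      simp only [hA, Finset.mem_filter, Finset.mem_univ, true_and] at hj
      obtain ⟨i, hi⟩ := hj
      obtain ⟨i', hne, hi'⟩ := hrow j i hi
      refine Nat.succ_le_of_lt (Finset.one_lt_card.2 ⟨(j, i), ?_, (j, i'), ?_, ?_⟩)
      · simpa [hE] using hi
      · simpa [hE] using hi'
      · simpa using hne.symm
  have hBE : 2 * B.card ≤ E.card := by
    refine Finset.mul_card_image_le_card_of_maps_to (f := Prod.snd) ?_ 2 ?_
    · rintro ⟨j, i⟩ h
      simp only [hE, Finset.mem_filter, Finset.mem_univ, true_and] at h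
      simp only [hB, Finset.mem_filter, Finset.mem_univ, true_and]
      exact ⟨j, h⟩
    · intro i hi
      simp only [hB, Finset.mem_filter, Finset.mem_univ, true_and] at hi
      obtain ⟨j, hj⟩ := hi
      obtain ⟨j', hne, hj'⟩ := hcol j i hj
      refine Nat.succ_le_of_lt (Finset.one_lt_card.2 ⟨(j, i), ?_, (j', i), ?_, ?_⟩)
      · simpa [hE] using hj
      · simpa [hE] using hj'
      · simpa using hne.symm
  let ext : (E → ℝ) →ₗ[ℝ] (J → M → ℝ) :=
    { toFun := fun x j i => if h : (j, i) ∈ E then x ⟨(j, i), h⟩ else 0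
      map_add' := by
        intro x x'
        funext j i
        by_cases h : (j, i) ∈ E <;> simp [h]
      map_smul' := by
        intro c x
        funext j i
        by_cases h : (j, i) ∈ E <;> simp [h] }
  let F : (E → ℝ) →ₗ[ℝ] (A → ℝ) × ((↥(B.erase i₀)) → ℝ) :=
    LinearMap.prod
      (LinearMap.pi fun j => ∑ i, (LinearMap.proj i ∘ₗ LinearMap.proj (j : J)) ∘ₗ ext)
      (LinearMap.pi fun i => ∑ j, (LinearMap.proj (i : M) ∘ₗ LinearMap.proj j) ∘ₗ ext)
  have hi₀ : i₀ ∈ B := by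
    simp only [hB, Finset.mem_filter, Finset.mem_univ, true_and]
    exact ⟨_, h₀⟩
  have hker : LinearMap.ker F ≠ ⊥ := by
    apply LinearMap.ker_ne_bot_of_finrank_lt
    rw [Module.finrank_prod, Module.finrank_pi, Module.finrank_pi, Module.finrank_pi,
      Fintype.card_coe, Fintype.card_coe, Fintype.card_coe, Finset.card_erase_of_mem hi₀]
    have : 0 < B.card := Finset.card_pos.2 ⟨_, hi₀⟩
    omega
  obtain ⟨x, hx, hx0⟩ := (Submodule.ne_bot_iff _).1 hker
  have hz : ∀ j i, y j i = 0 → ext x j i = 0 := by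
    intro j i h
    have : (j, i) ∉ E := by simp [hE, h]
    simp [ext, this]
  have hF1 : ∀ j, ∑ i, ext x j i = 0 := by
    intro j
    by_cases hj : j ∈ A
    · have := congrFun (congrArg Prod.fst (LinearMap.mem_ker.1 hx)) ⟨j, hj⟩
      simpa [F] using this
    · refine Finset.sum_eq_zero fun i _ => hz j i ?_
      by_contra h
      exact hj (by simp only [hA, Finset.mem_filter, Finset.mem_univ, true_and]; exact ⟨i, h⟩)
  have hF2 : ∀ i, i ≠ i₀ → ∑ j, ext x j i = 0 := by
    intro i hne
    by_cases hi : i ∈ B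
    · have := congrFun (congrArg Prod.snd (LinearMap.mem_ker.1 hx))
        ⟨i, Finset.mem_erase.2 ⟨hne, hi⟩⟩
      simpa [F] using this
    · refine Finset.sum_eq_zero fun j _ => hz j i ?_
      by_contra h
      exact hi (by simp only [hB, Finset.mem_filter, Finset.mem_univ, true_and]; exact ⟨j, h⟩)
  refine ⟨ext x, ?_, hz, hF1, ?_⟩
  · by_contra! h
    apply hx0
    funext e
    have := h e.1.1 e.1.2
    simpa [ext] using this
  · intro i
    by_cases hne : i = i₀
    · have h1 : ∑ i, ∑ j, ext x j i = 0 := by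
        rw [Finset.sum_comm]
        exact Finset.sum_eq_zero fun j _ => hF1 j
      rw [← Finset.add_sum_erase _ _ (Finset.mem_univ i₀),
        Finset.sum_eq_zero (fun i hi => hF2 i (Finset.ne_of_mem_erase hi)), add_zero] at h1
      rw [hne, h1]
    · exact hF2 i hne

/-- Pushing mass along a circulation kills an entry of the support and changes no marginal. -/
lemma exists_smaller_support (y : J → M → ℝ) (h0 : ∀ j i, 0 ≤ y j i) (hy : ∃ j i, y j i ≠ 0)
    (hrow : ∀ j i, y j i ≠ 0 → ∃ i', i' ≠ i ∧ y j i' ≠ 0)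
    (hcol : ∀ j i, y j i ≠ 0 → ∃ j', j' ≠ j ∧ y j' i ≠ 0) :
    ∃ y' : J → M → ℝ, (∀ j i, 0 ≤ y' j i) ∧ (∀ j i, y j i = 0 → y' j i = 0) ∧
      (∃ j i, y j i ≠ 0 ∧ y' j i = 0) ∧
      (∀ j, ∑ i, y' j i = ∑ i, y j i) ∧ ∀ i, ∑ j, y' j i = ∑ j, y j i := by
  classical
  obtain ⟨z, ⟨j₁, i₁, hz1⟩, hz0, hzr, hzc⟩ := exists_circulation y hy hrow hcol
  have hneg : ∃ e : J × M, z e.1 e.2 < 0 := by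
    by_contra! h
    have := (Finset.sum_eq_zero_iff_of_nonneg (fun i _ => h (j₁, i))).1 (hzr j₁) i₁
      (Finset.mem_univ _)
    exact hz1 this
  obtain ⟨e₀, he₀⟩ := hneg
  obtain ⟨e, he, hmin⟩ := Finset.exists_min_image
    (Finset.univ.filter fun e : J × M => z e.1 e.2 < 0) (fun e => y e.1 e.2 / (-z e.1 e.2))
    ⟨e₀, by simpa using he₀⟩
  simp only [Finset.mem_filter, Finset.mem_univ, true_and] at he hmin
  set t := y e.1 e.2 / (-z e.1 e.2) with ht
  have htn : 0 ≤ t := div_nonneg (h0 _ _) (by linarith)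
  refine ⟨fun j i => y j i + t * z j i, ?_, ?_, ⟨e.1, e.2, ?_, ?_⟩, ?_, ?_⟩
  · intro j i
    rcases lt_or_ge (z j i) 0 with h | h
    · have := hmin (j, i) h
      rw [le_div_iff₀ (by simpa using h)] at this
      simp only at this
      linarith
    · have := h0 j i
      positivity
  · intro j i h
    simp [h, hz0 j i h]
  · intro h
    rw [hz0 _ _ h] at he
    exact lt_irrefl _ he
  · rw [ht]
    have : z e.1 e.2 ≠ 0 := he.ne
    field_simp
    ring
  · intro j
    rw [Finset.sum_add_distrib, ← Finset.mul_sum, hzr, mul_zero, add_zero]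
  · intro i
    rw [Finset.sum_add_distrib, ← Finset.mul_sum, hzc, mul_zero, add_zero]

/-- Rounding a fractional assignment whose rows sum to the job sizes. Jobs of size more than `P` are
required to sit on one machine already. By induction on the support: a job or a machine of degree
one is removed by assigning its only edge, otherwise a circulation shrinks the support. -/
lemma exists_rounding_of_exact {P : ℝ} (hP : 0 ≤ P) (n : ℕ) : ∀ (y : J → M → ℝ),
    (∀ j i, 0 ≤ y j i) →
    (∀ j, ∑ i, y j i ≤ P ∨ ∃ i₀, ∀ i, i ≠ i₀ → y j i = 0) →
    {e : J × M | y e.1 e.2 ≠ 0}.ncard = n →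
    ∃ f : J → Option M, (∀ j, 0 < ∑ i, y j i → ∃ i, f j = some i ∧ 0 < y j i) ∧
      ∀ i, ∑ j, {j | f j = some i}.indicator (fun j => ∑ i, y j i) j ≤ ∑ j, y j i + P := by
  classical
  induction n using Nat.strong_induction_on with
  | _ n ih =>
  intro y h0 hbig hn
  -- removing a job `j` which is assigned to `i`
  have key : ∀ j i, y j i ≠ 0 → ((∀ i', i' ≠ i → y j i' = 0) ∨
      ((∀ j', j' ≠ j → y j' i = 0) ∧ ∑ i, y j i ≤ P)) →
      ∃ f : J → Option M, (∀ j, 0 < ∑ i, y j i → ∃ i, f j = some i ∧ 0 < y j i) ∧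
        ∀ i, ∑ j, {j | f j = some i}.indicator (fun j => ∑ i, y j i) j ≤ ∑ j, y j i + P := by
    intro j i hji hcase
    set y' : J → M → ℝ := fun a b => if a = j then 0 else y a b with hy'
    have hlt : {e : J × M | y' e.1 e.2 ≠ 0}.ncard < n := by
      rw [← hn]
      refine Set.ncard_lt_ncard ?_ (Set.toFinite _)
      refine ⟨fun e he => ?_, fun h => ?_⟩
      · simp only [hy', Set.mem_ofPred_eq] at he ⊢
        intro h
        simp [h] at he
      · have := h (show (j, i) ∈ {e : J × M | y e.1 e.2 ≠ 0} from hji)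
        simp [hy'] at this
    obtain ⟨f, hf1, hf2⟩ := ih _ hlt y' (fun a b => by
        simp only [hy']; split_ifs; exacts [le_rfl, h0 _ _]) (fun a => by
        by_cases ha : a = j
        · left
          simpa [hy', ha] using hP
        · simpa [hy', ha] using hbig a) rfl
    refine ⟨Function.update f j (some i), fun a ha => ?_, fun b => ?_⟩
    · by_cases haj : a = j
      · subst haj
        exact ⟨i, by simp, lt_of_le_of_ne (h0 _ _) (Ne.symm hji)⟩
      · have : ∑ i, y' a i = ∑ i, y a i := by simp [hy', haj]
        obtain ⟨c, hc, hc'⟩ := hf1 a (this ▸ ha)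
        refine ⟨c, by simp [haj, hc], ?_⟩
        simpa [hy', haj] using hc'
    · have hle : ∑ a, y a b = ∑ a, y' a b + y j b := by
        rw [← Finset.add_sum_erase _ _ (Finset.mem_univ j),
          ← Finset.add_sum_erase _ (fun a => y' a b) (Finset.mem_univ j)]
        have : y' j b = 0 := by simp [hy']
        rw [this, zero_add, add_comm]
        congr 1
        refine Finset.sum_congr rfl fun a ha => ?_
        simp [hy', Finset.ne_of_mem_erase ha]
      have hsum : ∑ a, {a | Function.update f j (some i) a = some b}.indicator
            (fun a => ∑ c, y a c) a
          = (if i = b then ∑ c, y j c else 0) +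
            ∑ a, {a | f a = some b}.indicator (fun a => ∑ c, y' a c) a := by
        rw [← Finset.add_sum_erase _ _ (Finset.mem_univ j),
          ← Finset.add_sum_erase _
            (fun a => {a | f a = some b}.indicator (fun a => ∑ c, y' a c) a) (Finset.mem_univ j)]
        have : {a | f a = some b}.indicator (fun a => ∑ c, y' a c) j = 0 := by
          simp [Set.indicator, hy']
        rw [this, zero_add]
        congr 1
        · simp [Set.indicator]
        · refine Finset.sum_congr rfl fun a ha => ?_
          have := Finset.ne_of_mem_erase ha
          simp [Set.indicator, hy', this]
      rw [hsum]
      have h2 := hf2 b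
      by_cases hb : i = b
      · subst hb
        rw [if_pos rfl]
        rcases hcase with hc | ⟨hc, hcP⟩
        · have : ∑ c, y j c = y j i :=
            Finset.sum_eq_single _ (fun c _ hc' => hc c hc') (by simp)
          linarith
        · have hz : ∑ a, {a | f a = some i}.indicator (fun a => ∑ c, y' a c) a = 0 := by
            refine Finset.sum_eq_zero fun a _ => ?_
            rw [Set.indicator_apply_eq_zero]
            intro ha
            by_contra hne
            have hpos : 0 < ∑ c, y' a c := lt_of_le_of_ne
              (Finset.sum_nonneg fun c _ => by
                simp only [hy']; split_ifs; exacts [le_rfl, h0 _ _]) (Ne.symm hne)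
            obtain ⟨c, hc1, hc2⟩ := hf1 a hpos
            have ha' : f a = some i := ha
            rw [ha'] at hc1
            obtain rfl := Option.some.inj hc1
            by_cases haj : a = j
            · simp [hy', haj] at hc2
            · simp [hy', haj, hc a haj] at hc2
          have := Finset.sum_nonneg (s := Finset.univ) fun a _ => h0 a i
          linarith
      · rw [if_neg hb, zero_add]
        have := h0 j b
        linarith
  by_cases hE : ∃ j i, y j i ≠ 0
  · by_cases hrow : ∀ j i, y j i ≠ 0 → ∃ i', i' ≠ i ∧ y j i' ≠ 0
    · have hsmall : ∀ j, ∑ i, y j i ≤ P := by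
        intro j
        rcases hbig j with h | ⟨i₀, hi₀⟩
        · exact h
        · by_cases hj : y j i₀ = 0
          · rw [Finset.sum_eq_zero]
            · exact hP
            · intro i _
              by_cases hi : i = i₀
              · rw [hi, hj]
              · exact hi₀ i hi
          · obtain ⟨i', hi', hne⟩ := hrow j i₀ hj
            exact absurd (hi₀ i' hi') hne
      by_cases hcol : ∀ j i, y j i ≠ 0 → ∃ j', j' ≠ j ∧ y j' i ≠ 0
      · obtain ⟨y', h0', hsup, ⟨j₁, i₁, hne, hz⟩, hr, hc⟩ :=
          exists_smaller_support y h0 hE hrow hcol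
        have hlt : {e : J × M | y' e.1 e.2 ≠ 0}.ncard < n := by
          rw [← hn]
          refine Set.ncard_lt_ncard ?_ (Set.toFinite _)
          refine ⟨fun e he h => he (hsup _ _ h), fun h => ?_⟩
          exact h (show (j₁, i₁) ∈ {e : J × M | y e.1 e.2 ≠ 0} from hne) hz
        obtain ⟨f, hf1, hf2⟩ := ih _ hlt y' h0' (fun j => Or.inl (by rw [hr]; exact hsmall j)) rfl
        simp only [hr] at hf1 hf2
        refine ⟨f, fun j hj => ?_, fun i => ?_⟩
        · obtain ⟨i, hi, hpos⟩ := hf1 j hj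
          refine ⟨i, hi, lt_of_le_of_ne (h0 _ _) fun h => ?_⟩
          rw [hsup _ _ h.symm] at hpos
          exact lt_irrefl _ hpos
        · rw [← hc i]
          exact hf2 i
      · push Not at hcol
        obtain ⟨j, i, hji, hj⟩ := hcol
        exact key j i hji (Or.inr ⟨hj, hsmall j⟩)
    · push Not at hrow
      obtain ⟨j, i, hji, hi⟩ := hrow
      exact key j i hji (Or.inl hi)
  · push Not at hE
    refine ⟨fun _ => none, fun j hj => ?_, fun i => ?_⟩
    · simp [hE] at hj
    · simpa [hE] using hP

/-- Jobs of sizes `p j ≥ 0`, covered by shares `y j i ≥ 0` of machines in `S j`, can be assigned to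
machines in `S j` such that the load of no machine exceeds its total share by more than `P`,
provided that every job larger than `P` is entirely in the share of some machine. -/
lemma exists_rounding [DecidableEq M] {P : ℝ} (hP : 0 ≤ P) (p : J → ℝ) (y : J → M → ℝ)
    (S : J → Set M) (hp : ∀ j, 0 ≤ p j) (hy : ∀ j i, 0 ≤ y j i) (hS : ∀ j, (S j).Nonempty)
    (hyS : ∀ j i, 0 < y j i → i ∈ S j) (hcov : ∀ j, p j ≤ ∑ i, y j i)
    (hbig : ∀ j, p j ≤ P ∨ ∃ i, p j ≤ y j i) :
    ∃ f : J → M, (∀ j, f j ∈ S j) ∧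
      ∀ i, (∑ j, if f j = i then p j else 0) ≤ ∑ j, y j i + P := by
  classical
  have : ∀ j, ∃ x : M → ℝ, (∀ i, 0 ≤ x i) ∧ (∀ i, x i ≤ y j i) ∧ ∑ i, x i = p j ∧
      (p j ≤ P ∨ ∃ i₀, ∀ i, i ≠ i₀ → x i = 0) := by
    intro j
    rcases hbig j with h | ⟨i₀, h⟩
    · rcases (hp j).eq_or_lt with h0 | h0
      · exact ⟨fun _ => 0, fun _ => le_rfl, hy j, by simpa using h0, Or.inl h⟩
      · have hpos := h0.trans_le (hcov j)
        refine ⟨fun i => y j i * (p j / ∑ i, y j i), fun i => mul_nonneg (hy j i) (by positivity),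
          fun i => mul_le_of_le_one_right (hy j i) ((div_le_one hpos).2 (hcov j)), ?_, Or.inl h⟩
        rw [← Finset.sum_mul]
        field_simp
    · refine ⟨fun i => if i = i₀ then p j else 0, fun i => ?_, fun i => ?_, by simp,
        Or.inr ⟨i₀, fun i hi => by simp [hi]⟩⟩
      · dsimp only
        split_ifs
        exacts [hp j, le_rfl]
      · dsimp only
        split_ifs with hi
        exacts [hi ▸ h, hy j i]
  choose x hx0 hxy hxp hxP using this
  obtain ⟨f, hf1, hf2⟩ := exists_rounding_of_exact hP _ x hx0
    (fun j => by rw [hxp]; exact hxP j) rfl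
  simp only [hxp] at hf1 hf2
  choose s hs using hS
  have : ∀ j, ∃ i ∈ S j, 0 < p j → f j = some i := by
    intro j
    by_cases h : 0 < p j
    · obtain ⟨i, hi, hi'⟩ := hf1 j h
      exact ⟨i, hyS j i (hi'.trans_le (hxy j i)), fun _ => hi⟩
    · exact ⟨s j, hs j, fun h' => absurd h' h⟩
  choose g hgS hg using this
  refine ⟨g, hgS, fun i => ?_⟩
  refine (Finset.sum_le_sum fun j _ => ?_).trans ((hf2 i).trans
    (by gcongr with j; exact hxy j i))
  rcases (hp j).eq_or_lt with h0 | h0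
  · simp [Set.indicator, ← h0]
  · have : g j = i ↔ f j = some i := by simp [hg j h0]
    simp [Set.indicator, this]

end Rounding
end Makespan

/-! ### Weighted sets of vertices -/

namespace Makespan

variable {T : RootedTree.{u}}

/-- The load of the parent edge of `v`, and `0` at the root, which has no parent edge. -/
noncomputable def wt (ℓ : Sym2 T → ℝ) (v : T) : ℝ :=
  open Classical in if v = ⊥ then 0 else 2 * ℓ (parentEdge v)

/-- Edge lengths are nonnegative. (Nothing is said about pairs that are not edges.) -/
def EdgeNonneg (ℓ : Sym2 T → ℝ) : Prop := ∀ e ∈ (SimpleGraph.hasse T).edgeSet, 0 ≤ ℓ e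

lemma pred_covBy {v : T} (h : v ≠ ⊥) : Order.pred v ⋖ v :=
  Order.pred_covBy_of_not_isMin (by simpa [isMin_iff_eq_bot] using h)

lemma pred_lt {v : T} (h : v ≠ ⊥) : Order.pred v < v := (pred_covBy h).lt

lemma ne_bot_of_le {u v : T} (hu : u ≠ ⊥) (h : u ≤ v) : v ≠ ⊥ := by
  rintro rfl
  exact hu (le_bot_iff.1 h)

/-- The ancestors of a vertex form a chain. -/
lemma le_total_of_le {a b c : T} (ha : a ≤ c) (hb : b ≤ c) : a ≤ b ∨ b ≤ a :=
  le_total_of_directed hb ha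

lemma lt_or_le_of_le {a b c : T} (ha : a ≤ c) (hb : b ≤ c) : a < b ∨ b ≤ a := by
  rcases le_total_of_le ha hb with h | h
  · exact h.lt_or_eq.imp id fun h => h.ge
  · exact Or.inr h

lemma parentEdge_mem {v : T} (h : v ≠ ⊥) : parentEdge v ∈ (SimpleGraph.hasse T).edgeSet := by
  simp only [parentEdge, SimpleGraph.mem_edgeSet, SimpleGraph.hasse_adj]
  exact Or.inl (pred_covBy h)

lemma parentEdge_injOn : Set.InjOn (parentEdge : T → Sym2 T) {v | v ≠ ⊥} := by
  intro a ha b hb h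
  simp only [parentEdge, Sym2.eq_iff] at h
  rcases h with h | ⟨h1, h2⟩
  · exact h.2
  · have h3 := pred_lt ha
    have h4 := pred_lt hb
    rw [h1] at h3
    rw [← h2] at h4
    exact absurd h3 h4.asymm

section Cost

variable {ℓ : Sym2 T → ℝ}

lemma wt_bot : wt ℓ ⊥ = 0 := by simp [wt]

lemma wt_of_ne {v : T} (h : v ≠ ⊥) : wt ℓ v = 2 * ℓ (parentEdge v) := by simp [wt, h]

lemma wt_nonneg (hℓ : EdgeNonneg ℓ) (v : T) : 0 ≤ wt ℓ v := by
  by_cases h : v = ⊥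
  · rw [h, wt_bot]
  · rw [wt_of_ne h]
    have := hℓ _ (parentEdge_mem h)
    positivity

variable [Fintype T]

/-- The load of the set of parent edges of the vertices of `S`. -/
noncomputable def cost (ℓ : Sym2 T → ℝ) (S : Set T) : ℝ := ∑ v, S.indicator (wt ℓ) v

lemma cost_nonneg (hℓ : EdgeNonneg ℓ) (S : Set T) : 0 ≤ cost ℓ S :=
  Finset.sum_nonneg fun v _ => Set.indicator_nonneg (fun v _ => wt_nonneg hℓ v) v

lemma cost_mono (hℓ : EdgeNonneg ℓ) {S S' : Set T} (h : S ⊆ S') : cost ℓ S ≤ cost ℓ S' :=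
  Finset.sum_le_sum fun v _ => Set.indicator_le_indicator_of_subset h (wt_nonneg hℓ) v

@[simp] lemma cost_empty : cost ℓ (∅ : Set T) = 0 := by simp [cost]

lemma cost_union {S S' : Set T} (h : Disjoint S S') : cost ℓ (S ∪ S') = cost ℓ S + cost ℓ S' := by
  simp only [cost, ← Finset.sum_add_distrib, Set.indicator_union_of_disjoint h]

lemma cost_union_le (hℓ : EdgeNonneg ℓ) (S S' : Set T) :
    cost ℓ (S ∪ S') ≤ cost ℓ S + cost ℓ S' := by
  rw [← Set.union_sdiff_self, cost_union disjoint_sdiff_self_right]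
  have := cost_mono hℓ (Set.sdiff_subset : S' \ S ⊆ S')
  linarith

lemma cost_le_sum (hℓ : EdgeNonneg ℓ) {ι : Type*} (s : Finset ι) (S : Set T) (A : ι → Set T)
    (h : ∀ v ∈ S, ∃ i ∈ s, v ∈ A i) : cost ℓ S ≤ ∑ i ∈ s, cost ℓ (A i) := by
  simp only [cost]
  rw [Finset.sum_comm]
  refine Finset.sum_le_sum fun v _ => ?_
  by_cases hv : v ∈ S
  · obtain ⟨i, hi, hvi⟩ := h v hv
    rw [Set.indicator_of_mem hv]
    refine le_trans ?_ (Finset.single_le_sum (f := fun i => (A i).indicator (wt ℓ) v)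
      (fun i _ => Set.indicator_nonneg (fun v _ => wt_nonneg hℓ v) v) hi)
    simp [hvi]
  · rw [Set.indicator_of_notMem hv]
    exact Finset.sum_nonneg fun i _ => Set.indicator_nonneg (fun v _ => wt_nonneg hℓ v) v

/-- The load of a set is the sum of the loads of its parts in a partition of the edges. -/
lemma cost_eq_sum_of_partition {ι : Type*} [Fintype ι] (A : ι → Set T)
    (h : ∀ v, v ≠ ⊥ → ∃! i, v ∈ A i) (S : Set T) : cost ℓ S = ∑ i, cost ℓ (S ∩ A i) := by
  simp only [cost]
  rw [Finset.sum_comm]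
  refine Finset.sum_congr rfl fun v _ => ?_
  by_cases hv : v = ⊥
  · subst hv
    simp [Set.indicator, wt_bot]
  · obtain ⟨i, hi, hu⟩ := h v hv
    rw [Finset.sum_eq_single i]
    · by_cases hS : v ∈ S <;> simp [hS, hi]
    · intro j _ hj
      refine Set.indicator_of_notMem (fun hm => hj (hu j hm.2)) _
    · simp

end Cost

/-! ### Tours and lower sets -/

section Tours

variable {ℓ : Sym2 T → ℝ}

lemma parentEdge_mem_edges {u w v : T} (p : (SimpleGraph.hasse T).Walk u w)
    (hu : ¬ v ≤ u) (hw : v ≤ w) : parentEdge v ∈ p.edges := by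
  obtain ⟨d, hd, h1, h2⟩ := p.exists_boundary_dart {x | ¬ v ≤ x} hu (by simpa using hw)
  simp only [Set.mem_ofPred_eq, not_not] at h1 h2
  have hadj := d.adj
  rw [SimpleGraph.hasse_adj] at hadj
  have hcov : d.fst ⋖ d.snd := by
    rcases hadj with h | h
    · exact h
    · exact absurd (h2.trans h.le) h1
  have hv : v = d.snd := by
    rcases h2.lt_or_eq with h | h
    · exact absurd ((Order.le_pred_of_lt h).trans_eq hcov.pred_eq) h1
    · exact h
  have he : d.edge ∈ p.edges := List.mem_map_of_mem hd
  convert he using 1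
  rw [parentEdge, hv, hcov.pred_eq]
  rfl

/-- A tour that visits `v` leaves the branch at `v` again, so it uses the parent edge twice. -/
lemma two_le_count [DecidableEq (Sym2 T)] (p : Tour T) {v : T} (hv : v ≠ ⊥) (hm : v ∈ p.support) :
    2 ≤ p.edges.count (parentEdge v) := by
  classical
  have hb : ¬ v ≤ ⊥ := by simpa using hv
  have hp := p.take_spec hm
  rw [← hp, SimpleGraph.Walk.edges_append, List.count_append]
  have h1 := List.count_pos_iff.2 (parentEdge_mem_edges (p.takeUntil v hm) hb le_rfl)
  have h2 := List.count_pos_iff.2 (parentEdge_mem_edges (p.dropUntil v hm).reverse hb le_rfl)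
  rw [SimpleGraph.Walk.edges_reverse, List.count_reverse] at h2
  convert Nat.add_le_add h1 h2

lemma support_lower (p : Tour T) {u v : T} (huv : u ≤ v) (hv : v ∈ p.support) :
    u ∈ p.support := by
  classical
  by_cases hu : u = ⊥
  · rw [hu]
    exact p.start_mem_support
  · have h := parentEdge_mem_edges (p.takeUntil v hv) (by simpa using hu) huv
    exact p.support_takeUntil_subset_support hv
      (SimpleGraph.Walk.snd_mem_support_of_mem_edges _ h)

lemma parentEdge_mem_edges_iff (p : Tour T) {v : T} (hv : v ≠ ⊥) :
    parentEdge v ∈ p.edges ↔ v ∈ p.support := by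
  classical
  refine ⟨fun h => SimpleGraph.Walk.snd_mem_support_of_mem_edges _ h, fun h => ?_⟩
  have := two_le_count p hv h
  exact List.count_pos_iff.1 (by omega)

/-- The vertices visited by a tour. -/
def visited (p : Tour T) : Set T := {v | v ∈ p.support}

variable [Fintype T]

lemma cost_visited_le (hℓ : EdgeNonneg ℓ) (p : Tour T) : cost ℓ (visited p) ≤ tourLength ℓ p := by
  classical
  have h1 : tourLength ℓ p = ∑ e ∈ p.edges.toFinset, p.edges.count e * ℓ e := by
    rw [tourLength, Finset.sum_list_map_count]
    simp
  have h2 : cost ℓ (visited p) =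
      ∑ v ∈ Finset.univ.filter (fun v => v ≠ ⊥ ∧ v ∈ p.support), 2 * ℓ (parentEdge v) := by
    rw [cost, Finset.sum_filter]
    refine Finset.sum_congr rfl fun v _ => ?_
    by_cases hv : v = ⊥
    · simp [hv, Set.indicator, wt_bot]
    · by_cases hm : v ∈ p.support <;> simp [hv, hm, Set.indicator, visited, wt_of_ne]
  rw [h1, h2, ← Finset.sum_image (s := Finset.univ.filter (fun v => v ≠ ⊥ ∧ v ∈ p.support))
    (g := parentEdge) (f := fun e => 2 * ℓ e)]
  · refine (Finset.sum_le_sum ?_).trans (Finset.sum_le_sum_of_subset_of_nonneg ?_ ?_)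
    · intro e he
      simp only [Finset.mem_image, Finset.mem_filter, Finset.mem_univ, true_and] at he
      obtain ⟨v, ⟨hv, hm⟩, rfl⟩ := he
      have := two_le_count p hv hm
      have h0 := hℓ _ (parentEdge_mem hv)
      gcongr
      exact_mod_cast this
    · intro e he
      simp only [Finset.mem_image, Finset.mem_filter, Finset.mem_univ, true_and] at he
      obtain ⟨v, ⟨hv, hm⟩, rfl⟩ := he
      simpa using (parentEdge_mem_edges_iff p hv).2 hm
    · intro e he _
      have := hℓ e (p.edges_subset_edgeSet (by simpa using he))
      positivity
  · intro a ha b hb h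
    simp only [Finset.coe_filter, Finset.mem_univ, true_and, Set.mem_ofPred_eq] at ha hb
    exact parentEdge_injOn ha.1 hb.1 h

/-- Every set of vertices that contains the root and is closed under taking parents is visited by a
tour that traverses each of its edges exactly twice. -/
lemma exists_tour (ℓ : Sym2 T → ℝ) (H : Set T) (hbot : ⊥ ∈ H) (hlow : IsLowerSet H) :
    ∃ p : Tour T, visited p = H ∧ tourLength ℓ p = cost ℓ H := by
  classical
  induction hn : H.ncard using Nat.strong_induction_on generalizing H with
  | _ n ih =>
  by_cases htriv : H = {⊥}
  · refine ⟨SimpleGraph.Walk.nil, ?_, ?_⟩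
    · ext v
      simp [visited, htriv]
    · subst htriv
      rw [cost, Finset.sum_eq_zero]
      · simp [tourLength]
      · intro v _
        rw [Set.indicator_apply_eq_zero]
        rintro rfl
        exact wt_bot
  · have hex : ∃ a ∈ H, a ≠ ⊥ := by
      by_contra! h
      exact htriv (Set.eq_singleton_iff_unique_mem.2 ⟨hbot, h⟩)
    obtain ⟨a, haH, ha⟩ := hex
    -- a maximal vertex of `H` is attached to a tour of the remaining vertices by a detour
    obtain ⟨m, ham, hm⟩ := (Set.toFinite H).exists_le_maximal haH
    have hmb : m ≠ ⊥ := by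
      rintro rfl
      exact ha (le_bot_iff.1 ham)
    have hcov := pred_covBy hmb
    have hlow' : IsLowerSet (H \ {m}) := by
      intro x y hyx hx
      refine ⟨hlow hyx hx.1, fun h => hx.2 ?_⟩
      rw [Set.mem_singleton_iff] at h ⊢
      subst h
      exact le_antisymm (hm.2 hx.1 hyx) hyx
    obtain ⟨p, hp, hlen⟩ := ih _ (by
      rw [← hn]
      exact Set.ncard_sdiff_singleton_lt_of_mem hm.1 (Set.toFinite _)) (H \ {m})
      ⟨hbot, fun h => hmb h.symm⟩ hlow' rfl
    have hpm : Order.pred m ∈ p.support := by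
      change Order.pred m ∈ visited p
      rw [hp]
      exact ⟨hlow hcov.le hm.1, hcov.lt.ne⟩
    have hadj : (SimpleGraph.hasse T).Adj (Order.pred m) m :=
      SimpleGraph.hasse_adj.2 (Or.inl hcov)
    refine ⟨(p.takeUntil _ hpm).append ((SimpleGraph.Walk.cons hadj
      (SimpleGraph.Walk.cons hadj.symm SimpleGraph.Walk.nil)).append (p.dropUntil _ hpm)), ?_, ?_⟩
    · ext v
      have h1 : v ∈ p.support ↔ v ∈ H ∧ v ≠ m := by
        change v ∈ visited p ↔ _
        rw [hp]
        rfl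
      have h2 : v ∈ p.support ↔ v ∈ (p.takeUntil _ hpm).support ∨
          v ∈ (p.dropUntil _ hpm).support := by
        conv_lhs => rw [← p.take_spec hpm]
        rw [SimpleGraph.Walk.mem_support_append_iff]
      simp only [visited, Set.mem_ofPred_eq, SimpleGraph.Walk.mem_support_append_iff,
        SimpleGraph.Walk.support_cons, SimpleGraph.Walk.support_nil, List.mem_cons,
        List.not_mem_nil, or_false]
      by_cases hvm : v = m
      · simp [hvm, hm.1]
      · have h3 : v = Order.pred m → v ∈ p.support := by
          rintro rfl
          exact hpm
        have h4 : v ∈ p.support ↔ v ∈ H := by simp [h1, hvm]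
        rw [← h4]
        constructor
        · rintro (h | (h | h | h) | h)
          exacts [h2.2 (Or.inl h), h3 h, absurd h hvm, h3 h, h2.2 (Or.inr h)]
        · intro h
          rcases h2.1 h with h | h
          exacts [Or.inl h, Or.inr (Or.inr h)]
    · have h1 : cost ℓ H = cost ℓ (H \ {m}) + cost ℓ {m} := by
        rw [← cost_union (by simp), Set.sdiff_union_self,
          Set.union_eq_self_of_subset_right (by simpa using hm.1)]
      have h2 : cost ℓ {m} = 2 * ℓ (parentEdge m) := by
        rw [cost, Finset.sum_eq_single m]
        · simp [wt_of_ne hmb]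
        · intro b _ hb
          simp [hb]
        · simp
      have h3 : tourLength ℓ p =
          ((p.takeUntil _ hpm).edges.map ℓ).sum + ((p.dropUntil _ hpm).edges.map ℓ).sum := by
        conv_lhs => rw [← p.take_spec hpm]
        simp only [tourLength, SimpleGraph.Walk.edges_append, List.map_append, List.sum_append]
      rw [h1, h2, ← hlen, h3]
      simp only [tourLength, SimpleGraph.Walk.edges_append, SimpleGraph.Walk.edges_cons,
        SimpleGraph.Walk.edges_nil, List.map_append, List.sum_append, List.map_cons, List.sum_cons,
        List.map_nil, List.sum_nil, parentEdge, Sym2.eq_swap (a := m)]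
      ring

end Tours
end Makespan

/-! ### The condensed tree -/

namespace Makespan

variable {T : RootedTree.{u}} [Fintype T]

lemma exists_child {y w : T} (h : y < w) : ∃ a, y ⋖ a ∧ a ≤ w := by
  obtain ⟨a, ha, hm⟩ := (Set.toFinite {a : T | y < a ∧ a ≤ w}).exists_minimal ⟨w, h, le_rfl⟩
  refine ⟨a, ⟨ha.1, fun b hb hba => ?_⟩, ha.2⟩
  exact (hba.not_ge) (hm ⟨hb, hba.le.trans ha.2⟩ hba.le)

lemma exists_isMax_ge (v : T) : ∃ c, IsMax c ∧ v ≤ c := by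
  obtain ⟨c, hc, hm⟩ := (Set.toFinite (Set.univ : Set T)).exists_le_maximal (Set.mem_univ v)
  exact ⟨c, fun b hb => hm.2 (Set.mem_univ b) hb, hc⟩

section Condensed

variable {ℓ : Sym2 T → ℝ} {δ D : ℝ}

lemma branchLoad_eq {v : T} (hv : v ≠ ⊥) : branchLoad ℓ v = cost ℓ (Set.Ici v) := by
  rw [branchLoad, cost, Finset.mul_sum]
  refine Finset.sum_congr rfl fun w _ => ?_
  by_cases h : v ≤ w
  · simp [h, wt_of_ne (ne_bot_of_le hv h)]
  · simp [h]

lemma Kept.mono {u v : T} (hv : Kept ℓ δ D v) (h : u ≤ v) : Kept ℓ δ D u :=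
  fun b hb hbu => hv b hb (hbu.trans_le h)

lemma Condensed.isLeafEdge (hℓ : EdgeNonneg ℓ) {b : T} (hb : Condensed ℓ δ D b) :
    IsLeafEdge ℓ δ D b := by
  refine ⟨hb.1, fun b' hb' hlt => ?_, fun w hw hk => hk b hb hw⟩
  have hle := Order.le_pred_of_lt hlt
  have hne := ne_bot_of_le hb'.1 hle
  rcases hb.2.2 with h | h
  · exact hne h
  · rw [branchLoad_eq hne] at h
    have h1 := hb'.2.1
    rw [branchLoad_eq hb'.1] at h1
    have := cost_mono hℓ (Set.Ici_subset_Ici.2 hle)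
    linarith

lemma IsLeafEdge.condensed_or_isMax {v : T} (hv : IsLeafEdge ℓ δ D v) :
    Condensed ℓ δ D v ∨ IsMax v := by
  by_cases hm : IsMax v
  · exact Or.inr hm
  · left
    obtain ⟨w, hw⟩ := not_isMax_iff.1 hm
    obtain ⟨a, ha, -⟩ := exists_child hw
    have := hv.2.2 a ha.lt
    simp only [Kept, not_forall, not_not] at this
    obtain ⟨b, hb, hba⟩ := this
    have hle := Order.le_pred_of_lt hba
    rw [ha.pred_eq] at hle
    rcases hle.lt_or_eq with hlt | rfl
    exacts [absurd hlt (hv.2.1 b hb), hb]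

/-- The branch at a leaf edge that is not condensed consists of this edge only. -/
lemma IsLeafEdge.condLoad_eq {v : T} (hv : IsLeafEdge ℓ δ D v) :
    condLoad ℓ δ D v = cost ℓ (Set.Ici v) := by
  rw [← branchLoad_eq hv.1]
  by_cases hc : Condensed ℓ δ D v
  · simp [condLoad, hc]
  · have hm := hv.condensed_or_isMax.resolve_left hc
    have : Set.Ici v = {v} := by
      ext w
      simp only [Set.mem_Ici, Set.mem_singleton_iff]
      exact ⟨fun h => (hm.eq_of_le h).symm, fun h => h.ge⟩
    rw [condLoad, if_neg hc, branchLoad, this, Finset.sum_eq_single v] <;> simp +contextual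

lemma IsLeafEdge.cost_le_or_isMax {v : T} (hv : IsLeafEdge ℓ δ D v) :
    cost ℓ (Set.Ici v) ≤ δ * D ∨ IsMax v := by
  rw [← branchLoad_eq hv.1]
  exact hv.condensed_or_isMax.imp_left fun h => h.2.1

lemma IsLeafEdge.eq_of_le {t t' v : T} (ht : IsLeafEdge ℓ δ D t) (ht' : IsLeafEdge ℓ δ D t')
    (h : t ≤ v) (h' : t' ≤ v) : t = t' := by
  rcases le_total_of_le h h' with hle | hle
  · rcases hle.lt_or_eq with hlt | heq
    exacts [absurd ht'.2.1 (ht.2.2 _ hlt), heq]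
  · rcases hle.lt_or_eq with hlt | heq
    exacts [absurd ht.2.1 (ht'.2.2 _ hlt), heq.symm]

lemma IsLeafEdge.eq_of_le_leafEdge {t t' : T} (ht : IsLeafEdge ℓ δ D t)
    (ht' : IsLeafEdge ℓ δ D t') (h : t ≤ t') : t = t' := ht.eq_of_le ht' h le_rfl

lemma kept_or_exists_leafEdge (hℓ : EdgeNonneg ℓ) (v : T) :
    Kept ℓ δ D v ∨ ∃ t, IsLeafEdge ℓ δ D t ∧ t < v := by
  by_cases hk : Kept ℓ δ D v
  · exact Or.inl hk
  · simp only [Kept, not_forall, not_not] at hk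
    obtain ⟨b, hb, hlt⟩ := hk
    exact Or.inr ⟨b, hb.isLeafEdge hℓ, hlt⟩

lemma exists_leafEdge_le (hℓ : EdgeNonneg ℓ) {c : T} (hc : IsMax c) (hne : c ≠ ⊥) :
    ∃ t, IsLeafEdge ℓ δ D t ∧ t ≤ c := by
  rcases kept_or_exists_leafEdge (δ := δ) (D := D) hℓ c with hk | ⟨t, ht, hlt⟩
  · exact ⟨c, ⟨hne, hk, fun w hw => absurd hw hc.not_lt⟩, le_rfl⟩
  · exact ⟨t, ht, hlt.le⟩

lemma OnBackbone.mono {u x : T} (hx : OnBackbone ℓ δ D x) (h : u ≤ x) : OnBackbone ℓ δ D u := by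
  obtain ⟨w, hw, hlt⟩ := hx
  exact ⟨w, hw, h.trans_lt hlt⟩

lemma OnBackbone.kept {x : T} (hx : OnBackbone ℓ δ D x) : Kept ℓ δ D x := by
  obtain ⟨w, hw, hlt⟩ := hx
  exact hw.1.2.1.mono hlt.le

lemma OnBackbone.not_isLeafEdge {x : T} (hx : OnBackbone ℓ δ D x) : ¬ IsLeafEdge ℓ δ D x := by
  obtain ⟨w, hw, hlt⟩ := hx
  exact fun h => h.2.2 w hlt hw.1.2.1

lemma OnBackbone.not_le_leafEdge {x t : T} (hx : OnBackbone ℓ δ D x) (ht : IsLeafEdge ℓ δ D t) :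
    ¬ t ≤ x := by
  intro h
  rcases h.lt_or_eq with hlt | rfl
  exacts [ht.2.2 _ hlt hx.kept, hx.not_isLeafEdge ht]

/-- `p` is a vertex of the backbone or the leaf of a leaf cluster. -/
def AboveLeafCluster (ℓ : Sym2 T → ℝ) (δ D : ℝ) (p : T) : Prop :=
  ∃ w, IsLeafCluster ℓ δ D w ∧ p ≤ w

lemma OnBackbone.above {x : T} (hx : OnBackbone ℓ δ D x) : AboveLeafCluster ℓ δ D x := by
  obtain ⟨w, hw, hlt⟩ := hx
  exact ⟨w, hw, hlt.le⟩

lemma AboveLeafCluster.edge {p : T} (h : AboveLeafCluster ℓ δ D p) (hp : p ≠ ⊥) :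
    IsBackboneEdge ℓ δ D p ∨ IsLeafCluster ℓ δ D p := by
  obtain ⟨w, hw, hle⟩ := h
  rcases hle.lt_or_eq with hlt | rfl
  exacts [Or.inl ⟨hp, w, hw, hlt⟩, Or.inr hw]

lemma isBranching_inf {p q : T} (hp : AboveLeafCluster ℓ δ D p) (hq : AboveLeafCluster ℓ δ D q)
    (hpq : ¬ p ≤ q) (hqp : ¬ q ≤ p) : IsBranching ℓ δ D (p ⊓ q) := by
  have h1 : p ⊓ q < p := lt_of_le_of_ne inf_le_left fun h => hpq (inf_eq_left.1 h)
  have h2 : p ⊓ q < q := lt_of_le_of_ne inf_le_right fun h => hqp (inf_eq_right.1 h)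
  obtain ⟨a, ha, hap⟩ := exists_child h1
  obtain ⟨b, hb, hbq⟩ := exists_child h2
  refine ⟨a, b, ha, hb, ?_, ?_, ?_⟩
  · rintro rfl
    exact ha.lt.not_ge (le_inf hap hbq)
  · obtain ⟨w, hw, hle⟩ := hp
    exact AboveLeafCluster.edge ⟨w, hw, hap.trans hle⟩ (ne_bot_of_gt ha.lt)
  · obtain ⟨w, hw, hle⟩ := hq
    exact AboveLeafCluster.edge ⟨w, hw, hbq.trans hle⟩ (ne_bot_of_gt hb.lt)

lemma IsSmallLeaf.not_isLeafCluster {t : T} (ht : IsSmallLeaf ℓ δ D t) :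
    ¬ IsLeafCluster ℓ δ D t := fun h => absurd h.2 (not_le.2 ht.2)

lemma IsSmallLeaf.onBackbone (hw : IsWoollyTree ℓ δ D) {t : T} (ht : IsSmallLeaf ℓ δ D t) :
    OnBackbone ℓ δ D (Order.pred t) := by
  rcases hw t ht.1.1 ht.1.2.1 with h | h | h
  · exact absurd ht.1 h.2.not_isLeafEdge
  · exact absurd h ht.not_isLeafCluster
  · exact h.2

lemma OnBackbone.not_isSmallLeaf {x : T} (hx : OnBackbone ℓ δ D x) : ¬ IsSmallLeaf ℓ δ D x :=
  fun h => hx.not_isLeafEdge h.1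

lemma IsSmallLeaf.foot_eq {t : T} (ht : IsSmallLeaf ℓ δ D t) : foot ℓ δ D t = Order.pred t := by
  simp [foot, ht]

lemma OnBackbone.foot_eq {x : T} (hx : OnBackbone ℓ δ D x) : foot ℓ δ D x = x := by
  simp [foot, hx.not_isSmallLeaf]

lemma foot_le (v : T) : foot ℓ δ D v ≤ v := by
  by_cases h : IsSmallLeaf ℓ δ D v
  · rw [h.foot_eq]
    exact Order.pred_le v
  · simp [foot, h]

lemma IsSmallLeaf.le_foot {u t : T} (ht : IsSmallLeaf ℓ δ D t) (h : u < t) :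
    u ≤ foot ℓ δ D t := by
  rw [ht.foot_eq]
  exact Order.le_pred_of_lt h

lemma IsLeafEdge.leafCluster_or_small {t : T} (ht : IsLeafEdge ℓ δ D t) :
    IsLeafCluster ℓ δ D t ∨ IsSmallLeaf ℓ δ D t :=
  (le_or_gt _ _).imp (fun h => ⟨ht, h⟩) fun h => ⟨ht, h⟩

/-- In a binary tree at most one small leaf edge is attached to a backbone vertex, as another child
lies on the way to a leaf cluster. -/
lemma foot_injOn (hbin : IsBinary T) (hw : IsWoollyTree ℓ δ D) {t t' : T}
    (ht : IsSmallLeaf ℓ δ D t) (ht' : IsSmallLeaf ℓ δ D t') (h : foot ℓ δ D t = foot ℓ δ D t') :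
    t = t' := by
  by_contra hne
  rw [ht.foot_eq, ht'.foot_eq] at h
  have h1 := pred_covBy ht.1.1
  have h2 := pred_covBy ht'.1.1
  rw [← h] at h2
  obtain ⟨w, hwc, hlt⟩ := ht.onBackbone hw
  obtain ⟨a, ha, haw⟩ := exists_child hlt
  have hsm : ∀ s, IsSmallLeaf ℓ δ D s → a ≠ s := by
    rintro s hs rfl
    rcases AboveLeafCluster.edge ⟨w, hwc, haw⟩ hs.1.1 with h | h
    · exact h.2.not_isSmallLeaf hs
    · exact hs.not_isLeafCluster h
  have hsub : ({a, t, t'} : Set T) ⊆ {v | Order.pred t ⋖ v} := by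
    rintro v (rfl | rfl | rfl)
    exacts [ha, h1, h2]
  have h3 := Set.ncard_le_ncard hsub (Set.toFinite _)
  have h4 : ({a, t, t'} : Set T).ncard = 3 :=
    Set.ncard_eq_three.2 ⟨a, t, t', hsm t ht, hsm t' ht', hne, rfl⟩
  have := hbin (Order.pred t)
  omega

end Condensed

/-! ### Woolly edges -/

section Woolly

variable {ℓ : Sym2 T → ℝ} {δ D : ℝ}

lemma SamePath.refl (x : T) : SamePath ℓ δ D x x :=
  Or.inl ⟨le_rfl, fun _ h h' => absurd h' h.not_gt⟩

lemma SamePath.symm {x y : T} (h : SamePath ℓ δ D x y) : SamePath ℓ δ D y x := Or.symm h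

lemma SamePath.le_total {x y : T} (h : SamePath ℓ δ D x y) : x ≤ y ∨ y ≤ x :=
  h.imp And.left And.left

/-- Two backbone vertices on the path of a common third one are on the same path: if they were
incomparable, then their meet would be a branching point on one of the given paths. -/
lemma SamePath.trans {x y z : T} (hx : OnBackbone ℓ δ D x) (hz : OnBackbone ℓ δ D z)
    (h₁ : SamePath ℓ δ D x y) (h₂ : SamePath ℓ δ D y z) : SamePath ℓ δ D x z := by
  rcases h₁ with ⟨hxy, b₁⟩ | ⟨hxy, b₁⟩ <;> rcases h₂ with ⟨hyz, b₂⟩ | ⟨hyz, b₂⟩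
  · refine Or.inl ⟨hxy.trans hyz, fun t h h' => ?_⟩
    rcases lt_or_le_of_le h'.le hyz with hty | hty
    exacts [b₁ t h hty, b₂ t hty h']
  · rcases le_total_of_le hxy hyz with h | h
    · exact Or.inl ⟨h, fun t h1 h2 => b₁ t h1 (h2.trans_le hyz)⟩
    · exact Or.inr ⟨h, fun t h1 h2 => b₂ t h1 (h2.trans_le hxy)⟩
  · by_cases h : x ≤ z
    · exact Or.inl ⟨h, fun t h1 h2 => b₂ t (hxy.trans h1) h2⟩
    · by_cases h' : z ≤ x
      · exact Or.inr ⟨h', fun t h1 h2 => b₁ t (hyz.trans h1) h2⟩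
      · exact absurd (isBranching_inf hx.above hz.above h h') (b₁ _ (le_inf hxy hyz)
          (lt_of_le_of_ne inf_le_left fun h'' => h (inf_eq_left.1 h'')))
  · refine Or.inr ⟨hyz.trans hxy, fun t h h' => ?_⟩
    rcases lt_or_le_of_le h'.le hxy with hty | hty
    exacts [b₂ t h hty, b₁ t hty h']

/-- The woolly edge of the backbone vertex `x`; it is empty if `x` is a branching root. -/
def wool (ℓ : Sym2 T → ℝ) (δ D : ℝ) (x : T) : Set T :=
  {v | (IsBackboneEdge ℓ δ D v ∨ IsSmallLeaf ℓ δ D v) ∧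
      OnBackbone ℓ δ D (foot ℓ δ D v) ∧ SamePath ℓ δ D x (foot ℓ δ D v)}

lemma wool_eq {x y : T} (hx : OnBackbone ℓ δ D x) (hy : OnBackbone ℓ δ D y)
    (h : SamePath ℓ δ D x y) : wool ℓ δ D x = wool ℓ δ D y := by
  ext v
  simp only [wool, Set.mem_ofPred_eq]
  refine and_congr_right fun _ => and_congr_right fun hf => ?_
  exact ⟨fun h' => h.symm.trans hy hf h', fun h' => h.trans hx hf h'⟩

lemma IsWoollyEdge.exists_eq_wool {W : Set T} (hW : IsWoollyEdge ℓ δ D W) :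
    ∃ x, OnBackbone ℓ δ D x ∧ W = wool ℓ δ D x := hW.2

lemma IsWoollyEdge.mem {W : Set T} (hW : IsWoollyEdge ℓ δ D W) {v : T} (hv : v ∈ W) :
    (IsBackboneEdge ℓ δ D v ∨ IsSmallLeaf ℓ δ D v) ∧ OnBackbone ℓ δ D (foot ℓ δ D v) ∧
      W = wool ℓ δ D (foot ℓ δ D v) := by
  obtain ⟨x, hx, rfl⟩ := hW.exists_eq_wool
  exact ⟨hv.1, hv.2.1, wool_eq hx hv.2.1 hv.2.2⟩

lemma IsWoollyEdge.samePath {W : Set T} (hW : IsWoollyEdge ℓ δ D W) {v v' : T} (hv : v ∈ W)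
    (hv' : v' ∈ W) : SamePath ℓ δ D (foot ℓ δ D v) (foot ℓ δ D v') := by
  have := (hW.mem hv).2.2
  rw [this] at hv'
  exact hv'.2.2

lemma IsWoollyEdge.eq_of_mem {W W' : Set T} (hW : IsWoollyEdge ℓ δ D W)
    (hW' : IsWoollyEdge ℓ δ D W') {v : T} (hv : v ∈ W) (hv' : v ∈ W') : W = W' := by
  rw [(hW.mem hv).2.2, (hW'.mem hv').2.2]

lemma exists_isWoollyEdge (hw : IsWoollyTree ℓ δ D) {v : T}
    (hv : IsBackboneEdge ℓ δ D v ∨ IsSmallLeaf ℓ δ D v) :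
    ∃ W, IsWoollyEdge ℓ δ D W ∧ v ∈ W := by
  have hf : OnBackbone ℓ δ D (foot ℓ δ D v) := by
    rcases hv with h | h
    · rw [h.2.foot_eq]
      exact h.2
    · rw [h.foot_eq]
      exact h.onBackbone hw
  have hm : v ∈ wool ℓ δ D (foot ℓ δ D v) := ⟨hv, hf, SamePath.refl _⟩
  exact ⟨_, ⟨⟨v, hm⟩, _, hf, rfl⟩, hm⟩

lemma IsWoollyEdge.exists_maximal_foot {W C : Set T} (hW : IsWoollyEdge ℓ δ D W) (hC : C ⊆ W)
    (hne : C.Nonempty) : ∃ c ∈ C, ∀ c' ∈ C, foot ℓ δ D c' ≤ foot ℓ δ D c := by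
  obtain ⟨x, ⟨c, hc, rfl⟩, hm⟩ :=
    ((Set.toFinite C).image (foot ℓ δ D)).exists_maximal (hne.image _)
  refine ⟨c, hc, fun c' hc' => ?_⟩
  rcases (hW.samePath (hC hc) (hC hc')).le_total with h | h
  · exact hm ⟨c', hc', rfl⟩ h
  · exact h

/-- The bottom of a woolly edge is a branching point or the parent of a leaf cluster. -/
lemma IsWoollyEdge.exists_bottom {W : Set T} (hW : IsWoollyEdge ℓ δ D W) :
    ∃ y, OnBackbone ℓ δ D y ∧ W = wool ℓ δ D y ∧ (∀ v ∈ W, foot ℓ δ D v ≤ y) ∧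
      (IsBranching ℓ δ D y ∨ ∃ w, IsLeafCluster ℓ δ D w ∧ y ⋖ w) := by
  obtain ⟨x, hx, hWx⟩ := hW.exists_eq_wool
  obtain ⟨y, ⟨hy, hxy⟩, hm⟩ := (Set.toFinite
    {y | OnBackbone ℓ δ D y ∧ SamePath ℓ δ D x y}).exists_maximal ⟨x, hx, SamePath.refl x⟩
  have hWy : W = wool ℓ δ D y := hWx.trans (wool_eq hx hy hxy)
  refine ⟨y, hy, hWy, fun v hv => ?_, ?_⟩
  · rw [hWy] at hv
    rcases hv.2.2.le_total with h | h
    · exact hm ⟨hv.2.1, hxy.trans hx hv.2.1 hv.2.2⟩ h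
    · exact h
  · by_cases hb : IsBranching ℓ δ D y
    · exact Or.inl hb
    · right
      obtain ⟨w, hw, hlt⟩ := hy
      obtain ⟨a, ha, haw⟩ := exists_child hlt
      rcases AboveLeafCluster.edge ⟨w, hw, haw⟩ (ne_bot_of_gt ha.lt) with h | h
      · have hya : SamePath ℓ δ D y a := by
          refine Or.inl ⟨ha.le, fun z h1 h2 => ?_⟩
          rcases h1.lt_or_eq with h3 | rfl
          exacts [absurd h2 (ha.2 h3), hb]
        exact absurd (hm ⟨h.2, hxy.trans hx h.2 hya⟩ ha.le) ha.lt.not_ge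
      · exact ⟨a, h, ha⟩

/-- Every branching point can be given a leaf cluster below it, no leaf cluster being given twice.
Label the leaf clusters injectively by numbers. Of two child branches of a branching point `y` that
contain leaf clusters, one misses the largest label below `y`, and `y` gets the leaf cluster with
the largest label in that branch. -/
lemma exists_leafCluster_of_branching (ℓ : Sym2 T → ℝ) (δ D : ℝ) :
    ∃ lam : T → T, (∀ y, IsBranching ℓ δ D y → IsLeafCluster ℓ δ D (lam y) ∧ y < lam y) ∧
      ∀ y y', IsBranching ℓ δ D y → IsBranching ℓ δ D y' → lam y = lam y' → y = y' := by
  classical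
  let lab := Fintype.equivFin T
  have hex : ∀ y, AboveLeafCluster ℓ δ D y → ∃ w, IsLeafCluster ℓ δ D w ∧ y ≤ w ∧
      ∀ w', IsLeafCluster ℓ δ D w' → y ≤ w' → lab w' ≤ lab w := by
    rintro y ⟨w, hw, hle⟩
    obtain ⟨w₀, h₀, hm⟩ := Finset.exists_max_image
      (Finset.univ.filter fun w => IsLeafCluster ℓ δ D w ∧ y ≤ w) lab ⟨w, by simp [hw, hle]⟩
    simp only [Finset.mem_filter, Finset.mem_univ, true_and] at h₀ hm
    exact ⟨w₀, h₀.1, h₀.2, fun w' h h' => hm w' ⟨h, h'⟩⟩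
  have key : ∀ y, ∃ w, IsBranching ℓ δ D y → IsLeafCluster ℓ δ D w ∧ ∃ a, y ⋖ a ∧ a ≤ w ∧
      (∀ w', IsLeafCluster ℓ δ D w' → a ≤ w' → lab w' ≤ lab w) ∧
      ∃ w', IsLeafCluster ℓ δ D w' ∧ y ≤ w' ∧ lab w < lab w' := by
    intro y
    by_cases hy : IsBranching ℓ δ D y
    · obtain ⟨a, b, ha, hb, hab, hae, hbe⟩ := hy
      have above : ∀ c, IsBackboneEdge ℓ δ D c ∨ IsLeafCluster ℓ δ D c →
          AboveLeafCluster ℓ δ D c := by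
        rintro c (h | h)
        exacts [h.2.above, ⟨c, h, le_rfl⟩]
      obtain ⟨wa, hwa, hla, hma⟩ := hex a (above a hae)
      obtain ⟨wb, hwb, hlb, hmb⟩ := hex b (above b hbe)
      have hne : wa ≠ wb := by
        rintro rfl
        rcases le_total_of_le hla hlb with h | h
        · rcases h.lt_or_eq with h | h
          exacts [hb.2 ha.lt h, hab h]
        · rcases h.lt_or_eq with h | h
          exacts [ha.2 hb.lt h, hab h.symm]
      rcases lt_or_gt_of_ne (lab.injective.ne hne) with h | h
      · exact ⟨wa, fun _ => ⟨hwa, a, ha, hla, hma, wb, hwb, hb.le.trans hlb, h⟩⟩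
      · exact ⟨wb, fun _ => ⟨hwb, b, hb, hlb, hmb, wa, hwa, ha.le.trans hla, h⟩⟩
    · exact ⟨y, fun h => absurd h hy⟩
  choose lam hlam using key
  have hlt : ∀ y y', IsBranching ℓ δ D y → IsBranching ℓ δ D y' → lam y = lam y' → ¬ y < y' := by
    intro y y' hy hy' heq hyy
    obtain ⟨-, a, ha, hal, hma, -⟩ := hlam y hy
    obtain ⟨-, a', ha', hal', -, w', hw', hle', hl⟩ := hlam y' hy'
    rw [← heq] at hal' hl
    have : a ≤ y' := by
      rcases lt_or_le_of_le (ha'.le.trans hal') hal with h | h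
      exacts [absurd h (ha.2 hyy), h]
    exact (hma w' hw' (this.trans hle')).not_gt hl
  refine ⟨lam, fun y hy => ?_, fun y y' hy hy' heq => ?_⟩
  · obtain ⟨h, a, ha, hal, -⟩ := hlam y hy
    exact ⟨h, ha.lt.trans_le hal⟩
  · obtain ⟨-, a, ha, hal, -⟩ := hlam y hy
    obtain ⟨-, a', ha', hal', -⟩ := hlam y' hy'
    rw [← heq] at hal'
    rcases le_total_of_le (ha.le.trans hal) (ha'.le.trans hal') with h | h
    · rcases h.lt_or_eq with h | h
      exacts [absurd h (hlt y y' hy hy' heq), h]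
    · rcases h.lt_or_eq with h | h
      exacts [absurd h (hlt y' y hy' hy heq.symm), h.symm]

/-- Every woolly edge can be given a leaf cluster below it, no leaf cluster being given more than
twice: once for a woolly edge that ends above it, once for a woolly edge that ends in a branching
point. -/
lemma exists_leafCluster_of_woollyEdge (ℓ : Sym2 T → ℝ) (δ D : ℝ) :
    ∃ lam : Set T → T,
      (∀ W, IsWoollyEdge ℓ δ D W → IsLeafCluster ℓ δ D (lam W) ∧
        ∀ v ∈ W, foot ℓ δ D v < lam W) ∧
      ∀ w, {W | IsWoollyEdge ℓ δ D W ∧ lam W = w}.ncard ≤ 2 := by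
  classical
  obtain ⟨lb, hlb, hinj⟩ := exists_leafCluster_of_branching ℓ δ D
  have key : ∀ W, ∃ y w, IsWoollyEdge ℓ δ D W → W = wool ℓ δ D y ∧
      (∀ v ∈ W, foot ℓ δ D v ≤ y) ∧ IsLeafCluster ℓ δ D w ∧ y < w ∧
      (Order.pred w = y ∨ IsBranching ℓ δ D y ∧ lb y = w) := by
    intro W
    by_cases hW : IsWoollyEdge ℓ δ D W
    · obtain ⟨y, -, hWy, hle, hb | ⟨w, hw, hcov⟩⟩ := hW.exists_bottom
      · exact ⟨y, lb y, fun _ => ⟨hWy, hle, (hlb y hb).1, (hlb y hb).2, Or.inr ⟨hb, rfl⟩⟩⟩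
      · exact ⟨y, w, fun _ => ⟨hWy, hle, hw, hcov.lt, Or.inl hcov.pred_eq⟩⟩
    · exact ⟨⊥, ⊥, fun h => absurd h hW⟩
  choose bot lam hlam using key
  refine ⟨lam, fun W hW => ?_, fun w => ?_⟩
  · obtain ⟨-, hle, hc, hlt, -⟩ := hlam W hW
    exact ⟨hc, fun v hv => (hle v hv).trans_lt hlt⟩
  · have hB : {y | IsBranching ℓ δ D y ∧ lb y = w}.ncard ≤ 1 :=
      (Set.ncard_le_one (Set.toFinite _)).2 fun a ha b hb =>
        hinj a b ha.1 hb.1 (ha.2.trans hb.2.symm)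
    have h2 : (insert (Order.pred w) {y | IsBranching ℓ δ D y ∧ lb y = w}).ncard ≤ 2 :=
      (Set.ncard_insert_le _ _).trans (by omega)
    refine (Set.ncard_le_ncard_of_injOn bot ?_ ?_ (Set.toFinite _)).trans h2
    · rintro W ⟨hW, rfl⟩
      obtain ⟨-, -, -, -, h | h⟩ := hlam W hW
      exacts [Or.inl h.symm, Or.inr h]
    · intro W hW W' hW' h
      rw [(hlam W hW.1).1, (hlam W' hW'.1).1, h]

end Woolly
end Makespan

/-! ### Clusters as a partition of the edges -/

namespace Makespan

variable {T : RootedTree.{u}}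

/-- The union of the branches at the edges in `Q`. -/
def up (Q : Set T) : Set T := {v | ∃ t ∈ Q, t ≤ v}

lemma up_mono {Q Q' : Set T} (h : Q ⊆ Q') : up Q ⊆ up Q' := fun _ ⟨t, ht, hle⟩ => ⟨t, h ht, hle⟩

@[simp] lemma up_empty : up (∅ : Set T) = ∅ := by
  ext
  simp [up]

variable [Fintype T]

/-- The standing assumptions on the tree and its edge clusters, with a positive bound `D`. -/
structure Setting (ℓ : Sym2 T → ℝ) (ε D κ : ℝ) (𝒞 : Set (Set T)) : Prop where
  bin : IsBinary T
  nonneg : EdgeNonneg ℓ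
  D_pos : 0 < D
  eps_pos : 0 < ε
  eps_le : ε ≤ 1
  woolly : IsWoollyTree ℓ ε D
  clust : IsEdgeClustering ℓ ε ε D κ 𝒞

/-- The edges of `T` that the edge `e` of the condensed tree stands for: a leaf edge stands for a
whole branch. -/
def piece (ℓ : Sym2 T → ℝ) (δ D : ℝ) (e : T) : Set T :=
  {v | IsBackboneEdge ℓ δ D e ∧ v = e ∨ IsLeafEdge ℓ δ D e ∧ e ≤ v}

/-- The edges of `T` that a set `K` of edges of the condensed tree stands for. -/
def region (ℓ : Sym2 T → ℝ) (δ D : ℝ) (K : Set T) : Set T := {v | ∃ e ∈ K, v ∈ piece ℓ δ D e}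

/-- The backbone edges in `K`. -/
def bones (ℓ : Sym2 T → ℝ) (δ D : ℝ) (K : Set T) : Set T := {v | v ∈ K ∧ IsBackboneEdge ℓ δ D v}

/-- The small leaf edges in `K`. -/
def smallLeaves (ℓ : Sym2 T → ℝ) (δ D : ℝ) (K : Set T) : Set T := {v | v ∈ K ∧ IsSmallLeaf ℓ δ D v}

section Region

variable {ℓ : Sym2 T → ℝ} {δ D : ℝ}

lemma eq_of_mem_piece {e e' v : T} (h : v ∈ piece ℓ δ D e) (h' : v ∈ piece ℓ δ D e') : e = e' := by
  rcases h with ⟨h1, rfl⟩ | ⟨h1, h2⟩ <;> rcases h' with ⟨h3, h4⟩ | ⟨h3, h4⟩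
  · exact h4
  · exact absurd h4 (h1.2.not_le_leafEdge h3)
  · rw [h4] at h2
    exact absurd h2 (h3.2.not_le_leafEdge h1)
  · exact h1.eq_of_le h3 h2 h4

lemma cost_piece {e : T} (he : IsBackboneEdge ℓ δ D e ∨ IsLeafEdge ℓ δ D e)
    (hℓ : EdgeNonneg ℓ) : cost ℓ (piece ℓ δ D e) = condLoad ℓ δ D e := by
  rcases he with he | he
  · have h1 : piece ℓ δ D e = {e} := by
      ext v
      simp [piece, he, he.2.not_isLeafEdge]
    have h2 : ¬ Condensed ℓ δ D e := fun h => he.2.not_isLeafEdge (h.isLeafEdge hℓ)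
    rw [h1, condLoad, if_neg h2, cost, Finset.sum_eq_single e] <;>
      simp +contextual [wt_of_ne he.1]
  · have h1 : piece ℓ δ D e = Set.Ici e := by
      ext v
      have : ¬ IsBackboneEdge ℓ δ D e := fun h => h.2.not_isLeafEdge he
      simp [piece, he, this]
    rw [h1, he.condLoad_eq]

lemma setLoad_eq (hℓ : EdgeNonneg ℓ) {K : Set T}
    (hK : ∀ e ∈ K, IsBackboneEdge ℓ δ D e ∨ IsSmallLeaf ℓ δ D e) :
    setLoad ℓ δ D K = cost ℓ (region ℓ δ D K) := by
  have h1 : ∀ e, K.indicator (condLoad ℓ δ D) e =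
      ∑ v, ({v | e ∈ K ∧ v ∈ piece ℓ δ D e} : Set T).indicator (wt ℓ) v := by
    intro e
    by_cases he : e ∈ K
    · rw [Set.indicator_of_mem he, ← cost_piece ((hK e he).imp_right fun h => h.1) hℓ]
      simp [cost, he]
    · simp [he]
  rw [setLoad, Finset.sum_congr rfl fun e _ => h1 e, cost, Finset.sum_comm]
  refine Finset.sum_congr rfl fun v _ => ?_
  by_cases hv : v ∈ region ℓ δ D K
  · rw [Set.indicator_of_mem hv]
    obtain ⟨e, he, hev⟩ := hv
    rw [Finset.sum_eq_single e]
    · simp [he, hev]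
    · intro e' _ hne
      refine Set.indicator_of_notMem (fun h => hne (eq_of_mem_piece h.2 hev)) _
    · simp
  · rw [Set.indicator_of_notMem hv]
    refine Finset.sum_eq_zero fun e _ => ?_
    have hn : v ∉ {v | e ∈ K ∧ v ∈ piece ℓ δ D e} := fun h => hv ⟨e, h⟩
    exact Set.indicator_of_notMem hn _

lemma region_eq {K : Set T} (hK : ∀ e ∈ K, IsBackboneEdge ℓ δ D e ∨ IsSmallLeaf ℓ δ D e) :
    region ℓ δ D K = bones ℓ δ D K ∪ up (smallLeaves ℓ δ D K) := by
  ext v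
  constructor
  · rintro ⟨e, he, ⟨h, rfl⟩ | ⟨h, hle⟩⟩
    · exact Or.inl ⟨he, h⟩
    · refine Or.inr ⟨e, ⟨he, (hK e he).resolve_left fun h' => h'.2.not_isLeafEdge h⟩, hle⟩
  · rintro (⟨h, h'⟩ | ⟨t, ⟨h, h'⟩, hle⟩)
    exacts [⟨v, h, Or.inl ⟨h', rfl⟩⟩, ⟨t, h, Or.inr ⟨h'.1, hle⟩⟩]

lemma bones_disjoint_up {K Q : Set T} (hQ : ∀ t ∈ Q, IsLeafEdge ℓ δ D t) :
    Disjoint (bones ℓ δ D K) (up Q) := by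
  rw [Set.disjoint_left]
  rintro v ⟨-, h⟩ ⟨t, ht, hle⟩
  exact h.2.not_le_leafEdge (hQ t ht) hle

lemma cost_up_add (Q Q' : Set T) (hsub : Q ⊆ Q') (hQ : ∀ t ∈ Q', IsLeafEdge ℓ δ D t) :
    cost ℓ (up Q') = cost ℓ (up Q) + cost ℓ (up (Q' \ Q)) := by
  rw [← cost_union]
  · congr 1
    ext v
    constructor
    · rintro ⟨t, ht, hle⟩
      by_cases h : t ∈ Q
      exacts [Or.inl ⟨t, h, hle⟩, Or.inr ⟨t, ⟨ht, h⟩, hle⟩]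
    · rintro (h | h)
      exacts [up_mono hsub h, up_mono Set.sdiff_subset h]
  · rw [Set.disjoint_left]
    rintro v ⟨t, ht, hle⟩ ⟨t', ht', hle'⟩
    exact ht'.2 ((hQ t (hsub ht)).eq_of_le (hQ t' ht'.1) hle hle' ▸ ht)

end Region

namespace Setting

variable {ℓ : Sym2 T → ℝ} {ε D κ : ℝ} {𝒞 : Set (Set T)}

lemma kind (S : Setting ℓ ε D κ 𝒞) {C : Set T} (hC : C ∈ 𝒞) {e : T} (he : e ∈ C) :
    IsBackboneEdge ℓ ε D e ∨ IsSmallLeaf ℓ ε D e := by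
  obtain ⟨W, hW, -, hsub⟩ := S.clust.subedge C hC
  exact (hW.mem (hsub.2.1 he)).1

lemma onBackbone_foot (S : Setting ℓ ε D κ 𝒞) {C : Set T} (hC : C ∈ 𝒞) {e : T} (he : e ∈ C) :
    OnBackbone ℓ ε D (foot ℓ ε D e) := by
  obtain ⟨W, hW, -, hsub⟩ := S.clust.subedge C hC
  exact (hW.mem (hsub.2.1 he)).2.1

lemma samePath (S : Setting ℓ ε D κ 𝒞) {C : Set T} (hC : C ∈ 𝒞) {e e' : T} (he : e ∈ C)
    (he' : e' ∈ C) : SamePath ℓ ε D (foot ℓ ε D e) (foot ℓ ε D e') := by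
  obtain ⟨W, hW, -, hsub⟩ := S.clust.subedge C hC
  exact hW.samePath (hsub.2.1 he) (hsub.2.1 he')

/-- Clusters are contiguous parts of woolly edges. -/
lemma mem_of_between (S : Setting ℓ ε D κ 𝒞) {C : Set T} (hC : C ∈ 𝒞) {a b c : T} (ha : a ∈ C)
    (hc : c ∈ C) (hb : IsBackboneEdge ℓ ε D b ∨ IsSmallLeaf ℓ ε D b)
    (hf : OnBackbone ℓ ε D (foot ℓ ε D b)) (hab : Before ℓ ε D a b) (hbc : Before ℓ ε D b c) :
    b ∈ C := by
  obtain ⟨W, hW, -, hsub⟩ := S.clust.subedge C hC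
  refine hsub.2.2 a ha c hc b ?_ hab hbc
  have h1 : foot ℓ ε D a ≤ foot ℓ ε D b := hab.elim le_of_lt fun h => h.1.le
  have h2 : foot ℓ ε D b ≤ foot ℓ ε D c := hbc.elim le_of_lt fun h => h.1.le
  rw [(hW.mem (hsub.2.1 ha)).2.2]
  refine ⟨hb, hf, Or.inl ⟨h1, fun z hz hz' => ?_⟩⟩
  rcases S.samePath hC ha hc with ⟨-, h⟩ | ⟨h, -⟩
  · exact h z hz (hz'.trans_le h2)
  · exact absurd (hz.trans_lt (hz'.trans_le h2)) h.not_gt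

/-- A path down from the root that enters an edge cluster through a backbone edge and leaves it
passes all of it. -/
lemma foot_le_foot (S : Setting ℓ ε D κ 𝒞) {C : Set T} (hC : C ∈ 𝒞) {u z c : T} (hu : u ∈ C)
    (hub : IsBackboneEdge ℓ ε D u) (hz0 : z ≠ ⊥) (hz : Kept ℓ ε D z) (huz : u ≤ z) (hzC : z ∉ C)
    (hc : c ∈ C) : foot ℓ ε D c ≤ foot ℓ ε D z := by
  have hcb := S.onBackbone_foot hC hc
  have hfu := hub.2.foot_eq
  have key : ∀ q, AboveLeafCluster ℓ ε D q → u ≤ q → foot ℓ ε D c ≤ q ∨ q < foot ℓ ε D c := by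
    intro q hq huq
    by_contra! h
    have hcu : ¬ foot ℓ ε D c ≤ u := fun h' => h.1 (h'.trans huq)
    rcases S.samePath hC hu hc with ⟨h1, h2⟩ | ⟨h1, h2⟩
    · rw [hfu] at h1 h2
      have hne : ¬ q ≤ foot ℓ ε D c := fun h' => h.2 (lt_of_le_of_ne h' fun h'' => h.1 h''.ge)
      exact h2 _ (le_inf huq h1) (lt_of_le_of_ne inf_le_right fun h'' => h.1 (inf_eq_right.1 h''))
        (isBranching_inf hq hcb.above hne h.1)
    · exact hcu (h1.trans hfu.le)
  rcases S.woolly z hz0 hz with hzb | hzl | ⟨hzs, hzf⟩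
  · rw [hzb.2.foot_eq]
    refine (key z hzb.2.above huz).resolve_right fun hlt => hzC ?_
    refine S.mem_of_between hC hu hc (Or.inl hzb) (by rw [hzb.2.foot_eq]; exact hzb.2) ?_ ?_
    · left
      rw [hfu, hzb.2.foot_eq]
      exact lt_of_le_of_ne huz fun h => hzC (h ▸ hu)
    · left
      rwa [hzb.2.foot_eq]
  · have hns : ¬ IsSmallLeaf ℓ ε D z := fun h => h.not_isLeafCluster hzl
    have : foot ℓ ε D z = z := by simp [foot, hns]
    rw [this]
    refine (key z ⟨z, hzl, le_rfl⟩ huz).resolve_right fun hlt => ?_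
    exact hcb.not_le_leafEdge hzl.1 hlt.le
  · have hfz := hzs.foot_eq
    rw [← hfz] at hzf
    have hlt : u < z := lt_of_le_of_ne huz fun h => hub.2.not_isSmallLeaf (h ▸ hzs)
    have hle := hzs.le_foot hlt
    refine (key _ hzf.above hle).resolve_right fun hlt' => hzC ?_
    refine S.mem_of_between hC hu hc (Or.inr hzs) hzf ?_ (Or.inl hlt')
    rw [Before, hfu]
    rcases hle.lt_or_eq with h | h
    · exact Or.inl h
    · exact Or.inr ⟨h, hub.2.not_isSmallLeaf, hzs⟩

lemma exists_leafCluster_below (S : Setting ℓ ε D κ 𝒞) {C : Set T} (hC : C ∈ 𝒞) :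
    ∃ w, IsLeafCluster ℓ ε D w ∧ ∀ c ∈ C, foot ℓ ε D c < w := by
  obtain ⟨W, hW, -, hsub⟩ := S.clust.subedge C hC
  obtain ⟨c, hc, hm⟩ := hW.exists_maximal_foot hsub.2.1 hsub.1
  obtain ⟨w, hw, hlt⟩ := S.onBackbone_foot hC hc
  exact ⟨w, hw, fun c' hc' => (hm c' hc').trans_lt hlt⟩

lemma small_kind {W : Set T} (hW : IsSmallCluster ℓ ε ε D W) {e : T} (he : e ∈ W) :
    IsBackboneEdge ℓ ε D e ∨ IsSmallLeaf ℓ ε D e := (hW.1.mem he).1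

lemma notMem_of_small (S : Setting ℓ ε D κ 𝒞) {C W : Set T} (hC : C ∈ 𝒞)
    (hW : IsSmallCluster ℓ ε ε D W) {v : T} (hv : v ∈ C) : v ∉ W := by
  obtain ⟨W', hW', hns, hsub⟩ := S.clust.subedge C hC
  intro h
  rw [hW.1.eq_of_mem hW' h (hsub.2.1 hv)] at hW
  exact hns hW

lemma eq_of_mem (S : Setting ℓ ε D κ 𝒞) {C C' : Set T} (hC : C ∈ 𝒞) (hC' : C' ∈ 𝒞) {v : T}
    (hv : v ∈ C) (hv' : v ∈ C') : C = C' := by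
  by_contra hne
  exact Set.disjoint_left.1 (S.clust.disjoint hC hC' hne) hv hv'

lemma exists_cluster (S : Setting ℓ ε D κ 𝒞) {v : T}
    (hv : IsBackboneEdge ℓ ε D v ∨ IsSmallLeaf ℓ ε D v) :
    (∃ W, IsSmallCluster ℓ ε ε D W ∧ v ∈ W) ∨ ∃ C ∈ 𝒞, v ∈ C := by
  obtain ⟨W, hW, hm⟩ := exists_isWoollyEdge S.woolly hv
  by_cases h : IsSmallCluster ℓ ε ε D W
  · exact Or.inl ⟨W, h, hm⟩
  · exact Or.inr (S.clust.cover W hW h v hm)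

lemma exists_piece (S : Setting ℓ ε D κ 𝒞) {v : T} (hv : v ≠ ⊥) :
    ∃ e, (IsBackboneEdge ℓ ε D e ∨ IsLeafCluster ℓ ε D e ∨ IsSmallLeaf ℓ ε D e) ∧
      v ∈ piece ℓ ε D e := by
  rcases kept_or_exists_leafEdge (δ := ε) (D := D) S.nonneg v with hk | ⟨t, ht, hlt⟩
  · rcases S.woolly v hv hk with h | h | h
    · exact ⟨v, Or.inl h, Or.inl ⟨h, rfl⟩⟩
    · exact ⟨v, Or.inr (Or.inl h), Or.inr ⟨h.1, le_rfl⟩⟩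
    · exact ⟨v, Or.inr (Or.inr h.1), Or.inr ⟨h.1.1, le_rfl⟩⟩
  · exact ⟨t, Or.inr ht.leafCluster_or_small, Or.inr ⟨ht, hlt.le⟩⟩

section Sum

open scoped Classical

/-- The clusters partition the edges of the tree. -/
lemma existsUnique_region (S : Setting ℓ ε D κ 𝒞) {v : T} (hv : v ≠ ⊥) :
    ∃! K : {w : T // IsLeafCluster ℓ ε D w} ⊕
        ({W : Set T // IsSmallCluster ℓ ε ε D W} ⊕ {C : Set T // C ∈ 𝒞}),
      v ∈ region ℓ ε D (Sum.elim (fun w => {w.1}) (Sum.elim Subtype.val Subtype.val) K) := by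
  have hexK : ∃ K : {w : T // IsLeafCluster ℓ ε D w} ⊕
        ({W : Set T // IsSmallCluster ℓ ε ε D W} ⊕ {C : Set T // C ∈ 𝒞}),
      v ∈ region ℓ ε D (Sum.elim (fun w => {w.1}) (Sum.elim Subtype.val Subtype.val) K) := by
    obtain ⟨e, he, hve⟩ := S.exists_piece hv
    by_cases hl : IsLeafCluster ℓ ε D e
    · exact ⟨Sum.inl ⟨e, hl⟩, e, rfl, hve⟩
    · rcases S.exists_cluster (v := e) (he.imp_right fun h => h.resolve_left hl) with
        ⟨W, hW, hm⟩ | ⟨C, hC, hm⟩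
      exacts [⟨Sum.inr (Sum.inl ⟨W, hW⟩), e, hm, hve⟩, ⟨Sum.inr (Sum.inr ⟨C, hC⟩), e, hm, hve⟩]
  refine existsUnique_of_exists_of_unique hexK ?_
  have hl : ∀ w, IsLeafCluster ℓ ε D w → ¬ (IsBackboneEdge ℓ ε D w ∨ IsSmallLeaf ℓ ε D w) := by
    rintro w hw (h | h)
    exacts [h.2.not_isLeafEdge hw.1, h.not_isLeafCluster hw]
  rintro (w | W | C) (w' | W' | C') ⟨e, he, hve⟩ ⟨e', he', hve'⟩ <;>
    obtain rfl := eq_of_mem_piece hve hve' <;>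
    simp only [Sum.elim_inl, Sum.elim_inr, Set.mem_singleton_iff] at he he'
  · rw [Subtype.ext (he.symm.trans he')]
  · exact absurd (small_kind W'.2 he') (hl _ (he ▸ w.2))
  · exact absurd (S.kind C'.2 he') (hl _ (he ▸ w.2))
  · exact absurd (small_kind W.2 he) (hl _ (he' ▸ w'.2))
  · rw [Subtype.ext (W.2.1.eq_of_mem W'.2.1 he he')]
  · exact absurd he (S.notMem_of_small C'.2 W.2 he')
  · exact absurd (S.kind C.2 he) (hl _ (he' ▸ w'.2))
  · exact absurd he' (S.notMem_of_small C.2 W'.2 he)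
  · rw [Subtype.ext (S.eq_of_mem C.2 C'.2 he he')]

lemma cost_eq_sum (S : Setting ℓ ε D κ 𝒞) (H : Set T) :
    cost ℓ H = ∑ w : {w : T // IsLeafCluster ℓ ε D w}, cost ℓ (H ∩ Set.Ici w.1) +
      (∑ W : {W : Set T // IsSmallCluster ℓ ε ε D W}, cost ℓ (H ∩ region ℓ ε D W.1) +
        ∑ C : {C : Set T // C ∈ 𝒞}, cost ℓ (H ∩ region ℓ ε D C.1)) := by
  rw [cost_eq_sum_of_partition _ (fun v hv => S.existsUnique_region hv), Fintype.sum_sum_type,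
    Fintype.sum_sum_type]
  simp only [Sum.elim_inl, Sum.elim_inr]
  congr 1
  refine Finset.sum_congr rfl fun w _ => ?_
  congr 2
  ext v
  have : ¬ IsBackboneEdge ℓ ε D w.1 := fun h => h.2.not_isLeafEdge w.2.1
  simp [region, piece, w.2.1, this]

end Sum

end Setting
end Makespan

/-! ### Splitting an edge cluster -/

namespace Makespan

variable {T : RootedTree.{u}} [Fintype T]

/-- A tour visiting `H` reaches the path of `C` and follows it to its end. -/
def Passes (ℓ : Sym2 T → ℝ) (δ D : ℝ) (H C : Set T) : Prop := ∀ c ∈ C, foot ℓ δ D c ∈ H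

/-- A tour visiting `H` reaches the path of `C` but does not follow it to its end. -/
def EndsIn (ℓ : Sym2 T → ℝ) (δ D : ℝ) (H C : Set T) : Prop :=
  ¬ Passes ℓ δ D H C ∧ ∃ c ∈ C, foot ℓ δ D c ∈ H

/-- `Q` is an initial part of the small leaf edges of `C`, in order of distance from the root. -/
def IsPrefix (ℓ : Sym2 T → ℝ) (δ D : ℝ) (C Q : Set T) : Prop :=
  Q ⊆ smallLeaves ℓ δ D C ∧
    ∀ t ∈ Q, ∀ t' ∈ smallLeaves ℓ δ D C, foot ℓ δ D t' ≤ foot ℓ δ D t → t' ∈ Q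

/-- The backbone edges of `C` that lie above the small leaf edges in `Q`. -/
def stem (ℓ : Sym2 T → ℝ) (δ D : ℝ) (C Q : Set T) : Set T :=
  {v | v ∈ bones ℓ δ D C ∧ ∃ t ∈ Q, v ≤ foot ℓ δ D t}

/-- A fractional split of the edge cluster `C` between the tours ending in it and those passing it:
the ending tours get `Q₀` and the fraction of load `lam` of the straddling rest of `Q₁`, together
with the backbone down to it, and the passing tours get the other small leaf edges. What the two
groups get is covered by what the tours with visited sets `H i` visit of `C`. -/
structure IsSplit (ℓ : Sym2 T → ℝ) (δ D : ℝ) {k : ℕ} (H : Fin k → Set T) (C Q₀ Q₁ : Set T)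
    (lam : ℝ) : Prop where
  subset : Q₀ ⊆ Q₁
  prefix₀ : IsPrefix ℓ δ D C Q₀
  prefix₁ : IsPrefix ℓ δ D C Q₁
  straddle_le : cost ℓ (up (Q₁ \ Q₀)) ≤ δ / 2 * D
  lam_nonneg : 0 ≤ lam
  lam_le : lam ≤ cost ℓ (up (Q₁ \ Q₀))
  exists_ending : Q₁.Nonempty → ∃ i, EndsIn ℓ δ D (H i) C
  exists_bone : Q₁.Nonempty → ∃ v ∈ bones ℓ δ D C, ∀ t ∈ Q₁, ¬ v ≤ foot ℓ δ D t
  ending_le : cost ℓ (up Q₀) + lam + cost ℓ (stem ℓ δ D C Q₁) ≤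
    ∑ i, {i | EndsIn ℓ δ D (H i) C}.indicator (fun i => cost ℓ (H i ∩ region ℓ δ D C)) i
  passing_le : cost ℓ (up (smallLeaves ℓ δ D C \ Q₁)) + (cost ℓ (up (Q₁ \ Q₀)) - lam) ≤
    ∑ i, {i | Passes ℓ δ D (H i) C}.indicator
      (fun i => cost ℓ (H i ∩ up (smallLeaves ℓ δ D C))) i

namespace Setting

variable {ℓ : Sym2 T → ℝ} {ε D κ : ℝ} {𝒞 : Set (Set T)}

lemma foot_comparable (S : Setting ℓ ε D κ 𝒞) {C : Set T} (hC : C ∈ 𝒞) {e e' : T} (he : e ∈ C)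
    (he' : e' ∈ C) : foot ℓ ε D e < foot ℓ ε D e' ∨ foot ℓ ε D e' ≤ foot ℓ ε D e := by
  rcases (S.samePath hC he he').le_total with h | h
  · exact h.lt_or_eq.imp_right fun h => h.ge
  · exact Or.inr h

/-- Below the foot of a small leaf edge of a cluster that is not the lowest foot of the cluster
there is a backbone edge of the cluster. -/
lemma exists_bone_below (S : Setting ℓ ε D κ 𝒞) {C : Set T} (hC : C ∈ 𝒞) {s v : T} (hs : s ∈ C)
    (hv : v ∈ C) (hlt : foot ℓ ε D s < foot ℓ ε D v) :
    ∃ u ∈ bones ℓ ε D C, foot ℓ ε D s < u := by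
  rcases S.kind hC hv with h | h
  · exact ⟨v, ⟨hv, h⟩, by rwa [h.2.foot_eq] at hlt⟩
  · have hf := S.onBackbone_foot hC hv
    have hff := hf.foot_eq
    have hb : IsBackboneEdge ℓ ε D (foot ℓ ε D v) := ⟨ne_bot_of_gt hlt, hf⟩
    refine ⟨_, ⟨S.mem_of_between hC hs hv (Or.inl hb) (by rwa [hff]) ?_ ?_, hb⟩, hlt⟩
    · left
      rwa [hff]
    · right
      rw [hff]
      exact ⟨rfl, hf.not_isSmallLeaf, h⟩

/-- Let the tours ending in `C` cover the load `L` of the small leaf edges. They get the initial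
part of load `L`, so that the straddling leaf edge is the last one before which the load is less
than `L`. Some ending tour goes down that far, as otherwise they could not cover the load `L`. -/
lemma exists_isSplit (S : Setting ℓ ε D κ 𝒞) {k : ℕ} {H : Fin k → Set T}
    (hlow : ∀ i, IsLowerSet (H i)) (hcov : ∀ v, ∃ i, v ∈ H i) {C : Set T} (hC : C ∈ 𝒞) :
    ∃ Q₀ Q₁ lam, IsSplit ℓ ε D H C Q₀ Q₁ lam := by
  classical
  have hℓ := S.nonneg
  set Λ := smallLeaves ℓ ε D C with hΛ
  have hleaf : ∀ t ∈ Λ, IsLeafEdge ℓ ε D t := fun t ht => ht.2.1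
  have hreg := region_eq (ℓ := ℓ) (δ := ε) (D := D) fun e he => S.kind hC he
  set U := {v | v ∈ up Λ ∧ ∃ i, EndsIn ℓ ε D (H i) C ∧ v ∈ H i} with hU
  have hpass : cost ℓ (up Λ) - cost ℓ U ≤ ∑ i, {i | Passes ℓ ε D (H i) C}.indicator
      (fun i => cost ℓ (H i ∩ up Λ)) i := by
    have h1 : cost ℓ (up Λ) ≤ cost ℓ U + cost ℓ (up Λ \ U) := by
      rw [← cost_union disjoint_sdiff_self_right]
      exact cost_mono hℓ (by intro v hv; by_cases h : v ∈ U <;> simp [h, hv])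
    have h2 : cost ℓ (up Λ \ U) ≤
        ∑ i, cost ℓ {v | Passes ℓ ε D (H i) C ∧ v ∈ H i ∩ up Λ} := by
      refine cost_le_sum hℓ _ _ _ fun v hv => ?_
      obtain ⟨i, hi⟩ := hcov v
      refine ⟨i, Finset.mem_univ _, ?_, hi, hv.1⟩
      by_contra hnp
      obtain ⟨t, ht, hle⟩ := hv.1
      exact hv.2 ⟨hv.1, i, ⟨hnp, t, ht.1, hlow i ((foot_le t).trans hle) hi⟩, hi⟩
    refine le_trans (by linarith) (h2.trans_eq (Finset.sum_congr rfl fun i _ => ?_))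
    by_cases hi : Passes ℓ ε D (H i) C
    · simp only [hi, true_and, Set.indicator, Set.mem_ofPred_eq, if_true]
      rfl
    · simp [hi]
  by_cases hU0 : cost ℓ U ≤ 0
  · refine ⟨∅, ∅, 0, ⟨le_rfl, ⟨by simp, by simp⟩, ⟨by simp, by simp⟩, ?_, le_rfl, by simp, by simp,
      by simp, ?_, ?_⟩⟩
    · have := S.eps_pos
      have := S.D_pos
      simp only [Set.sdiff_self, up_empty, cost_empty]
      positivity
    · have : stem ℓ ε D C ∅ = ∅ := by simp [stem]
      rw [this]
      simp only [up_empty, cost_empty, add_zero]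
      exact Finset.sum_nonneg fun i _ => Set.indicator_nonneg (fun i _ => cost_nonneg hℓ _) i
    · simp only [Set.sdiff_empty, up_empty, cost_empty, sub_zero, add_zero]
      have := cost_nonneg hℓ U
      linarith
  push Not at hU0
  let low : T → Set T := fun t => {t' | t' ∈ Λ ∧ foot ℓ ε D t' < foot ℓ ε D t}
  have hΛne : Λ.Nonempty := by
    by_contra h
    rw [Set.not_nonempty_iff_eq_empty] at h
    have : U = ∅ := by simp [hU, h]
    rw [this, cost_empty] at hU0
    exact lt_irrefl _ hU0
  have hex : {t | t ∈ Λ ∧ cost ℓ (up (low t)) < cost ℓ U}.Nonempty := by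
    obtain ⟨x, ⟨t, ht, rfl⟩, hm⟩ :=
      ((Set.toFinite Λ).image (foot ℓ ε D)).exists_minimal (hΛne.image _)
    refine ⟨t, ht, ?_⟩
    have : low t = ∅ := by
      rw [Set.eq_empty_iff_forall_notMem]
      rintro t' ⟨ht', hlt⟩
      exact hlt.not_ge (hm ⟨t', ht', rfl⟩ hlt.le)
    rwa [this, up_empty, cost_empty]
  obtain ⟨x, ⟨s, ⟨hs, hsU⟩, rfl⟩, hm⟩ :=
    ((Set.toFinite {t | t ∈ Λ ∧ cost ℓ (up (low t)) < cost ℓ U}).image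
      (foot ℓ ε D)).exists_maximal (hex.image _)
  set Q₀ := low s with hQ₀
  set Q₁ := {t' | t' ∈ Λ ∧ foot ℓ ε D t' ≤ foot ℓ ε D s} with hQ₁
  have hsub : Q₀ ⊆ Q₁ := fun t ht => ⟨ht.1, ht.2.le⟩
  have hdiff : Q₁ \ Q₀ ⊆ {s} := by
    rintro t ⟨⟨ht, hle⟩, hn⟩
    rcases hle.lt_or_eq with h | h
    · exact absurd ⟨ht, h⟩ hn
    · exact foot_injOn S.bin S.woolly ht.2 hs.2 h
  have hadd := cost_up_add (ℓ := ℓ) Q₀ Q₁ hsub fun t ht => hleaf t ht.1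
  have hadd' := cost_up_add (ℓ := ℓ) Q₁ Λ (fun t ht => ht.1) hleaf
  have hUΛ : cost ℓ U ≤ cost ℓ (up Λ) := cost_mono hℓ fun v hv => hv.1
  -- after the straddling leaf edge the load `cost ℓ U` is reached
  have hreach : cost ℓ U ≤ cost ℓ (up Q₁) := by
    by_cases hlast : ∃ t ∈ Λ, foot ℓ ε D s < foot ℓ ε D t
    · obtain ⟨y, ⟨t, ⟨ht, hlt⟩, rfl⟩, hmin⟩ :=
        ((Set.toFinite {t | t ∈ Λ ∧ foot ℓ ε D s < foot ℓ ε D t}).image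
          (foot ℓ ε D)).exists_minimal ((show Set.Nonempty _ from hlast).image _)
      have h1 : cost ℓ U ≤ cost ℓ (up (low t)) := by
        by_contra! h
        exact hlt.not_ge (hm ⟨t, ⟨ht, h⟩, rfl⟩ hlt.le)
      refine h1.trans (cost_mono hℓ (up_mono fun t' ht' => ⟨ht'.1, ?_⟩))
      refine (S.foot_comparable hC hs.1 ht'.1.1).resolve_left fun h => ?_
      exact ht'.2.not_ge (hmin ⟨t', ⟨ht'.1, h⟩, rfl⟩ ht'.2.le)
    · push Not at hlast
      refine hUΛ.trans (cost_mono hℓ (up_mono fun t ht => ⟨ht, ?_⟩))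
      exact (S.foot_comparable hC hs.1 ht.1).resolve_left (hlast t ht)
  -- an ending tour that reaches the straddling leaf edge
  have hdeep : ∃ i, EndsIn ℓ ε D (H i) C ∧ foot ℓ ε D s ∈ H i := by
    by_contra! h
    refine hsU.not_ge (cost_mono hℓ ?_)
    rintro v ⟨⟨t, ht, hle⟩, i, hi, hv⟩
    refine ⟨t, ⟨ht, ?_⟩, hle⟩
    refine (S.foot_comparable hC ht.1 hs.1).resolve_right fun hst => ?_
    exact h i hi (hlow i (hst.trans ((foot_le t).trans hle)) hv)
  obtain ⟨i₀, hi₀, hsi⟩ := hdeep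
  refine ⟨Q₀, Q₁, cost ℓ U - cost ℓ (up Q₀), ⟨hsub, ⟨fun t ht => ht.1, ?_⟩, ⟨fun t ht => ht.1, ?_⟩,
    ?_, by linarith, by linarith, fun _ => ⟨i₀, hi₀⟩, fun _ => ?_, ?_, ?_⟩⟩
  · exact fun t ht t' ht' hle => ⟨ht', hle.trans_lt ht.2⟩
  · exact fun t ht t' ht' hle => ⟨ht', hle.trans ht.2⟩
  · refine (cost_mono hℓ (up_mono hdiff)).trans ?_
    have h1 : up ({s} : Set T) = Set.Ici s := by
      ext
      simp [up]
    rw [h1, ← hs.2.1.condLoad_eq]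
    exact hs.2.2.le
  · obtain ⟨hnp, -⟩ := hi₀
    simp only [Passes, not_forall] at hnp
    obtain ⟨v, hv, hvi⟩ := hnp
    have hlt : foot ℓ ε D s < foot ℓ ε D v :=
      (S.foot_comparable hC hs.1 hv).resolve_right fun h => hvi (hlow i₀ h hsi)
    obtain ⟨w, hw, hlt⟩ := S.exists_bone_below hC hs.1 hv hlt
    exact ⟨w, hw, fun t ht hle => (hle.trans ht.2).not_gt hlt⟩
  · have h1 : Disjoint U (stem ℓ ε D C Q₁) := by
      have := bones_disjoint_up (K := C) hleaf
      exact (this.mono (fun v hv => hv.1) (fun v hv => hv.1)).symm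
    have h2 : cost ℓ (up Q₀) + (cost ℓ U - cost ℓ (up Q₀)) + cost ℓ (stem ℓ ε D C Q₁) =
        cost ℓ (U ∪ stem ℓ ε D C Q₁) := by
      rw [cost_union h1]
      ring
    rw [h2]
    have h3 : cost ℓ (U ∪ stem ℓ ε D C Q₁) ≤
        ∑ i, cost ℓ {v | EndsIn ℓ ε D (H i) C ∧ v ∈ H i ∩ region ℓ ε D C} := by
      refine cost_le_sum hℓ _ _ _ ?_
      rintro v (⟨hv, i, hi, hvi⟩ | ⟨hv, t, ht, hle⟩)
      · refine ⟨i, Finset.mem_univ _, hi, hvi, ?_⟩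
        rw [hreg]
        exact Or.inr hv
      · refine ⟨i₀, Finset.mem_univ _, hi₀, hlow i₀ (hle.trans ht.2) hsi, ?_⟩
        rw [hreg]
        exact Or.inl hv
    refine h3.trans_eq (Finset.sum_congr rfl fun i _ => ?_)
    by_cases hi : EndsIn ℓ ε D (H i) C
    · simp only [hi, true_and, Set.indicator, Set.mem_ofPred_eq, if_true]
      rfl
    · simp [hi]
  · refine le_trans (le_of_eq ?_) hpass
    rw [hadd', hadd]
    ring

end Setting
end Makespan

/-! ### Tours for an assignment of the leaf edges -/

namespace Makespan

variable {T : RootedTree.{u}} [Fintype T]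

/-- The part of the backbone in `H` that is retained: the small clusters and the edge clusters which
`H` passes. -/
def base (ℓ : Sym2 T → ℝ) (δ D : ℝ) (𝒞 : Set (Set T)) (H : Set T) : Set T :=
  {v | OnBackbone ℓ δ D v ∧ v ∈ H ∧ ∀ C ∈ 𝒞, v ∈ C → Passes ℓ δ D H C}

/-- The vertices visited by the `i`-th new tour: the root, the retained part of `H i`, and, for every
leaf edge `t` with `g t = i`, the branch at `t` and the path from the root to it. -/
def newVisited (ℓ : Sym2 T → ℝ) (δ D : ℝ) (𝒞 : Set (Set T)) {k : ℕ} (H : Fin k → Set T)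
    (g : T → Fin k) (i : Fin k) : Set T :=
  {v | v = ⊥ ∨ v ∈ base ℓ δ D 𝒞 (H i) ∨ ∃ t, IsLeafEdge ℓ δ D t ∧ g t = i ∧ (v ≤ t ∨ t ≤ v)}

/-- The leaf edges are assigned to tours by `g` as in a simple structure: a small cluster `W` goes
to the tour of the leaf cluster `lam W` below it; of an edge cluster `C`, the initial part `Q C` goes
to the tour `en C` and the rest to the tour `pa C`, which passes `C`. -/
structure IsAssignment (ℓ : Sym2 T → ℝ) (ε D : ℝ) (𝒞 : Set (Set T)) {k : ℕ} (H : Fin k → Set T)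
    (g : T → Fin k) (lam : Set T → T) (Q : Set T → Set T) (en pa : Set T → Fin k) : Prop where
  leaf : ∀ w, IsLeafCluster ℓ ε D w → w ∈ H (g w)
  lam_leaf : ∀ W, IsSmallCluster ℓ ε ε D W → IsLeafCluster ℓ ε D (lam W)
  foot_lt : ∀ W, IsSmallCluster ℓ ε ε D W → ∀ v ∈ W, foot ℓ ε D v < lam W
  small : ∀ W, IsSmallCluster ℓ ε ε D W → ∀ t ∈ smallLeaves ℓ ε D W, g t = g (lam W)
  isPrefix : ∀ C ∈ 𝒞, IsPrefix ℓ ε D C (Q C)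
  mem : ∀ C ∈ 𝒞, ∀ t ∈ Q C, g t = en C
  notMem : ∀ C ∈ 𝒞, ∀ t ∈ smallLeaves ℓ ε D C, t ∉ Q C → g t = pa C
  touches : ∀ C ∈ 𝒞, (Q C).Nonempty → ∃ c ∈ C, foot ℓ ε D c ∈ H (en C)
  passes : ∀ C ∈ 𝒞, Passes ℓ ε D (H (pa C)) C

variable {ℓ : Sym2 T → ℝ} {ε D κ : ℝ} {𝒞 : Set (Set T)}

namespace Setting

lemma isBackboneEdge_of_mem (S : Setting ℓ ε D κ 𝒞) {C : Set T} (hC : C ∈ 𝒞) {v : T} (hv : v ∈ C)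
    (hb : OnBackbone ℓ ε D v) : IsBackboneEdge ℓ ε D v :=
  (S.kind hC hv).resolve_right hb.not_isSmallLeaf

lemma passes_of_le (S : Setting ℓ ε D κ 𝒞) {H C : Set T} (hlow : IsLowerSet H) (hC : C ∈ 𝒞)
    {u z : T} (hu : u ∈ C) (hub : OnBackbone ℓ ε D u) (hz : Kept ℓ ε D z) (huz : u ≤ z)
    (hzC : z ∉ C) (hzH : foot ℓ ε D z ∈ H) : Passes ℓ ε D H C := by
  have hb := S.isBackboneEdge_of_mem hC hu hub
  exact fun c hc => hlow (S.foot_le_foot hC hu hb (ne_bot_of_le hb.1 huz) hz huz hzC hc) hzH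

lemma base_lower (S : Setting ℓ ε D κ 𝒞) {H : Set T} (hlow : IsLowerSet H) :
    IsLowerSet (base ℓ ε D 𝒞 H) := by
  rintro v u huv ⟨hb, hv, hp⟩
  refine ⟨hb.mono huv, hlow huv hv, fun C hC hu => ?_⟩
  by_cases hvC : v ∈ C
  · exact hp C hC hvC
  · exact S.passes_of_le hlow hC hu (hb.mono huv) hb.kept huv hvC (by rwa [hb.foot_eq])

lemma mem_base_of_lt_leafCluster (S : Setting ℓ ε D κ 𝒞) {H : Set T} (hlow : IsLowerSet H)
    {u w : T} (hw : IsLeafCluster ℓ ε D w) (hwH : w ∈ H) (huw : u < w) :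
    u ∈ base ℓ ε D 𝒞 H := by
  have hb : OnBackbone ℓ ε D u := ⟨w, hw, huw⟩
  refine ⟨hb, hlow huw.le hwH, fun C hC hu => ?_⟩
  refine S.passes_of_le hlow hC hu hb hw.1.2.1 huw.le (fun h => ?_) (hlow (foot_le w) hwH)
  rcases S.kind hC h with h | h
  exacts [h.2.not_isLeafEdge hw.1, h.not_isLeafCluster hw]

/-- If `H` reaches the edge cluster `C` at all, then the path from the root to a small leaf edge of
`C` is retained until it meets `C`. -/
lemma mem_base_of_lt_smallLeaf (S : Setting ℓ ε D κ 𝒞) {H C : Set T} (hlow : IsLowerSet H)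
    (hC : C ∈ 𝒞) {c t u : T} (hc : c ∈ C) (hcH : foot ℓ ε D c ∈ H) (ht : t ∈ smallLeaves ℓ ε D C)
    (hut : u < t) (huC : u ∉ C) : u ∈ base ℓ ε D 𝒞 H := by
  have hle := ht.2.le_foot hut
  have hb : OnBackbone ℓ ε D u := (S.onBackbone_foot hC ht.1).mono hle
  have huc : u ≤ foot ℓ ε D c := by
    rcases S.foot_comparable hC hc ht.1 with h | h
    · refine (lt_or_le_of_le h.le hle).resolve_left fun h' => huC ?_
      have hbe : IsBackboneEdge ℓ ε D u := ⟨ne_bot_of_gt h', hb⟩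
      have hff := hb.foot_eq
      refine S.mem_of_between hC hc ht.1 (Or.inl hbe) (by rwa [hff]) ?_ ?_
      · left
        rwa [hff]
      · rw [Before, hff]
        rcases hle.lt_or_eq with h'' | h''
        exacts [Or.inl h'', Or.inr ⟨h'', hb.not_isSmallLeaf, ht.2⟩]
    · exact hle.trans h
  refine ⟨hb, hlow huc hcH, fun C' hC' hu => ?_⟩
  have hck : Kept ℓ ε D c := by
    rcases S.kind hC hc with h | h
    exacts [h.2.kept, h.1.2.1]
  refine S.passes_of_le hlow hC' hu hb hck (huc.trans (foot_le c)) (fun h => huC ?_) hcH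
  rwa [S.eq_of_mem hC hC' hc h]

end Setting

section New

variable {k : ℕ} {H : Fin k → Set T} {g : T → Fin k}

lemma mem_newVisited_iff {t v : T} (ht : IsLeafEdge ℓ ε D t) (htv : t ≤ v) (i : Fin k) :
    v ∈ newVisited ℓ ε D 𝒞 H g i ↔ i = g t := by
  refine ⟨?_, fun h => Or.inr (Or.inr ⟨t, ht, h.symm, Or.inr htv⟩)⟩
  rintro (rfl | h | ⟨t', ht', rfl, h | h⟩)
  · exact absurd rfl (ne_bot_of_le ht.1 htv)
  · exact absurd htv (h.1.not_le_leafEdge ht)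
  · rw [ht.eq_of_le_leafEdge ht' (htv.trans h)]
  · rw [ht.eq_of_le ht' htv h]

lemma newVisited_lower (S : Setting ℓ ε D κ 𝒞) (hlow : ∀ i, IsLowerSet (H i)) (i : Fin k) :
    IsLowerSet (newVisited ℓ ε D 𝒞 H g i) := by
  rintro v u huv (rfl | h | ⟨t, ht, hg, h | h⟩)
  · exact Or.inl (le_bot_iff.1 huv)
  · exact Or.inr (Or.inl (S.base_lower (hlow i) huv h))
  · exact Or.inr (Or.inr ⟨t, ht, hg, Or.inl (huv.trans h)⟩)
  · exact Or.inr (Or.inr ⟨t, ht, hg, le_total_of_le huv h⟩)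

lemma exists_of_mem_newVisited {v : T} (hv : IsBackboneEdge ℓ ε D v) {i : Fin k}
    (h : v ∈ newVisited ℓ ε D 𝒞 H g i) :
    v ∈ base ℓ ε D 𝒞 (H i) ∨ ∃ t, IsLeafEdge ℓ ε D t ∧ g t = i ∧ v < t := by
  rcases h with h | h | ⟨t, ht, hg, h | h⟩
  · exact absurd h hv.1
  · exact Or.inl h
  · exact Or.inr ⟨t, ht, hg, lt_of_le_of_ne h fun h' => hv.2.not_isLeafEdge (h' ▸ ht)⟩
  · exact absurd h (hv.2.not_le_leafEdge ht)

variable {lam : Set T → T} {Q : Set T → Set T} {en pa : Set T → Fin k}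

namespace IsAssignment

/-- Above an assigned leaf edge a tour needs retained backbone edges only, except in an edge cluster
that contains the leaf edge. -/
lemma mem_base_or (S : Setting ℓ ε D κ 𝒞) (hlow : ∀ i, IsLowerSet (H i))
    (A : IsAssignment ℓ ε D 𝒞 H g lam Q en pa) {t u : T} (ht : IsLeafEdge ℓ ε D t) (hut : u < t) :
    u ∈ base ℓ ε D 𝒞 (H (g t)) ∨ ∃ C ∈ 𝒞, u ∈ C ∧ t ∈ smallLeaves ℓ ε D C := by
  rcases ht.leafCluster_or_small with hl | hs
  · exact Or.inl (S.mem_base_of_lt_leafCluster (hlow _) hl (A.leaf t hl) hut)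
  · rcases S.exists_cluster (Or.inr hs) with ⟨W, hW, htW⟩ | ⟨C, hC, htC⟩
    · left
      rw [A.small W hW t ⟨htW, hs⟩]
      have hl := A.lam_leaf W hW
      exact S.mem_base_of_lt_leafCluster (hlow _) hl (A.leaf _ hl)
        ((hs.le_foot hut).trans_lt (A.foot_lt W hW t htW))
    · by_cases huC : u ∈ C
      · exact Or.inr ⟨C, hC, huC, htC, hs⟩
      · left
        have htouch : ∃ c ∈ C, foot ℓ ε D c ∈ H (g t) := by
          by_cases htQ : t ∈ Q C
          · rw [A.mem C hC t htQ]
            exact A.touches C hC ⟨t, htQ⟩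
          · rw [A.notMem C hC t ⟨htC, hs⟩ htQ]
            exact ⟨t, htC, A.passes C hC t htC⟩
        obtain ⟨c, hc, hcH⟩ := htouch
        exact S.mem_base_of_lt_smallLeaf (hlow _) hC hc hcH ⟨htC, hs⟩ hut huC

lemma inter_leafCluster_subset (i : Fin k) {w : T} (hw : IsLeafCluster ℓ ε D w) :
    newVisited ℓ ε D 𝒞 H g i ∩ Set.Ici w ⊆ {v | g w = i ∧ w ≤ v} :=
  fun _ hv => ⟨((mem_newVisited_iff hw.1 hv.2 i).1 hv.1).symm, hv.2⟩

lemma inter_small_subset (S : Setting ℓ ε D κ 𝒞) (hlow : ∀ i, IsLowerSet (H i))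
    (A : IsAssignment ℓ ε D 𝒞 H g lam Q en pa) (i : Fin k) {W : Set T}
    (hW : IsSmallCluster ℓ ε ε D W) :
    newVisited ℓ ε D 𝒞 H g i ∩ region ℓ ε D W ⊆
      (H i ∩ region ℓ ε D W) ∪ {v | g (lam W) = i ∧ v ∈ region ℓ ε D W} := by
  rintro v ⟨hv, hr⟩
  have hr' := hr
  rw [region_eq fun e he => Setting.small_kind hW he] at hr'
  rcases hr' with ⟨hvW, hb⟩ | ⟨t, ht, hle⟩
  · left
    rcases exists_of_mem_newVisited hb hv with h | ⟨t, ht, rfl, hlt⟩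
    · exact ⟨h.2.1, hr⟩
    · rcases A.mem_base_or S hlow ht hlt with h | ⟨C, hC, hvC, -⟩
      exacts [⟨h.2.1, hr⟩, absurd hvW (S.notMem_of_small hC hW hvC)]
  · right
    refine ⟨?_, hr⟩
    rw [← A.small W hW t ht]
    exact ((mem_newVisited_iff ht.2.1 hle i).1 hv).symm

lemma inter_bones (S : Setting ℓ ε D κ 𝒞) (hlow : ∀ i, IsLowerSet (H i))
    (A : IsAssignment ℓ ε D 𝒞 H g lam Q en pa) {i : Fin k} {C : Set T} (hC : C ∈ 𝒞) {v : T}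
    (hv : v ∈ bones ℓ ε D C) (hvi : v ∈ newVisited ℓ ε D 𝒞 H g i) :
    Passes ℓ ε D (H i) C ∨ (en C = i ∧ v ∈ stem ℓ ε D C (Q C)) := by
  rcases exists_of_mem_newVisited hv.2 hvi with h | ⟨t, ht, rfl, hlt⟩
  · exact Or.inl (h.2.2 C hC hv.1)
  · rcases A.mem_base_or S hlow ht hlt with h | ⟨C', hC', hvC', ht'⟩
    · exact Or.inl (h.2.2 C hC hv.1)
    · obtain rfl := S.eq_of_mem hC hC' hv.1 hvC'
      by_cases htQ : t ∈ Q C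
      · exact Or.inr ⟨(A.mem C hC t htQ).symm, hv, t, htQ, ht'.2.le_foot hlt⟩
      · rw [A.notMem C hC t ht' htQ]
        exact Or.inl (A.passes C hC)

lemma inter_edge_subset (S : Setting ℓ ε D κ 𝒞) (hlow : ∀ i, IsLowerSet (H i))
    (A : IsAssignment ℓ ε D 𝒞 H g lam Q en pa) (i : Fin k) {C : Set T} (hC : C ∈ 𝒞) :
    newVisited ℓ ε D 𝒞 H g i ∩ region ℓ ε D C ⊆
      {v | Passes ℓ ε D (H i) C ∧ v ∈ bones ℓ ε D C} ∪
        ({v | en C = i ∧ v ∈ up (Q C) ∪ stem ℓ ε D C (Q C)} ∪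
          {v | pa C = i ∧ v ∈ up (smallLeaves ℓ ε D C \ Q C)}) := by
  rintro v ⟨hv, hr⟩
  rw [region_eq fun e he => S.kind hC he] at hr
  rcases hr with hb | ⟨t, ht, hle⟩
  · rcases A.inter_bones S hlow hC hb hv with h | ⟨h, h'⟩
    exacts [Or.inl ⟨h, hb⟩, Or.inr (Or.inl ⟨h, Or.inr h'⟩)]
  · have hg := (mem_newVisited_iff ht.2.1 hle i).1 hv
    by_cases htQ : t ∈ Q C
    · exact Or.inr (Or.inl ⟨(A.mem C hC t htQ).symm.trans hg.symm, Or.inl ⟨t, htQ, hle⟩⟩)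
    · exact Or.inr (Or.inr ⟨(A.notMem C hC t ht htQ).symm.trans hg.symm, t, ⟨ht, htQ⟩, hle⟩)

variable {τ : Fin k → Tour T}

lemma mem_support_iff (hτ : ∀ i, visited (τ i) = newVisited ℓ ε D 𝒞 H g i) {t v : T}
    (ht : IsLeafEdge ℓ ε D t) (htv : t ≤ v) (i : Fin k) : v ∈ (τ i).support ↔ i = g t := by
  rw [← mem_newVisited_iff (𝒞 := 𝒞) (H := H) ht htv i, ← hτ i]
  rfl

lemma coversSome_iff (hτ : ∀ i, visited (τ i) = newVisited ℓ ε D 𝒞 H g i) (C : Set T) (i : Fin k) :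
    CoversSome ℓ ε D (τ i) C ↔ ∃ t ∈ C, IsLeafEdge ℓ ε D t ∧ g t = i := by
  constructor
  · rintro ⟨c, ⟨-, t, htC, ht, hle⟩, hc⟩
    exact ⟨t, htC, ht, ((mem_support_iff hτ ht hle i).1 hc).symm⟩
  · rintro ⟨t, htC, ht, rfl⟩
    obtain ⟨c, hc, hle⟩ := exists_isMax_ge t
    exact ⟨c, ⟨hc, t, htC, ht, hle⟩, (mem_support_iff hτ ht hle _).2 rfl⟩

lemma singleCoverage (hτ : ∀ i, visited (τ i) = newVisited ℓ ε D 𝒞 H g i) {C : Set T} (i : Fin k)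
    (h : ∀ t ∈ C, IsLeafEdge ℓ ε D t → g t = i) : SingleCoverage ℓ ε D τ C := by
  refine ⟨i, ?_⟩
  rintro c ⟨-, t, htC, ht, hle⟩ j
  rw [mem_support_iff hτ ht hle, h t htC ht]

lemma splitCoverage (S : Setting ℓ ε D κ 𝒞) (hlow : ∀ i, IsLowerSet (H i))
    (A : IsAssignment ℓ ε D 𝒞 H g lam Q en pa)
    (hτ : ∀ i, visited (τ i) = newVisited ℓ ε D 𝒞 H g i) {C : Set T} (hC : C ∈ 𝒞)
    (hQ : (Q C).Nonempty) (hQ' : (smallLeaves ℓ ε D C \ Q C).Nonempty)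
    (hend : ¬ Passes ℓ ε D (H (en C)) C)
    (hbone : ∃ v ∈ bones ℓ ε D C, ∀ t ∈ Q C, ¬ v ≤ foot ℓ ε D t) :
    SplitCoverage ℓ ε D τ C := by
  have hpre := A.isPrefix C hC
  refine ⟨en C, pa C, ⟨?_, ?_⟩, ⟨?_, ?_⟩, ?_⟩
  · obtain ⟨v, hv, hvQ⟩ := hbone
    intro htr
    have hvs := (parentEdge_mem_edges_iff _ hv.2.1).1 (htr v hv.1 hv.2)
    have hvn : v ∈ newVisited ℓ ε D 𝒞 H g (en C) := by
      rw [← hτ]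
      exact hvs
    rcases A.inter_bones S hlow hC hv hvn with h | ⟨-, -, t, ht, hle⟩
    exacts [hend h, hvQ t ht hle]
  · obtain ⟨t, ht⟩ := hQ
    have hts := hpre.1 ht
    exact (coversSome_iff hτ C _).2 ⟨t, hts.1, hts.2.1, A.mem C hC t ht⟩
  · intro v hv hb
    rw [parentEdge_mem_edges_iff _ hb.1]
    change v ∈ visited _
    rw [hτ]
    have hp := A.passes C hC
    refine Or.inr (Or.inl ⟨hb.2, ?_, fun C' hC' hv' => ?_⟩)
    · have := hp v hv
      rwa [hb.2.foot_eq] at this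
    · rwa [← S.eq_of_mem hC hC' hv hv']
  · obtain ⟨t, ht, htQ⟩ := hQ'
    exact (coversSome_iff hτ C _).2 ⟨t, ht.1, ht.2.1, A.notMem C hC t ht htQ⟩
  · obtain ⟨x, ⟨e₀, he₀, rfl⟩, hm⟩ :=
      ((Set.toFinite (Q C)).image (foot ℓ ε D)).exists_maximal (hQ.image _)
    have hs₀ := hpre.1 he₀
    refine ⟨e₀, hs₀.1, hs₀.2, fun e he hes c hc hec => ⟨fun h j => ?_, fun h j => ?_⟩⟩
    · have hle : foot ℓ ε D e ≤ foot ℓ ε D e₀ := by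
        rcases h with rfl | h | h
        exacts [le_rfl, h.le, h.1.le]
      rw [mem_support_iff hτ hes.1 hec, A.mem C hC e (hpre.2 e₀ he₀ e ⟨he, hes⟩ hle)]
    · have hlt : foot ℓ ε D e₀ < foot ℓ ε D e := h.resolve_right fun h' => h'.2.1 hs₀.2
      have heQ : e ∉ Q C := fun h' => hlt.not_ge (hm ⟨e, h', rfl⟩ hlt.le)
      rw [mem_support_iff hτ hes.1 hec, A.notMem C hC e ⟨he, hes⟩ heQ]

end IsAssignment

end New
end Makespan

/-! ### Rounding the shares of the tours -/

namespace Makespan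

lemma exists_extension {α β : Type*} [Nonempty β] {p : α → Prop} (f : {x : α // p x} → β) :
    ∃ F : α → β, ∀ x, F x.1 = f x :=
  ⟨Function.extend Subtype.val f fun _ => Classical.arbitrary β, fun x =>
    Subtype.val_injective.extend_apply _ _ x⟩

variable {T : RootedTree.{u}} [Fintype T]

open scoped Classical

/-- The load charged to the tour `i` in the edge cluster `C`, if the initial part `Q` of the small
leaf edges of `C` goes to the tour `e` and the rest to the tour `p`: a tour that passes `C` pays for
all backbone edges of `C`, the tour `e` for those above `Q`. -/
noncomputable def clusterCharge (ℓ : Sym2 T → ℝ) (δ D : ℝ) {k : ℕ} (H : Fin k → Set T)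
    (C Q : Set T) (e p i : Fin k) : ℝ :=
  (if Passes ℓ δ D (H i) C then cost ℓ (bones ℓ δ D C) else 0) +
    (if e = i then cost ℓ (up Q) + cost ℓ (stem ℓ δ D C Q) else 0) +
    (if p = i then cost ℓ (up (smallLeaves ℓ δ D C \ Q)) else 0)

variable {ℓ : Sym2 T → ℝ} {ε D κ : ℝ} {𝒞 : Set (Set T)}

namespace Setting

lemma cost_region (S : Setting ℓ ε D κ 𝒞) {C : Set T} (hC : C ∈ 𝒞) :
    cost ℓ (region ℓ ε D C) = cost ℓ (bones ℓ ε D C) + cost ℓ (up (smallLeaves ℓ ε D C)) := by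
  rw [region_eq fun e he => S.kind hC he, cost_union (bones_disjoint_up fun t ht => ht.2.1)]

lemma le_cost_region (S : Setting ℓ ε D κ 𝒞) {C : Set T} (hC : C ∈ 𝒞) :
    ε * ε / 2 * D ≤ cost ℓ (region ℓ ε D C) := by
  rw [← setLoad_eq S.nonneg fun e he => S.kind hC he]
  exact S.clust.load_ge C hC

lemma cost_region_le (S : Setting ℓ ε D κ 𝒞) {C : Set T} (hC : C ∈ 𝒞) :
    cost ℓ (region ℓ ε D C) ≤ κ * (ε / 2 * D) := by
  rw [← setLoad_eq S.nonneg fun e he => S.kind hC he]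
  exact S.clust.load_le C hC

lemma cost_small_le (S : Setting ℓ ε D κ 𝒞) {W : Set T} (hW : IsSmallCluster ℓ ε ε D W) :
    cost ℓ (region ℓ ε D W) ≤ ε * ε / 2 * D := by
  rw [← setLoad_eq S.nonneg fun e he => small_kind hW he]
  exact hW.2.le

lemma le_cost_leafCluster {w : T} (hw : IsLeafCluster ℓ ε D w) :
    ε / 2 * D ≤ cost ℓ (Set.Ici w) := by
  rw [← hw.1.condLoad_eq]
  exact hw.2

/-- Some tour visits a leaf cluster below `C`, so it passes `C`. -/
lemma exists_passes (S : Setting ℓ ε D κ 𝒞) {k : ℕ} {H : Fin k → Set T}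
    (hlow : ∀ i, IsLowerSet (H i)) (hcov : ∀ v, ∃ i, v ∈ H i) {C : Set T} (hC : C ∈ 𝒞) :
    ∃ i, Passes ℓ ε D (H i) C := by
  obtain ⟨w, -, hw⟩ := S.exists_leafCluster_below hC
  obtain ⟨i, hi⟩ := hcov w
  exact ⟨i, fun c hc => hlow i (hw c hc).le hi⟩

section Split

variable {k : ℕ} {H : Fin k → Set T} {C Q₀ Q₁ : Set T} {lam : ℝ}

lemma cost_up_smallLeaves (hp : IsPrefix ℓ ε D C Q₁) :
    cost ℓ (up (smallLeaves ℓ ε D C)) =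
      cost ℓ (up Q₁) + cost ℓ (up (smallLeaves ℓ ε D C \ Q₁)) :=
  cost_up_add _ _ hp.1 fun _ ht => ht.2.1

lemma cost_up_prefix (h : IsSplit ℓ ε D H C Q₀ Q₁ lam) :
    cost ℓ (up Q₁) = cost ℓ (up Q₀) + cost ℓ (up (Q₁ \ Q₀)) :=
  cost_up_add _ _ h.subset fun _ ht => (h.prefix₁.1 ht).2.1

lemma ending_le_region (S : Setting ℓ ε D κ 𝒞) (hC : C ∈ 𝒞) (h : IsSplit ℓ ε D H C Q₀ Q₁ lam) :
    cost ℓ (up Q₀) + lam + cost ℓ (stem ℓ ε D C Q₁) ≤ cost ℓ (region ℓ ε D C) := by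
  have h1 := cost_up_smallLeaves h.prefix₁
  have h2 := cost_up_prefix h
  have h3 := S.cost_region hC
  have h4 := h.lam_le
  have h5 := cost_nonneg S.nonneg (up (smallLeaves ℓ ε D C \ Q₁))
  have h6 : cost ℓ (stem ℓ ε D C Q₁) ≤ cost ℓ (bones ℓ ε D C) :=
    cost_mono S.nonneg fun v hv => hv.1
  linarith

lemma passing_le_region (S : Setting ℓ ε D κ 𝒞) (hC : C ∈ 𝒞) (h : IsSplit ℓ ε D H C Q₀ Q₁ lam) :
    cost ℓ (up (smallLeaves ℓ ε D C \ Q₁)) + (cost ℓ (up (Q₁ \ Q₀)) - lam) ≤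
      cost ℓ (region ℓ ε D C) := by
  have h1 := cost_up_smallLeaves h.prefix₁
  have h2 := cost_up_prefix h
  have h3 := S.cost_region hC
  have h4 := h.lam_nonneg
  have h5 := cost_nonneg S.nonneg (up Q₀)
  have h6 := cost_nonneg S.nonneg (bones ℓ ε D C)
  linarith

end Split

variable {k : ℕ} {H : Fin k → Set T}

/-- Leaf clusters and the two parts of the edge clusters are assigned to single tours. -/
lemma exists_cluster_tours (S : Setting ℓ ε D κ 𝒞) (hκ : 1 ≤ κ)
    (hlow : ∀ i, IsLowerSet (H i)) (hcov : ∀ v, ∃ i, v ∈ H i)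
    (Q₀ Q₁ : {C : Set T // C ∈ 𝒞} → Set T) (lam : {C : Set T // C ∈ 𝒞} → ℝ)
    (hsp : ∀ C, IsSplit ℓ ε D H C.1 (Q₀ C) (Q₁ C) (lam C)) :
    ∃ (lf : {w : T // IsLeafCluster ℓ ε D w} → Fin k) (en pa : {C : Set T // C ∈ 𝒞} → Fin k),
      (∀ w, w.1 ∈ H (lf w)) ∧
      (∀ C, (Q₁ C).Nonempty → EndsIn ℓ ε D (H (en C)) C.1) ∧
      (∀ C, Passes ℓ ε D (H (pa C)) C.1) ∧
      ∀ i, (∑ w, if lf w = i then cost ℓ (Set.Ici w.1) else 0) +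
          ((∑ C, if en C = i then
            cost ℓ (up (Q₀ C)) + lam C + cost ℓ (stem ℓ ε D C.1 (Q₁ C)) else 0) +
          (∑ C, if pa C = i then cost ℓ (up (smallLeaves ℓ ε D C.1 \ Q₁ C)) +
            (cost ℓ (up (Q₁ C \ Q₀ C)) - lam C) else 0)) ≤
        (∑ w : {w : T // IsLeafCluster ℓ ε D w}, cost ℓ (H i ∩ Set.Ici w.1)) +
          ((∑ C : {C : Set T // C ∈ 𝒞},
            if EndsIn ℓ ε D (H i) C.1 then cost ℓ (H i ∩ region ℓ ε D C.1) else 0) +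
          (∑ C : {C : Set T // C ∈ 𝒞}, if Passes ℓ ε D (H i) C.1 then
            cost ℓ (H i ∩ up (smallLeaves ℓ ε D C.1)) else 0)) + κ * ε * D := by
  have hℓ := S.nonneg
  have hεD : 0 < ε * D := mul_pos S.eps_pos S.D_pos
  have hP : 0 ≤ κ * ε * D := by
    rw [mul_assoc]
    positivity
  have hPε : ε * D ≤ κ * ε * D := by
    rw [mul_assoc]
    exact le_mul_of_one_le_left hεD.le hκ
  have hPr : κ * (ε / 2 * D) ≤ κ * ε * D := by linarith
  obtain ⟨i₀, -⟩ := hcov ⊥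
  have R := exists_rounding (M := Fin k) hP
    (Sum.elim (fun w : {w : T // IsLeafCluster ℓ ε D w} => cost ℓ (Set.Ici w.1))
      (Sum.elim (fun C => cost ℓ (up (Q₀ C)) + lam C + cost ℓ (stem ℓ ε D C.1 (Q₁ C)))
        (fun C => cost ℓ (up (smallLeaves ℓ ε D C.1 \ Q₁ C)) +
            (cost ℓ (up (Q₁ C \ Q₀ C)) - lam C))))
    (Sum.elim (fun w i => cost ℓ (H i ∩ Set.Ici w.1))
      (Sum.elim
        (fun C i => if EndsIn ℓ ε D (H i) C.1 then cost ℓ (H i ∩ region ℓ ε D C.1) else 0)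
        (fun C i => if Passes ℓ ε D (H i) C.1 then
            cost ℓ (H i ∩ up (smallLeaves ℓ ε D C.1)) else 0)))
    (Sum.elim (fun w => {i | w.1 ∈ H i})
      (Sum.elim (fun C => {i | (Q₁ C).Nonempty → EndsIn ℓ ε D (H i) C.1})
        (fun C => {i | Passes ℓ ε D (H i) C.1})))
  refine (R ?_ ?_ ?_ ?_ ?_ ?_).elim ?_
  · rintro (w | C | C)
    · exact cost_nonneg hℓ _
    · exact add_nonneg (add_nonneg (cost_nonneg hℓ _) (hsp C).lam_nonneg) (cost_nonneg hℓ _)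
    · exact add_nonneg (cost_nonneg hℓ _) (sub_nonneg.2 (hsp C).lam_le)
  · rintro (w | C | C) i
    · exact cost_nonneg hℓ _
    · simp only [Sum.elim_inl, Sum.elim_inr]
      split_ifs
      exacts [cost_nonneg hℓ _, le_rfl]
    · simp only [Sum.elim_inr]
      split_ifs
      exacts [cost_nonneg hℓ _, le_rfl]
  · rintro (w | C | C)
    · exact hcov w.1
    · by_cases hQ : (Q₁ C).Nonempty
      · obtain ⟨i, hi⟩ := (hsp C).exists_ending hQ
        exact ⟨i, fun _ => hi⟩
      · exact ⟨i₀, fun h => absurd h hQ⟩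
    · exact S.exists_passes hlow hcov C.2
  · rintro (w | C | C) i hi
    · simp only [Sum.elim_inl, Set.mem_ofPred_eq] at hi ⊢
      by_contra hw
      have : H i ∩ Set.Ici w.1 = ∅ := by
        rw [Set.eq_empty_iff_forall_notMem]
        rintro v ⟨hv, hle⟩
        exact hw (hlow i hle hv)
      rw [this, cost_empty] at hi
      exact lt_irrefl _ hi
    · simp only [Sum.elim_inl, Sum.elim_inr] at hi
      split_ifs at hi with h
      exacts [fun _ => h, absurd hi (lt_irrefl _)]
    · simp only [Sum.elim_inr] at hi
      split_ifs at hi with h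
      exacts [h, absurd hi (lt_irrefl _)]
  · rintro (w | C | C)
    · refine cost_le_sum hℓ _ _ _ fun v hv => ?_
      obtain ⟨i, hi⟩ := hcov v
      exact ⟨i, Finset.mem_univ _, hi, hv⟩
    · simpa only [Sum.elim_inl, Sum.elim_inr, Set.indicator, Set.mem_ofPred_eq] using
        (hsp C).ending_le
    · simpa only [Sum.elim_inr, Set.indicator, Set.mem_ofPred_eq] using (hsp C).passing_le
  · rintro (w | C | C)
    · rcases w.2.1.cost_le_or_isMax with h | h
      · exact Or.inl (h.trans hPε)
      · right
        -- a leaf cluster that is a single long edge is visited entirely or not at all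
        obtain ⟨i, hi⟩ := hcov w.1
        refine ⟨i, cost_mono hℓ fun v hv => ⟨?_, hv⟩⟩
        rwa [← h.eq_of_le hv]
    · exact Or.inl (((S.ending_le_region C.2 (hsp C)).trans (S.cost_region_le C.2)).trans hPr)
    · exact Or.inl (((S.passing_le_region C.2 (hsp C)).trans (S.cost_region_le C.2)).trans hPr)
  · rintro f ⟨hfS, hf⟩
    refine ⟨fun w => f (Sum.inl w), fun C => f (Sum.inr (Sum.inl C)),
      fun C => f (Sum.inr (Sum.inr C)), fun w => hfS (Sum.inl w),
      fun C => hfS (Sum.inr (Sum.inl C)), fun C => hfS (Sum.inr (Sum.inr C)), fun i => ?_⟩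
    have := hf i
    simpa only [Fintype.sum_sum_type, Sum.elim_inl, Sum.elim_inr] using this

/-- The straddling leaf edges are assigned to one of the two tours of their edge cluster. -/
lemma exists_straddler_tours (S : Setting ℓ ε D κ 𝒞)
    (Q₀ Q₁ : {C : Set T // C ∈ 𝒞} → Set T) (lam : {C : Set T // C ∈ 𝒞} → ℝ)
    (hsp : ∀ C, IsSplit ℓ ε D H C.1 (Q₀ C) (Q₁ C) (lam C))
    (en pa : {C : Set T // C ∈ 𝒞} → Fin k) :
    ∃ st : {C : Set T // C ∈ 𝒞} → Fin k, (∀ C, st C = en C ∨ st C = pa C) ∧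
      ∀ i, (∑ C, if st C = i then cost ℓ (up (Q₁ C \ Q₀ C)) else 0) ≤
        (∑ C, ((if en C = i then lam C else 0) +
          (if pa C = i then cost ℓ (up (Q₁ C \ Q₀ C)) - lam C else 0))) + ε / 2 * D := by
  have hεD : 0 ≤ ε / 2 * D := by
    have := S.eps_pos
    have := S.D_pos
    positivity
  have R := exists_rounding (M := Fin k) hεD
    (fun C : {C : Set T // C ∈ 𝒞} => cost ℓ (up (Q₁ C \ Q₀ C)))
    (fun C i => (if en C = i then lam C else 0) +
          (if pa C = i then cost ℓ (up (Q₁ C \ Q₀ C)) - lam C else 0))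
    (fun C => {i | i = en C ∨ i = pa C})
  refine R (fun C => cost_nonneg S.nonneg _) ?_ (fun C => ⟨en C, Or.inl rfl⟩) ?_ ?_
    (fun C => Or.inl (hsp C).straddle_le)
  · intro C i
    have h1 := (hsp C).lam_nonneg
    have h2 := (hsp C).lam_le
    refine add_nonneg ?_ ?_ <;> split_ifs <;> linarith
  · intro C i hi
    by_contra hne
    simp only [Set.mem_ofPred_eq, not_or] at hne
    rw [if_neg (Ne.symm hne.1), if_neg (Ne.symm hne.2), add_zero] at hi
    exact lt_irrefl _ hi
  · intro C
    rw [Finset.sum_add_distrib, Finset.sum_ite_eq, Finset.sum_ite_eq]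
    simp

/-- The outcome of both roundings. Single coverage is achieved up to one cut in each edge cluster,
and the charges of no tour exceed its length by more than a multiple of `ε * D`. -/
lemma exists_rounded (S : Setting ℓ ε D κ 𝒞) (hκ : 1 ≤ κ)
    (hlow : ∀ i, IsLowerSet (H i)) (hcov : ∀ v, ∃ i, v ∈ H i) (hcost : ∀ i, cost ℓ (H i) ≤ D) :
    ∃ (lf : T → Fin k) (en pa : Set T → Fin k) (Q : Set T → Set T),
      (∀ w, IsLeafCluster ℓ ε D w → w ∈ H (lf w)) ∧
      (∀ C ∈ 𝒞, IsPrefix ℓ ε D C (Q C)) ∧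
      (∀ C ∈ 𝒞, (Q C).Nonempty → EndsIn ℓ ε D (H (en C)) C ∧
        ∃ v ∈ bones ℓ ε D C, ∀ t ∈ Q C, ¬ v ≤ foot ℓ ε D t) ∧
      (∀ C ∈ 𝒞, Passes ℓ ε D (H (pa C)) C) ∧
      ∀ i, (∑ w : {w : T // IsLeafCluster ℓ ε D w},
            if lf w.1 = i then cost ℓ (Set.Ici w.1) else 0) +
          (∑ W : {W : Set T // IsSmallCluster ℓ ε ε D W}, cost ℓ (H i ∩ region ℓ ε D W.1)) +
          (∑ C : {C : Set T // C ∈ 𝒞}, clusterCharge ℓ ε D H C.1 (Q C.1) (en C.1) (pa C.1) i) ≤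
        (1 + (κ + 1 / 2) * ε) * D := by
  have hℓ := S.nonneg
  have := fun C : {C : Set T // C ∈ 𝒞} => S.exists_isSplit hlow hcov C.2
  choose Q₀ Q₁ lam hsp using this
  obtain ⟨lf, en, pa, hlf, hen, hpa, h1⟩ := S.exists_cluster_tours hκ hlow hcov Q₀ Q₁ lam hsp
  obtain ⟨st, hst, h2⟩ := S.exists_straddler_tours Q₀ Q₁ lam hsp en pa
  obtain ⟨i₀, -⟩ := hcov ⊥
  let Q : {C : Set T // C ∈ 𝒞} → Set T := fun C => if st C = en C then Q₁ C else Q₀ C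
  have hQ₁ : ∀ C, Q C ⊆ Q₁ C := by
    intro C
    simp only [Q]
    split_ifs
    exacts [subset_rfl, (hsp C).subset]
  have : Nonempty (Fin k) := ⟨i₀⟩
  obtain ⟨lf', hlf'⟩ := exists_extension lf
  obtain ⟨en', hen'⟩ := exists_extension en
  obtain ⟨pa', hpa'⟩ := exists_extension pa
  obtain ⟨Q', hQ'⟩ := exists_extension Q
  refine ⟨lf', en', pa', Q', fun w hw => ?_, fun C hC => ?_, fun C hC hne => ?_, fun C hC => ?_,
    fun i => ?_⟩
  · rw [hlf' ⟨w, hw⟩]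
    exact hlf ⟨w, hw⟩
  · rw [hQ' ⟨C, hC⟩]
    simp only [Q]
    split_ifs
    exacts [(hsp ⟨C, hC⟩).prefix₁, (hsp ⟨C, hC⟩).prefix₀]
  · rw [hQ' ⟨C, hC⟩] at hne ⊢
    have hne₁ := hne.mono (hQ₁ ⟨C, hC⟩)
    rw [hen' ⟨C, hC⟩]
    obtain ⟨v, hv, h⟩ := (hsp ⟨C, hC⟩).exists_bone hne₁
    exact ⟨hen _ hne₁, v, hv, fun t ht => h t (hQ₁ _ ht)⟩
  · rw [hpa' ⟨C, hC⟩]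
    exact hpa ⟨C, hC⟩
  simp only [hlf', hen', hpa', hQ']
  -- the charge of the straddling leaf edge is replaced by its rounded value
  have hcharge : ∀ C, clusterCharge ℓ ε D H C.1 (Q C) (en C) (pa C) i ≤
      (if Passes ℓ ε D (H i) C.1 then cost ℓ (bones ℓ ε D C.1) else 0) +
      ((if en C = i then cost ℓ (up (Q₀ C)) + lam C + cost ℓ (stem ℓ ε D C.1 (Q₁ C)) else 0) +
      (if pa C = i then cost ℓ (up (smallLeaves ℓ ε D C.1 \ Q₁ C)) +
            (cost ℓ (up (Q₁ C \ Q₀ C)) - lam C) else 0)) +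
      ((if st C = i then cost ℓ (up (Q₁ C \ Q₀ C)) else 0) -
      ((if en C = i then lam C else 0) +
          (if pa C = i then cost ℓ (up (Q₁ C \ Q₀ C)) - lam C else 0))) := by
    intro C
    have e1 := cost_up_smallLeaves (hsp C).prefix₁
    have e2 := cost_up_prefix (hsp C)
    have e3 := cost_up_smallLeaves (hsp C).prefix₀
    have e4 : cost ℓ (stem ℓ ε D C.1 (Q₀ C)) ≤ cost ℓ (stem ℓ ε D C.1 (Q₁ C)) :=
      cost_mono hℓ fun v hv => ⟨hv.1, hv.2.imp fun t ht => ⟨(hsp C).subset ht.1, ht.2⟩⟩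
    have e5 := cost_nonneg hℓ (up (Q₁ C \ Q₀ C))
    by_cases hse : st C = en C
    · have hQC : Q C = Q₁ C := if_pos hse
      rw [clusterCharge, hQC, hse]
      by_cases ha : en C = i <;> by_cases hb : pa C = i <;> simp only [ha, hb, if_true, if_false] <;>
        linarith
    · have hsp' := (hst C).resolve_left hse
      have hQC : Q C = Q₀ C := if_neg hse
      rw [clusterCharge, hQC, hsp']
      by_cases ha : en C = i <;> by_cases hb : pa C = i <;> simp only [ha, hb, if_true, if_false] <;>
        linarith
  have hpart : ∀ C : {C : Set T // C ∈ 𝒞},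
      (if Passes ℓ ε D (H i) C.1 then cost ℓ (bones ℓ ε D C.1) else 0) +
      ((if EndsIn ℓ ε D (H i) C.1 then cost ℓ (H i ∩ region ℓ ε D C.1) else 0) +
      (if Passes ℓ ε D (H i) C.1 then cost ℓ (H i ∩ up (smallLeaves ℓ ε D C.1)) else 0)) ≤
      cost ℓ (H i ∩ region ℓ ε D C.1) := by
    intro C
    by_cases hp : Passes ℓ ε D (H i) C.1
    · have hne : ¬ EndsIn ℓ ε D (H i) C.1 := fun h => h.1 hp
      simp only [hp, hne, if_true, if_false, zero_add]
      have hbd := bones_disjoint_up (ℓ := ℓ) (δ := ε) (D := D) (K := C.1)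
        (Q := smallLeaves ℓ ε D C.1) fun t ht => ht.2.1
      rw [region_eq fun e he => S.kind C.2 he, ← cost_union (hbd.mono_right Set.inter_subset_right)]
      refine cost_mono hℓ ?_
      rintro v (hv | hv)
      · refine ⟨?_, Or.inl hv⟩
        have := hp v hv.1
        rwa [hv.2.2.foot_eq] at this
      · exact ⟨hv.1, Or.inr hv.2⟩
    · simp only [hp, if_false, zero_add, add_zero]
      split_ifs
      exacts [le_rfl, cost_nonneg hℓ _]
  have s1 := Finset.sum_le_sum fun C (_ : C ∈ Finset.univ) => hcharge C
  have s2 := Finset.sum_le_sum fun C (_ : C ∈ Finset.univ) => hpart C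
  simp only [Finset.sum_add_distrib, Finset.sum_sub_distrib] at s1 s2
  have h1i := h1 i
  have h2i := h2 i
  simp only [Finset.sum_add_distrib] at h2i
  have hci := hcost i
  rw [S.cost_eq_sum] at hci
  linarith

/-- If one of the two parts of an edge cluster has small charge, then it is given to the tour of the
other part. This increases charges at most by a factor `1 + ε`, and afterwards every tour that gets a
part of the cluster has been charged at least `ε ^ 3 / 4 * D` for it. -/
lemma exists_thresholded (S : Setting ℓ ε D κ 𝒞) {C Q : Set T} (hC : C ∈ 𝒞) {e p : Fin k}
    (hpre : IsPrefix ℓ ε D C Q) (hend : Q.Nonempty → EndsIn ℓ ε D (H e) C)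
    (hpass : Passes ℓ ε D (H p) C) :
    ∃ Q', IsPrefix ℓ ε D C Q' ∧ (Q'.Nonempty → EndsIn ℓ ε D (H e) C) ∧
      (Q' = Q ∨ Q' = ∅ ∨ Q' = smallLeaves ℓ ε D C) ∧
      (∀ i, clusterCharge ℓ ε D H C Q' e p i ≤ (1 + ε) * clusterCharge ℓ ε D H C Q e p i) ∧
      ∀ i, e = i ∧ Q'.Nonempty ∨ p = i ∧ (smallLeaves ℓ ε D C \ Q').Nonempty →
        ε ^ 3 / 4 * D ≤ clusterCharge ℓ ε D H C Q e p i := by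
  have hℓ := S.nonneg
  have hε := S.eps_pos
  have hε1 := S.eps_le
  have hD := S.D_pos
  set Λ := smallLeaves ℓ ε D C with hΛ
  set b := cost ℓ (bones ℓ ε D C) with hb
  set x := cost ℓ (up Q) with hx
  set y := cost ℓ (up (Λ \ Q)) with hy
  set s := cost ℓ (stem ℓ ε D C Q) with hs
  have hb0 : 0 ≤ b := cost_nonneg hℓ _
  have hx0 : 0 ≤ x := cost_nonneg hℓ _
  have hy0 : 0 ≤ y := cost_nonneg hℓ _
  have hs0 : 0 ≤ s := cost_nonneg hℓ _
  have hload : ε * ε / 2 * D ≤ b + (x + y) := by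
    have := S.le_cost_region hC
    rwa [S.cost_region hC, cost_up_smallLeaves hpre] at this
  have hthr : ε ^ 3 / 4 * D ≤ ε / 2 * (b + (x + y)) := by
    have := mul_le_mul_of_nonneg_left hload (by positivity : 0 ≤ ε / 2)
    calc ε ^ 3 / 4 * D = ε / 2 * (ε * ε / 2 * D) := by ring
      _ ≤ _ := this
  have hthr' : ε / 2 * (b + (x + y)) ≤ 1 / 2 * (b + (x + y)) := by gcongr
  -- moving a part of charge at most the threshold to the other tour
  have hmove : ∀ a c : ℝ, a < ε ^ 3 / 4 * D → b + (x + y) ≤ a + c →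
      b + (x + y) ≤ (1 + ε) * c ∧ ε ^ 3 / 4 * D ≤ c := by
    intro a c ha hac
    have h1 : (1 - ε / 2) * (b + (x + y)) ≤ c := by linarith
    have h2 := mul_le_mul_of_nonneg_left h1 (by linarith : 0 ≤ 1 + ε)
    have h3 : 0 ≤ ε * (1 - ε) / 2 * (b + (x + y)) := by
      have : 0 ≤ 1 - ε := by linarith
      positivity
    constructor
    · linarith
    · linarith
  have hm : ∀ i, clusterCharge ℓ ε D H C Q e p i =
      (if Passes ℓ ε D (H i) C then b else 0) + (if e = i then x + s else 0) +
        (if p = i then y else 0) := fun i => rfl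
  have hm0 : ∀ i, 0 ≤ clusterCharge ℓ ε D H C Q e p i := by
    intro i
    rw [hm]
    refine add_nonneg (add_nonneg ?_ ?_) ?_ <;> split_ifs <;> linarith
  have hself : ∀ i, clusterCharge ℓ ε D H C Q e p i ≤
      (1 + ε) * clusterCharge ℓ ε D H C Q e p i := fun i =>
    le_mul_of_one_le_left (hm0 i) (by linarith)
  have hmp : b + y ≤ clusterCharge ℓ ε D H C Q e p p := by
    rw [hm, if_pos hpass, if_pos rfl]
    split_ifs <;> linarith
  have hme : x + s ≤ clusterCharge ℓ ε D H C Q e p e := by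
    rw [hm, if_pos rfl]
    split_ifs <;> linarith
  have hpass_le : ∀ i, (if Passes ℓ ε D (H i) C then b else 0) ≤
      (1 + ε) * clusterCharge ℓ ε D H C Q e p i := by
    intro i
    refine le_trans ?_ (hself i)
    rw [hm]
    have h1 : 0 ≤ if e = i then x + s else 0 := by split_ifs <;> linarith
    have h2 : 0 ≤ if p = i then y else 0 := by split_ifs <;> linarith
    linarith
  by_cases hQ : Q = ∅
  · refine ⟨Q, hpre, hend, Or.inl rfl, hself, ?_⟩
    rintro i (⟨-, h⟩ | ⟨rfl, -⟩)
    · exact absurd hQ h.ne_empty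
    · have : x = 0 := by rw [hx, hQ, up_empty, cost_empty]
      linarith
  have hQ := Set.nonempty_iff_ne_empty.2 hQ
  by_cases ha : x + s < ε ^ 3 / 4 * D
  · obtain ⟨hc1, hc2⟩ := hmove _ (b + y) ha (by linarith)
    refine ⟨∅, ⟨by simp, by simp⟩, by simp, Or.inr (Or.inl rfl), fun i => ?_, ?_⟩
    · have hst : stem ℓ ε D C ∅ = ∅ := by simp [stem]
      have hΛx : cost ℓ (up Λ) = x + y := cost_up_smallLeaves hpre
      rw [clusterCharge, hst]
      simp only [up_empty, cost_empty, add_zero, Set.sdiff_empty, ite_self]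
      rw [← hΛ, hΛx, ← hb]
      by_cases hp : p = i
      · subst hp
        rw [if_pos hpass, if_pos rfl]
        exact hc1.trans (mul_le_mul_of_nonneg_left hmp (by linarith))
      · rw [if_neg hp, add_zero]
        exact hpass_le i
    · rintro i (⟨-, h⟩ | ⟨rfl, -⟩)
      · simp at h
      · exact hc2.trans hmp
  push Not at ha
  by_cases hc : b + y < ε ^ 3 / 4 * D
  · obtain ⟨hc1, hc2⟩ := hmove _ (x + s) hc (by linarith)
    refine ⟨Λ, ⟨subset_rfl, fun _ _ t ht _ => ht⟩, fun _ => hend hQ, Or.inr (Or.inr rfl),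
      fun i => ?_, ?_⟩
    · have hst : cost ℓ (stem ℓ ε D C Λ) ≤ b := cost_mono hℓ fun v hv => hv.1
      have hΛx : cost ℓ (up Λ) = x + y := cost_up_smallLeaves hpre
      rw [clusterCharge, ← hΛ, hΛx, ← hb]
      simp only [Set.sdiff_self, up_empty, cost_empty, ite_self, add_zero]
      by_cases he : e = i
      · subst he
        rw [if_neg (hend hQ).1, if_pos rfl]
        have := mul_le_mul_of_nonneg_left hme (by linarith : 0 ≤ 1 + ε)
        linarith
      · rw [if_neg he, add_zero]
        exact hpass_le i
    · rintro i (⟨rfl, -⟩ | ⟨-, h⟩)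
      · exact ha.trans hme
      · simp at h
  · push Not at hc
    refine ⟨Q, hpre, hend, Or.inl rfl, hself, ?_⟩
    rintro i (⟨rfl, -⟩ | ⟨rfl, -⟩)
    exacts [ha.trans hme, hc.trans hmp]

end Setting
end Makespan

/-! ### The new solution -/

namespace Makespan

lemma ncard_mul_le_sum {α : Type*} {P : α → Prop} [Fintype {x // P x}] (F : {x // P x} → ℝ)
    (hF : ∀ x, 0 ≤ F x) {A : Set α} {c : ℝ} (hA : ∀ x ∈ A, ∃ hx : P x, c ≤ F ⟨x, hx⟩) :
    A.ncard * c ≤ ∑ x, F x := by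
  classical
  have h1 : A =
      ((Finset.univ.filter fun x : {x // P x} => x.1 ∈ A).image Subtype.val : Finset α) := by
    ext x
    simp only [Finset.coe_image, Finset.coe_filter, Finset.mem_univ, true_and, Set.mem_image,
      Set.mem_ofPred_eq]
    constructor
    · intro hx
      exact ⟨⟨x, (hA x hx).1⟩, hx, rfl⟩
    · rintro ⟨y, hy, rfl⟩
      exact hy
  have h2 : A.ncard = (Finset.univ.filter fun x : {x // P x} => x.1 ∈ A).card := by
    conv_lhs => rw [h1]
    rw [Set.ncard_coe_finset, Finset.card_image_of_injective _ Subtype.val_injective]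
  rw [h2, ← nsmul_eq_mul]
  refine (Finset.card_nsmul_le_sum _ F c fun x hx => ?_).trans
    (Finset.sum_le_sum_of_subset_of_nonneg (Finset.subset_univ _) fun x _ _ => hF x)
  simp only [Finset.mem_filter, Finset.mem_univ, true_and] at hx
  exact (hA _ hx).2

lemma sum_ite_le_ncard_mul {α : Type*} [Finite α] {P : α → Prop} [Fintype {x // P x}]
    (R : α → Prop) [DecidablePred R] {F : {x // P x} → ℝ} {c : ℝ} (hF : ∀ x, F x ≤ c)
    (hc : 0 ≤ c) :
    (∑ x, if R x.1 then F x else 0) ≤ {x | P x ∧ R x}.ncard * c := by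
  classical
  rw [← Finset.sum_filter]
  refine (Finset.sum_le_card_nsmul _ F c fun x _ => hF x).trans ?_
  rw [nsmul_eq_mul]
  gcongr
  rw [← Finset.card_image_of_injective _ Subtype.val_injective, ← Set.ncard_coe_finset]
  refine Set.ncard_le_ncard ?_ (Set.toFinite _)
  intro x hx
  simp only [Finset.coe_image, Finset.coe_filter, Finset.mem_univ, true_and, Set.mem_image,
    Set.mem_ofPred_eq] at hx
  obtain ⟨y, hy, rfl⟩ := hx
  exact ⟨y.2, hy⟩

variable {T : RootedTree.{u}} [Fintype T]

open scoped Classical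

variable {ℓ : Sym2 T → ℝ} {ε D κ : ℝ} {𝒞 : Set (Set T)}

namespace Setting

variable {k : ℕ} {H : Fin k → Set T}

lemma ncard_small_le {lf : T → Fin k} {lam : Set T → T}
    (hlam : ∀ W, IsWoollyEdge ℓ ε D W → IsLeafCluster ℓ ε D (lam W))
    (hfib : ∀ w, {W | IsWoollyEdge ℓ ε D W ∧ lam W = w}.ncard ≤ 2) (i : Fin k) :
    {W | IsSmallCluster ℓ ε ε D W ∧ lf (lam W) = i}.ncard ≤
      2 * {w | IsLeafCluster ℓ ε D w ∧ lf w = i}.ncard := by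
  rw [Set.ncard_eq_toFinset_card', Set.ncard_eq_toFinset_card']
  refine Finset.card_le_mul_card_image_of_maps_to (f := lam) ?_ 2 ?_
  · intro W hW
    simp only [Set.mem_toFinset, Set.mem_ofPred_eq] at hW ⊢
    exact ⟨hlam W hW.1.1, hW.2⟩
  · intro w _
    rw [← Set.ncard_coe_finset]
    refine le_trans (Set.ncard_le_ncard ?_ (Set.toFinite _)) (hfib w)
    intro W hW
    simp only [Finset.coe_filter, Set.mem_toFinset, Set.mem_ofPred_eq] at hW
    exact ⟨hW.1.1.1, hW.2⟩

/-- A function assigning every leaf edge as prescribed for its cluster. -/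
lemma exists_isAssignment (S : Setting ℓ ε D κ 𝒞)
    {lf : T → Fin k} {lam : Set T → T} {Q : Set T → Set T} {en pa : Set T → Fin k}
    (hlf : ∀ w, IsLeafCluster ℓ ε D w → w ∈ H (lf w))
    (hlam : ∀ W, IsWoollyEdge ℓ ε D W → IsLeafCluster ℓ ε D (lam W) ∧
      ∀ v ∈ W, foot ℓ ε D v < lam W)
    (hpre : ∀ C ∈ 𝒞, IsPrefix ℓ ε D C (Q C))
    (hen : ∀ C ∈ 𝒞, (Q C).Nonempty → EndsIn ℓ ε D (H (en C)) C)
    (hpa : ∀ C ∈ 𝒞, Passes ℓ ε D (H (pa C)) C) :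
    ∃ g : T → Fin k, (∀ w, IsLeafCluster ℓ ε D w → g w = lf w) ∧
      IsAssignment ℓ ε D 𝒞 H g lam Q en pa := by
  have : ∀ t, ∃ j : Fin k, (IsLeafCluster ℓ ε D t → j = lf t) ∧
      (∀ W, IsSmallCluster ℓ ε ε D W → t ∈ smallLeaves ℓ ε D W → j = lf (lam W)) ∧
      ∀ C ∈ 𝒞, t ∈ smallLeaves ℓ ε D C → (t ∈ Q C → j = en C) ∧ (t ∉ Q C → j = pa C) := by
    intro t
    by_cases ht : IsSmallLeaf ℓ ε D t
    · rcases S.exists_cluster (Or.inr ht) with ⟨W, hW, htW⟩ | ⟨C, hC, htC⟩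
      · refine ⟨lf (lam W), fun h => absurd h ht.not_isLeafCluster, fun W' hW' h => ?_,
          fun C hC h => absurd htW (S.notMem_of_small hC hW h.1)⟩
        rw [hW.1.eq_of_mem hW'.1 htW h.1]
      · refine ⟨if t ∈ Q C then en C else pa C, fun h => absurd h ht.not_isLeafCluster,
          fun W' hW' h => absurd h.1 (S.notMem_of_small hC hW' htC), fun C' hC' h => ?_⟩
        rw [S.eq_of_mem hC hC' htC h.1]
        exact ⟨fun h => if_pos h, fun h => if_neg h⟩
    · exact ⟨lf t, fun _ => rfl, fun _ _ h => absurd h.2 ht, fun _ _ h => absurd h.2 ht⟩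
  choose g hg using this
  have hgl : ∀ w, IsLeafCluster ℓ ε D w → g w = lf w := fun w => (hg w).1
  refine ⟨g, hgl, fun w hw => ?_, fun W hW => (hlam W hW.1).1, fun W hW => (hlam W hW.1).2,
    fun W hW t ht => ?_, hpre, fun C hC t ht => ?_, fun C hC t ht => ?_,
    fun C hC hQ => (hen C hC hQ).2, hpa⟩
  · rw [hgl w hw]
    exact hlf w hw
  · rw [(hg t).2.1 W hW ht, hgl _ (hlam W hW.1).1]
  · exact ((hg t).2.2 C hC ((hpre C hC).1 ht)).1 ht
  · exact ((hg t).2.2 C hC ht).2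

lemma cost_newVisited_le (S : Setting ℓ ε D κ 𝒞) (hlow : ∀ i, IsLowerSet (H i))
    {g : T → Fin k} {lam : Set T → T} {Q : Set T → Set T} {en pa : Set T → Fin k}
    (A : IsAssignment ℓ ε D 𝒞 H g lam Q en pa) (i : Fin k) :
    cost ℓ (newVisited ℓ ε D 𝒞 H g i) ≤
      (∑ w : {w : T // IsLeafCluster ℓ ε D w}, if g w.1 = i then cost ℓ (Set.Ici w.1) else 0) +
      ((∑ W : {W : Set T // IsSmallCluster ℓ ε ε D W}, cost ℓ (H i ∩ region ℓ ε D W.1)) +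
        (∑ W : {W : Set T // IsSmallCluster ℓ ε ε D W},
          if g (lam W.1) = i then cost ℓ (region ℓ ε D W.1) else 0) +
        ∑ C : {C : Set T // C ∈ 𝒞}, clusterCharge ℓ ε D H C.1 (Q C.1) (en C.1) (pa C.1) i) := by
  have hℓ := S.nonneg
  have hsep : ∀ (p : Prop) [Decidable p] (B : Set T),
      cost ℓ {v | p ∧ v ∈ B} = if p then cost ℓ B else 0 := by
    intro p _ B
    by_cases hp : p <;> simp [hp]
  rw [S.cost_eq_sum, ← Finset.sum_add_distrib]
  refine add_le_add (Finset.sum_le_sum fun w _ => ?_)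
    (add_le_add (Finset.sum_le_sum fun W _ => ?_) (Finset.sum_le_sum fun C _ => ?_))
  · rw [← hsep]
    exact cost_mono hℓ (IsAssignment.inter_leafCluster_subset i w.2)
  · rw [← hsep]
    exact (cost_mono hℓ (A.inter_small_subset S hlow i W.2)).trans (cost_union_le hℓ _ _)
  · refine (cost_mono hℓ (A.inter_edge_subset S hlow i C.2)).trans ?_
    refine (cost_union_le hℓ _ _).trans ?_
    rw [clusterCharge, add_assoc]
    refine add_le_add (hsep _ _).le ((cost_union_le hℓ _ _).trans (add_le_add ?_ (hsep _ _).le))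
    rw [hsep]
    split_ifs
    exacts [cost_union_le hℓ _ _, le_rfl]

/-- A family of lower sets that covers the tree is rearranged into one with simple structure. -/
lemma exists_simple (S : Setting ℓ ε D κ 𝒞) (hκ : 1 ≤ κ) (hlow : ∀ i, IsLowerSet (H i))
    (hcov : ∀ v, ∃ i, v ∈ H i) (hcost : ∀ i, cost ℓ (H i) ≤ D) :
    ∃ τ : Fin k → Tour T, Feasible τ ∧ MakespanLE ℓ τ ((1 + (4 * κ + 5) * ε) * D) ∧
      HasSimpleStructure ℓ ε ε D 𝒞 τ ((10 * κ + 15) / ε ^ 3) := by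
  have hℓ := S.nonneg
  have hε := S.eps_pos
  have hε1 := S.eps_le
  have hD := S.D_pos
  obtain ⟨lf, en, pa, Q, hlf, hpre, hen, hpa, hsum⟩ := S.exists_rounded hκ hlow hcov hcost
  have hth : ∀ C, ∃ Q', C ∈ 𝒞 → IsPrefix ℓ ε D C Q' ∧
      (Q'.Nonempty → EndsIn ℓ ε D (H (en C)) C) ∧
      (Q' = Q C ∨ Q' = ∅ ∨ Q' = smallLeaves ℓ ε D C) ∧
      (∀ i, clusterCharge ℓ ε D H C Q' (en C) (pa C) i ≤
        (1 + ε) * clusterCharge ℓ ε D H C (Q C) (en C) (pa C) i) ∧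
      ∀ i, en C = i ∧ Q'.Nonempty ∨ pa C = i ∧ (smallLeaves ℓ ε D C \ Q').Nonempty →
        ε ^ 3 / 4 * D ≤ clusterCharge ℓ ε D H C (Q C) (en C) (pa C) i := by
    intro C
    by_cases hC : C ∈ 𝒞
    · obtain ⟨Q', h⟩ := S.exists_thresholded hC (hpre C hC) (fun h => (hen C hC h).1) (hpa C hC)
      exact ⟨Q', fun _ => h⟩
    · exact ⟨∅, fun h => absurd h hC⟩
  choose Q' hQ' using hth
  obtain ⟨lam, hlam, hfib⟩ := exists_leafCluster_of_woollyEdge ℓ ε D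
  obtain ⟨g, hgl, A⟩ := S.exists_isAssignment hlf hlam (fun C hC => (hQ' C hC).1)
    (fun C hC => (hQ' C hC).2.1) hpa
  have htour := fun i => exists_tour ℓ (newVisited ℓ ε D 𝒞 H g i) (Or.inl rfl)
    (newVisited_lower S hlow i)
  choose τ hτ hlen using htour
  -- the quantities that bound the charges of a tour
  set X : Fin k → ℝ := fun i => ∑ w : {w : T // IsLeafCluster ℓ ε D w},
    if lf w.1 = i then cost ℓ (Set.Ici w.1) else 0 with hX
  set Y : Fin k → ℝ := fun i => ∑ W : {W : Set T // IsSmallCluster ℓ ε ε D W},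
    cost ℓ (H i ∩ region ℓ ε D W.1) with hY
  set Z : Fin k → ℝ := fun i => ∑ C : {C : Set T // C ∈ 𝒞},
    clusterCharge ℓ ε D H C.1 (Q C.1) (en C.1) (pa C.1) i with hZ
  have hchg : ∀ (C : Set T) i, 0 ≤ clusterCharge ℓ ε D H C (Q C) (en C) (pa C) i := by
    intro C i
    have h1 := cost_nonneg hℓ (bones ℓ ε D C)
    have h2 := cost_nonneg hℓ (up (Q C))
    have h3 := cost_nonneg hℓ (stem ℓ ε D C (Q C))
    have h4 := cost_nonneg hℓ (up (smallLeaves ℓ ε D C \ Q C))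
    refine add_nonneg (add_nonneg ?_ ?_) ?_ <;> split_ifs <;> linarith
  have hite : ∀ i (w : {w : T // IsLeafCluster ℓ ε D w}),
      0 ≤ if lf w.1 = i then cost ℓ (Set.Ici w.1) else 0 := by
    intro i w
    split_ifs
    exacts [cost_nonneg hℓ _, le_rfl]
  have hX0 : ∀ i, 0 ≤ X i := fun i => Finset.sum_nonneg fun w _ => hite i w
  have hY0 : ∀ i, 0 ≤ Y i := fun i => Finset.sum_nonneg fun W _ => cost_nonneg hℓ _
  have hZ0 : ∀ i, 0 ≤ Z i := fun i => Finset.sum_nonneg fun C _ => hchg C.1 i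
  have hB : ∀ i, X i + Y i + Z i ≤ (κ + 3 / 2) * D := by
    intro i
    refine (hsum i).trans (mul_le_mul_of_nonneg_right ?_ hD.le)
    have : (κ + 1 / 2) * ε ≤ (κ + 1 / 2) * 1 := by gcongr
    linarith
  -- the numbers of clusters in which a tour covers clients
  set NL : Fin k → ℕ := fun i => {w | IsLeafCluster ℓ ε D w ∧ lf w = i}.ncard with hNL
  set NS : Fin k → ℕ := fun i => {W | IsSmallCluster ℓ ε ε D W ∧ lf (lam W) = i}.ncard with hNS
  set E : Fin k → Set (Set T) := fun i => {C | C ∈ 𝒞 ∧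
    (en C = i ∧ (Q' C).Nonempty ∨ pa C = i ∧ (smallLeaves ℓ ε D C \ Q' C).Nonempty)} with hE
  have hL : ∀ i, (NL i : ℝ) * (ε / 2 * D) ≤ (κ + 3 / 2) * D := by
    intro i
    refine (ncard_mul_le_sum _ (hite i) ?_).trans (by linarith [hB i, hY0 i, hZ0 i] :
      X i ≤ (κ + 3 / 2) * D)
    rintro w ⟨hw, hwi⟩
    refine ⟨hw, ?_⟩
    rw [if_pos hwi]
    exact le_cost_leafCluster hw
  have hS : ∀ i, (NS i : ℝ) ≤ 2 * NL i := by
    intro i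
    exact_mod_cast ncard_small_le (fun W hW => (hlam W hW).1) hfib i
  have hEd : ∀ i, ((E i).ncard : ℝ) * (ε ^ 3 / 4 * D) ≤ (κ + 3 / 2) * D := by
    intro i
    refine (ncard_mul_le_sum (fun C : {C : Set T // C ∈ 𝒞} =>
      clusterCharge ℓ ε D H C.1 (Q C.1) (en C.1) (pa C.1) i) (fun C => hchg C.1 i) ?_).trans
      (by linarith [hB i, hX0 i, hY0 i] : Z i ≤ (κ + 3 / 2) * D)
    rintro C ⟨hC, h⟩
    exact ⟨hC, (hQ' C hC).2.2.2.2 i h⟩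
  refine ⟨τ, fun c hc => ?_, fun i => ?_, ⟨fun w hw => ?_, fun W hW => ?_, fun C hC => ?_,
    fun i => ?_⟩⟩
  · by_cases hne : c = ⊥
    · obtain ⟨i, -⟩ := hcov ⊥
      rw [hne]
      exact ⟨i, (τ i).start_mem_support⟩
    · obtain ⟨t, ht, hle⟩ := exists_leafEdge_le (δ := ε) (D := D) hℓ hc hne
      exact ⟨g t, (IsAssignment.mem_support_iff hτ ht hle _).2 rfl⟩
  · rw [hlen]
    refine (S.cost_newVisited_le hlow A i).trans ?_
    have h1 : (∑ w : {w : T // IsLeafCluster ℓ ε D w},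
        if g w.1 = i then cost ℓ (Set.Ici w.1) else 0) = X i :=
      Finset.sum_congr rfl fun w _ => by rw [hgl w.1 w.2]
    have h2 : (∑ W : {W : Set T // IsSmallCluster ℓ ε ε D W},
        if g (lam W.1) = i then cost ℓ (region ℓ ε D W.1) else 0) ≤ NS i * (ε * ε / 2 * D) := by
      have h3 : ∀ W : {W : Set T // IsSmallCluster ℓ ε ε D W}, g (lam W.1) = lf (lam W.1) :=
        fun W => hgl _ (hlam W.1 W.2.1).1
      simp only [h3]
      exact sum_ite_le_ncard_mul (fun W => lf (lam W) = i) (fun W => S.cost_small_le W.2)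
        (by positivity)
    have h4 : (∑ C : {C : Set T // C ∈ 𝒞},
        clusterCharge ℓ ε D H C.1 (Q' C.1) (en C.1) (pa C.1) i) ≤ (1 + ε) * Z i := by
      rw [hZ, Finset.mul_sum]
      exact Finset.sum_le_sum fun C _ => (hQ' C.1 C.2).2.2.2.1 i
    have h5 : (NS i : ℝ) * (ε * ε / 2 * D) ≤ 2 * ε * ((κ + 3 / 2) * D) := by
      calc (NS i : ℝ) * (ε * ε / 2 * D) ≤ 2 * NL i * (ε * ε / 2 * D) := by
            have := hS i
            gcongr
        _ = 2 * ε * (NL i * (ε / 2 * D)) := by ring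
        _ ≤ _ := by
            have := hL i
            gcongr
    have h6 : X i + Y i + Z i + ε * (X i + Y i + Z i) ≤
        (1 + (κ + 1 / 2) * ε) * D + ε * ((κ + 3 / 2) * D) := by
      have := hB i
      exact add_le_add (hsum i) (by gcongr)
    have h7 : 0 ≤ ε * (X i + Y i) := mul_nonneg hε.le (add_nonneg (hX0 i) (hY0 i))
    have h8 : 0 ≤ κ * ε * D := by positivity
    rw [h1]
    nlinarith
  · exact IsAssignment.singleCoverage hτ (g w) (by rintro t rfl -; rfl)
  · refine IsAssignment.singleCoverage hτ (g (lam W)) fun t ht htl => ?_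
    exact A.small W hW t
      ⟨ht, (small_kind hW ht).resolve_left fun h => h.2.not_isLeafEdge htl⟩
  · obtain ⟨-, hend, hcase, -, -⟩ := hQ' C hC
    have hsm : ∀ t ∈ C, IsLeafEdge ℓ ε D t → t ∈ smallLeaves ℓ ε D C := fun t ht htl =>
      ⟨ht, (S.kind hC ht).resolve_left fun h => h.2.not_isLeafEdge htl⟩
    by_cases h1 : (Q' C).Nonempty
    · by_cases h2 : (smallLeaves ℓ ε D C \ Q' C).Nonempty
      · right
        refine A.splitCoverage S hlow hτ hC h1 h2 (hend h1).1 ?_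
        rcases hcase with h | h | h
        · rw [h] at h1 ⊢
          exact (hen C hC h1).2
        · rw [h] at h1
          exact absurd h1 Set.not_nonempty_empty
        · rw [h, Set.sdiff_self] at h2
          exact absurd h2 Set.not_nonempty_empty
      · left
        refine IsAssignment.singleCoverage hτ (en C) fun t ht htl => A.mem C hC t ?_
        by_contra h
        exact h2 ⟨t, hsm t ht htl, h⟩
    · left
      exact IsAssignment.singleCoverage hτ (pa C) fun t ht htl =>
        A.notMem C hC t (hsm t ht htl) fun h => h1 ⟨t, h⟩
  · have hsub : {C ∈ clusters ℓ ε ε D 𝒞 | CoversSome ℓ ε D (τ i) C} ⊆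
        (fun w => ({w} : Set T)) '' {w | IsLeafCluster ℓ ε D w ∧ lf w = i} ∪
          ({W | IsSmallCluster ℓ ε ε D W ∧ lf (lam W) = i} ∪ E i) := by
      rintro C ⟨hC, hcs⟩
      obtain ⟨t, htC, ht, hgt⟩ := (IsAssignment.coversSome_iff hτ C i).1 hcs
      rcases hC with ⟨w, hw, rfl⟩ | hW | hC
      · left
        obtain rfl : t = w := htC
        exact ⟨t, ⟨hw, (hgl t hw).symm.trans hgt⟩, rfl⟩
      · refine Or.inr (Or.inl ⟨hW, ?_⟩)
        rw [← hgl _ (hlam C hW.1).1, ← A.small C hW t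
          ⟨htC, (small_kind hW htC).resolve_left fun h => h.2.not_isLeafEdge ht⟩, hgt]
      · have hts : t ∈ smallLeaves ℓ ε D C :=
          ⟨htC, (S.kind hC htC).resolve_left fun h => h.2.not_isLeafEdge ht⟩
        refine Or.inr (Or.inr ⟨hC, ?_⟩)
        by_cases htQ : t ∈ Q' C
        · exact Or.inl ⟨(A.mem C hC t htQ).symm.trans hgt, t, htQ⟩
        · exact Or.inr ⟨(A.notMem C hC t hts htQ).symm.trans hgt, t, hts, htQ⟩
    have hcard : {C ∈ clusters ℓ ε ε D 𝒞 | CoversSome ℓ ε D (τ i) C}.ncard ≤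
        NL i + (NS i + (E i).ncard) := by
      refine (Set.ncard_le_ncard hsub (Set.toFinite _)).trans ((Set.ncard_union_le _ _).trans ?_)
      exact add_le_add (Set.ncard_image_le (Set.toFinite _)) (Set.ncard_union_le _ _)
    have h1 : ({C ∈ clusters ℓ ε ε D 𝒞 | CoversSome ℓ ε D (τ i) C}.ncard : ℝ) ≤
        NL i + (NS i + (E i).ncard) := by exact_mod_cast hcard
    refine h1.trans ?_
    rw [le_div_iff₀ (by positivity)]
    have h2 : (NL i : ℝ) * ε ≤ 2 * κ + 3 := by
      have := hL i
      rw [← mul_assoc] at this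
      have := le_of_mul_le_mul_right this hD
      linarith
    have h3 : (NL i : ℝ) * ε ^ 3 ≤ 2 * κ + 3 := by
      refine le_trans ?_ h2
      gcongr
      exact pow_le_of_le_one hε.le hε1 (by norm_num)
    have h4 : (NS i : ℝ) * ε ^ 3 ≤ 2 * (NL i * ε ^ 3) := by
      rw [← mul_assoc]
      have := hS i
      gcongr
    have h5 : ((E i).ncard : ℝ) * ε ^ 3 ≤ 4 * κ + 6 := by
      have := hEd i
      rw [← mul_assoc] at this
      have := le_of_mul_le_mul_right this hD
      linarith
    linarith

end Setting

/-- If `D = 0`, then all edges have length `0`, the clusters are the branches at the children of the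
root, and one tour can visit the whole tree. -/
lemma exists_simple_of_zero (hbin : IsBinary T) (hℓ : EdgeNonneg ℓ) (hε : 0 < ε) (hε1 : ε ≤ 1)
    (hclust : IsEdgeClustering ℓ ε ε 0 κ 𝒞) {k : ℕ} {H : Fin k → Set T}
    (hcov : ∀ v, ∃ i, v ∈ H i) (hcost : ∀ i, cost ℓ (H i) ≤ 0) {N : ℝ} (hN : 2 ≤ N) :
    ∃ τ : Fin k → Tour T, Feasible τ ∧ MakespanLE ℓ τ 0 ∧
      HasSimpleStructure ℓ ε ε 0 𝒞 τ (N / ε ^ 3) := by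
  have hwt : ∀ v, wt ℓ v = 0 := by
    intro v
    obtain ⟨i, hi⟩ := hcov v
    refine le_antisymm (le_trans ?_ (hcost i)) (wt_nonneg hℓ v)
    have h1 : wt ℓ v = (H i).indicator (wt ℓ) v := by simp [hi]
    rw [h1]
    exact Finset.single_le_sum (f := (H i).indicator (wt ℓ))
      (fun v _ => Set.indicator_nonneg (fun v _ => wt_nonneg hℓ v) v) (Finset.mem_univ v)
  have hc0 : ∀ A : Set T, cost ℓ A = 0 := fun A =>
    Finset.sum_eq_zero fun v _ => by simp [Set.indicator, hwt]
  have hsmall : ∀ v, ¬ IsSmallLeaf ℓ ε 0 v := by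
    intro v hv
    have := hv.2
    rw [hv.1.condLoad_eq, hc0, mul_zero] at this
    exact lt_irrefl _ this
  have hnoleaf : ∀ W, IsWoollyEdge ℓ ε 0 W → ∀ t ∈ W, ¬ IsLeafEdge ℓ ε 0 t := by
    intro W hW t ht htl
    rcases (hW.mem ht).1 with h | h
    exacts [h.2.not_isLeafEdge htl, hsmall t h]
  have hsub𝒞 : ∀ C ∈ 𝒞, ∀ t ∈ C, ¬ IsLeafEdge ℓ ε 0 t := by
    intro C hC t ht
    obtain ⟨W, hW, -, hsub⟩ := hclust.subedge C hC
    exact hnoleaf W hW t (hsub.2.1 ht)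
  have hchild : ∀ v, IsLeafEdge ℓ ε 0 v → ⊥ ⋖ v := by
    intro v hv
    obtain ⟨a, ha, hav⟩ := exists_child (bot_lt_iff_ne_bot.2 hv.1)
    have hane : a ≠ ⊥ := ha.lt.ne'
    have hac : Condensed ℓ ε 0 a := by
      refine ⟨hane, ?_, Or.inl ha.pred_eq⟩
      rw [branchLoad_eq hane, hc0, mul_zero]
    rcases hav.lt_or_eq with h | rfl
    exacts [absurd h (hv.2.1 a hac), ha]
  obtain ⟨i₀, -⟩ := hcov ⊥
  have htour := fun i : Fin k => exists_tour ℓ (if i = i₀ then Set.univ else {⊥})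
    (by split_ifs <;> simp) (by
      split_ifs
      · exact isLowerSet_univ
      · rintro a b hba rfl
        exact le_bot_iff.1 hba)
  choose τ hτ hlen using htour
  have hmem : ∀ i v, v ∈ (τ i).support ↔ i = i₀ ∨ v = ⊥ := by
    intro i v
    change v ∈ visited (τ i) ↔ _
    rw [hτ]
    split_ifs with h <;> simp [h]
  have hsingle : ∀ C, SingleCoverage ℓ ε 0 τ C := by
    refine fun C => ⟨i₀, ?_⟩
    rintro c ⟨-, t, -, ht, hle⟩ j
    simp [hmem, ne_bot_of_le ht.1 hle]
  refine ⟨τ, fun c _ => ⟨i₀, by simp [hmem]⟩, fun i => ?_, ⟨fun v _ => hsingle _,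
    fun W _ => hsingle _, fun C _ => Or.inl (hsingle _), fun i => ?_⟩⟩
  · rw [hlen, hc0]
  · have hsub : {C ∈ clusters ℓ ε ε 0 𝒞 | CoversSome ℓ ε 0 (τ i) C} ⊆
        (fun w => ({w} : Set T)) '' {v : T | ⊥ ⋖ v} := by
      rintro C ⟨hC, c, ⟨-, t, htC, ht, -⟩, -⟩
      rcases hC with ⟨w, hw, rfl⟩ | hW | hC
      · exact ⟨w, hchild w hw.1, rfl⟩
      · exact absurd ht (hnoleaf C hW.1 t htC)
      · exact absurd ht (hsub𝒞 C hC t htC)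
    have h1 : {C ∈ clusters ℓ ε ε 0 𝒞 | CoversSome ℓ ε 0 (τ i) C}.ncard ≤ 2 :=
      (Set.ncard_le_ncard hsub (Set.toFinite _)).trans
        ((Set.ncard_image_le (Set.toFinite _)).trans (hbin ⊥))
    have h2 : ({C ∈ clusters ℓ ε ε 0 𝒞 | CoversSome ℓ ε 0 (τ i) C}.ncard : ℝ) ≤ 2 := by
      exact_mod_cast h1
    refine h2.trans (hN.trans ?_)
    exact le_div_self (by linarith) (by positivity) (pow_le_one₀ hε.le hε1)

end Makespan

theorem mainTheorem2 (κ : ℝ) (hκ : 1 ≤ κ) :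
    ∃ c₁ c₂ : ℝ, 0 < c₁ ∧ 0 < c₂ ∧
      ∀ (T : RootedTree.{u}) [Fintype T] (ℓ : Sym2 T → ℝ) (k : ℕ) (D ε : ℝ) (𝒞 : Set (Set T)),
        Makespan.IsBinary T →
        (∀ e ∈ (SimpleGraph.hasse T).edgeSet, 0 ≤ ℓ e) →
        0 ≤ D → 0 < ε → ε ≤ 1 →
        Makespan.IsWoollyTree ℓ ε D →
        Makespan.IsEdgeClustering ℓ ε ε D κ 𝒞 →
        (∃ τ : Fin k → Makespan.Tour T,
          Makespan.Feasible τ ∧ Makespan.MakespanLE ℓ τ D) →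
        ∃ τ : Fin k → Makespan.Tour T,
          Makespan.Feasible τ ∧ Makespan.MakespanLE ℓ τ ((1 + c₁ * ε) * D) ∧
          Makespan.HasSimpleStructure ℓ ε ε D 𝒞 τ (c₂ / ε ^ 3) := by
  refine ⟨4 * κ + 5, 10 * κ + 15, by linarith, by linarith, ?_⟩
  intro T _ ℓ k D ε 𝒞 hbin hℓ hD hε hε1 hwool hclust ⟨σ, hfeas, hspan⟩
  have hlow : ∀ i, IsLowerSet (Makespan.visited (σ i)) := fun i _ _ hle hv =>
    Makespan.support_lower (σ i) hle hv
  have hcov : ∀ v, ∃ i, v ∈ Makespan.visited (σ i) := by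
    intro v
    obtain ⟨c, hc, hle⟩ := Makespan.exists_isMax_ge v
    obtain ⟨i, hi⟩ := hfeas c hc
    exact ⟨i, hlow i hle hi⟩
  have hcost : ∀ i, Makespan.cost ℓ (Makespan.visited (σ i)) ≤ D := fun i =>
    (Makespan.cost_visited_le hℓ (σ i)).trans (hspan i)
  rcases hD.eq_or_lt with rfl | hD
  · rw [mul_zero]
    exact Makespan.exists_simple_of_zero hbin hℓ hε hε1 hclust hcov hcost (by linarith)
  · have S : Makespan.Setting ℓ ε D κ 𝒞 := ⟨hbin, hℓ, hD, hε, hε1, hwool, hclust⟩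
    exact S.exists_simple hκ hlow hcov hcost
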